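/- Let $\mathbb F$ be a field of characteristic $p>3$, let $m,n\ge 3$ be integers and let $\underline t=(t_1,\dots,t_m)$ be a tuple of positive integers. Put $Y_0=\{1,\dots,m\}$, $Y_1=\{m+1,\dots,m+n\}$, $Y=Y_0\cup Y_1$, and $\tau(r)=\bar 0$ for $r\in Y_0$, $\tau(r)=\bar 1$ for $r\in Y_1$. Let $\mathfrak A(m,n)=\mathfrak A(m)\otimes\Lambda(n)$, where $\mathfrak A(m)$ is the (purely even) divided power algebra with basis $x^{(\alpha)}$, $\alpha\in\mathbb N_0^m$, and product $x^{(\alpha)}x^{(\beta)}=\prod_i\binom{\alpha_i+\beta_i}{\alpha_i}x^{(\alpha+\beta)}$, and $\Lambda(n)$ is the exterior superalgebra in the odd variables $x_{m+1},\dots,x_{m+n}$; for $i\in Y_0$ write $x_i=x^{(\varepsilon_i)}$. Let $D_r$ ($r\in Y$) be the superderivation of $\mathfrak A(m,n)$ of parity $\tau(r)$ that acts on $\mathfrak A(m)$ by $x^{(\alpha)}\mapsto x^{(\alpha-\varepsilon_r)}$ (zero if $\alpha_r=0$) and kills $\Lambda(n)$ if $r\in Y_0$, and that is $\partial/\partial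 x_r$ (left derivative) on $\Lambda(n)$ and kills $\mathfrak A(m)$ if $r\in Y_1$. Let $\mathfrak A(m,n;\underline t)$ be the span of all $x^{(\alpha)}u$ with $0\le\alpha_i\le p^{t_i}-1$ for all $i$ and $u\in\Lambda(n)$, let $W$ be the Lie superalgebra of all operators $\sum_{r\in Y}f_rD_r$ on $\mathfrak A(m,n)$ with $f_r\in\mathfrak A(m,n;\underline t)$, and let $\mathrm{div}(\sum_r f_rD_r)=\sum_r(-1)^{\tau(r)\mathrm p(f_r)}D_r(f_r)$, where $\mathrm p$ is the parity. Let $S=S(m,n;\underline t)$ be the span of all $$D_{rs}(f)=(-1)^{\tau(r)\tau(s)}D_r(f)D_s-(-1)^{(\tau(r)+\tau(s))\mathrm p(f)}D_s(f)D_r,\qquad r,s\in Y,\ f\in\mathfrak A(m,n;\underline t),$$ let $\overline S=\{D\in W\mid \mathrm{div}(D)=0\}$, let $\mathcal S$ and $\overline{\mathcal S}$ be the even parts of $S$ and $\overline S$, and let $\mathcal T=\mathrm{span}_{\mathbb F}\{x_rD_r\mid r\in Y\}$ be the canonical torus. Then $\mathcal S$ is a Lie algebra under the commutator, and its derivation algebra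 is the internal direct sum $$\mathrm{Der}(\mathcal S)=\mathrm{ad}(\overline{\mathcal S}+\mathcal T)\ \oplus\ \mathrm{span}_{\mathbb F}\{(\mathrm{ad}\,D_i)^{p^{r}}\mid i\in Y_0,\ 1\le r<t_i\},$$ where $\mathrm{ad}\,E$ and $(\mathrm{ad}\,D_i)^{p^r}$ are restricted to $\mathcal S$. -/

import Mathlib

open scoped TensorProduct

attribute [local instance] LieRing.ofAssociativeRing

noncomputable section

/-! ### The divided power algebra -/

/-- The divided power algebra `𝔄(m)` over `F`: the vector space with basis
`x^(α)`, `α ∈ ℕ^m`. -/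
def DividedPower (F : Type*) [Field F] (m : ℕ) : Type _ := (Fin m → ℕ) →₀ F

namespace DividedPower

variable {F : Type*} [Field F] {m : ℕ}

instance : AddCommGroup (DividedPower F m) := inferInstanceAs (AddCommGroup ((Fin m → ℕ) →₀ F))

instance : Module F (DividedPower F m) := inferInstanceAs (Module F ((Fin m → ℕ) →₀ F))

variable (F m) in
/-- The basis of all `x^(α)`. -/
def basis : Module.Basis (Fin m → ℕ) F (DividedPower F m) :=
  Module.Basis.ofRepr (LinearEquiv.refl F ((Fin m → ℕ) →₀ F))

variable (F) in
/-- The divided power monomial `x^(α)`. -/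
def mono (α : Fin m → ℕ) : DividedPower F m := basis F m α

variable (F m) in
/-- The multiplication, `x^(α) x^(β) = (∏ i, binom(α i + β i, α i)) x^(α + β)`. -/
def mulHom : DividedPower F m →ₗ[F] DividedPower F m →ₗ[F] DividedPower F m :=
  (basis F m).constr F fun α => (basis F m).constr F fun β =>
    ((∏ i, (α i + β i).choose (α i) : ℕ) : F) • mono F (α + β)

instance : Mul (DividedPower F m) := ⟨fun a b => mulHom F m a b⟩

instance : One (DividedPower F m) := ⟨mono F 0⟩

theorem mul_def (a b : DividedPower F m) : a * b = mulHom F m a b := rfl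

theorem one_def : (1 : DividedPower F m) = mono F 0 := rfl

theorem mono_mul_mono (α β : Fin m → ℕ) :
    mono F α * mono F β = ((∏ i, (α i + β i).choose (α i) : ℕ) : F) • mono F (α + β) := by
  rw [mul_def, mulHom]
  unfold mono
  rw [Module.Basis.constr_basis, Module.Basis.constr_basis]

theorem ind {P : DividedPower F m → Prop} (h : ∀ α, P (mono F α)) (h0 : P 0)
    (ha : ∀ a b, P a → P b → P (a + b)) (hs : ∀ (c : F) a, P a → P (c • a)) (a) : P a := by
  have : a ∈ Submodule.span F (Set.range (basis F m)) := by
    rw [(basis F m).span_eq]; trivial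
  induction this using Submodule.span_induction with
  | mem x hx => obtain ⟨α, rfl⟩ := hx; exact h α
  | zero => exact h0
  | add x y _ _ hx hy => exact ha _ _ hx hy
  | smul c x _ hx => exact hs _ _ hx

theorem add_mul_aux (a b c : DividedPower F m) : (a + b) * c = a * c + b * c := by
  simp [mul_def]

theorem mul_add_aux (a b c : DividedPower F m) : a * (b + c) = a * b + a * c := by
  simp [mul_def]

theorem smul_mul_aux (r : F) (a b : DividedPower F m) : (r • a) * b = r • (a * b) := by
  simp [mul_def]

theorem mul_smul_aux (r : F) (a b : DividedPower F m) : a * (r • b) = r • (a * b) := by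
  simp [mul_def]

theorem zero_mul_aux (a : DividedPower F m) : 0 * a = 0 := by simp [mul_def]

theorem mul_zero_aux (a : DividedPower F m) : a * 0 = 0 := by simp [mul_def]

theorem mul_comm_aux (a b : DividedPower F m) : a * b = b * a := by
  induction a using ind with
  | h0 => rw [zero_mul_aux, mul_zero_aux]
  | ha a a' h h' => rw [add_mul_aux, mul_add_aux, h, h']
  | hs c a h => rw [smul_mul_aux, mul_smul_aux, h]
  | h α =>
    induction b using ind with
    | h0 => rw [zero_mul_aux, mul_zero_aux]
    | ha a a' h h' => rw [add_mul_aux, mul_add_aux, h, h']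
    | hs c a h => rw [smul_mul_aux, mul_smul_aux, h]
    | h β =>
      rw [mono_mul_mono, mono_mul_mono, add_comm β α]
      congr 2
      refine Finset.prod_congr rfl fun i _ => ?_
      rw [add_comm (β i), ← Nat.choose_symm_add]

theorem mul_assoc_aux (a b c : DividedPower F m) : a * b * c = a * (b * c) := by
  induction a using ind with
  | h0 => simp only [zero_mul_aux]
  | ha a a' h h' => simp only [add_mul_aux, h, h']
  | hs c a h => simp only [smul_mul_aux, h]
  | h α =>
    induction b using ind with
    | h0 => simp only [zero_mul_aux, mul_zero_aux]
    | ha a a' h h' => simp only [add_mul_aux, mul_add_aux, h, h']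
    | hs c a h => simp only [smul_mul_aux, mul_smul_aux, h]
    | h β =>
      induction c using ind with
      | h0 => simp only [mul_zero_aux]
      | ha a a' h h' => simp only [mul_add_aux, h, h']
      | hs c a h => simp only [mul_smul_aux, h]
      | h γ =>
        rw [mono_mul_mono, smul_mul_aux, mono_mul_mono, mono_mul_mono, mul_smul_aux,
          mono_mul_mono, smul_smul, smul_smul, add_assoc, ← Nat.cast_mul, ← Nat.cast_mul,
          ← Finset.prod_mul_distrib, ← Finset.prod_mul_distrib]
        congr 2
        refine Finset.prod_congr rfl fun i _ => ?_
        have h := Nat.choose_mul (n := α i + β i + γ i) (k := α i + β i) (s := α i)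
        have e1 : α i + β i + γ i - α i = β i + γ i := by omega
        have e2 : α i + β i - α i = β i := by omega
        rw [e1, e2] at h
        replace h := h (by omega)
        simp only [Pi.add_apply]
        rw [mul_comm, h, add_assoc, mul_comm]

theorem one_mul_aux (a : DividedPower F m) : 1 * a = a := by
  induction a using ind with
  | h0 => rw [mul_zero_aux]
  | ha a a' h h' => rw [mul_add_aux, h, h']
  | hs c a h => rw [mul_smul_aux, h]
  | h α => rw [one_def, mono_mul_mono]; simp

instance : CommRing (DividedPower F m) :=
  { (inferInstance : AddCommGroup (DividedPower F m)),
    (inferInstance : Mul (DividedPower F m)), (inferInstance : One (DividedPower F m)) with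
    left_distrib := mul_add_aux
    right_distrib := add_mul_aux
    zero_mul := zero_mul_aux
    mul_zero := mul_zero_aux
    mul_assoc := mul_assoc_aux
    one_mul := one_mul_aux
    mul_one := fun a => by rw [mul_comm_aux, one_mul_aux]
    mul_comm := mul_comm_aux }

instance : Algebra F (DividedPower F m) := Algebra.ofModule smul_mul_aux mul_smul_aux

/-- The linear map with `x^(α) ↦ x^(α - ε_i)`, where `x^(α - ε_i) = 0` if `α i = 0`. -/
def partialHom (i : Fin m) : DividedPower F m →ₗ[F] DividedPower F m :=
  (basis F m).constr F fun α => if α i = 0 then 0 else mono F (α - Pi.single i 1)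

theorem partialHom_mono (i : Fin m) (α : Fin m → ℕ) :
    partialHom i (mono F α) = if α i = 0 then 0 else mono F (α - Pi.single i 1) := by
  rw [partialHom, mono, Module.Basis.constr_basis]

theorem partialHom_comm (i j : Fin m) (a : DividedPower F m) :
    partialHom i (partialHom j a) = partialHom j (partialHom i a) := by
  by_cases hij : i = j
  · rw [hij]
  induction a using ind with
  | h0 => simp
  | ha a a' h h' => simp [h, h']
  | hs c a h => simp [h]
  | h α =>
    have hji : j ≠ i := fun h => hij h.symm
    rw [partialHom_mono, partialHom_mono]
    by_cases hi : α i = 0 <;> by_cases hj : α j = 0 <;>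
      simp [hi, hj, partialHom_mono, hij, hji, tsub_right_comm]

theorem partialHom_mul (i : Fin m) (a b : DividedPower F m) :
    partialHom i (a * b) = partialHom i a * b + a * partialHom i b := by
  induction a using ind with
  | h0 => simp
  | ha a a' h h' => simp only [add_mul, map_add, h, h']; abel
  | hs c a h => simp only [smul_mul_assoc, map_smul, h, smul_add]
  | h α =>
    induction b using ind with
    | h0 => simp
    | ha a a' h h' => simp only [mul_add, map_add, h, h']; abel
    | hs c a h => simp only [mul_smul_comm, map_smul, h, smul_add]
    | h β =>
      have split : ∀ f : Fin m → ℕ, ∏ k, f k = f i * ∏ k ∈ Finset.univ.erase i, f k :=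
        fun f => (Finset.mul_prod_erase _ f (Finset.mem_univ i)).symm
      have hL : ∀ α β γ δ : Fin m → ℕ, (∀ k, k ≠ i → α k = γ k) → (∀ k, k ≠ i → β k = δ k) →
          ∏ k ∈ Finset.univ.erase i, (α k + β k).choose (α k)
            = ∏ k ∈ Finset.univ.erase i, (γ k + δ k).choose (γ k) := by
        intro α β γ δ h1 h2
        refine Finset.prod_congr rfl fun k hk => ?_
        rw [h1 k (Finset.ne_of_mem_erase hk), h2 k (Finset.ne_of_mem_erase hk)]
      have hne : ∀ (α : Fin m → ℕ) k, k ≠ i → (α - Pi.single i 1 : Fin m → ℕ) k = α k := by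
        intro α k hk; simp [hk]
      rw [mono_mul_mono, map_smul, partialHom_mono, partialHom_mono, partialHom_mono]
      by_cases ha : α i = 0 <;> by_cases hb : β i = 0
      · simp [ha, hb]
      · have e : α + (β - Pi.single i 1) = α + β - Pi.single i 1 := by
          ext k; by_cases hk : k = i
          · subst hk; simp; omega
          · simp [hk]
        simp only [ha, hb, Pi.add_apply, if_true, if_false, zero_mul, zero_add, mono_mul_mono, e]
        congr 2
        rw [split, split, hL α β α (β - Pi.single i 1) (fun _ _ => rfl)
          (fun k hk => (hne β k hk).symm)]
        simp [ha]
      · have e : (α - Pi.single i 1) + β = α + β - Pi.single i 1 := by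
          ext k; by_cases hk : k = i
          · subst hk; simp; omega
          · simp [hk]
        simp only [ha, hb, Pi.add_apply, if_true, if_false, mul_zero, add_zero, mono_mul_mono, e]
        congr 2
        rw [split, split, hL α β (α - Pi.single i 1) β (fun k hk => (hne α k hk).symm)
          (fun _ _ => rfl)]
        simp [hb]
      · have e : α + (β - Pi.single i 1) = α + β - Pi.single i 1 := by
          ext k; by_cases hk : k = i
          · subst hk; simp; omega
          · simp [hk]
        have e' : (α - Pi.single i 1) + β = α + β - Pi.single i 1 := by
          ext k; by_cases hk : k = i
          · subst hk; simp; omega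
          · simp [hk]
        have hab : ¬ (α i + β i = 0) := by omega
        simp only [ha, hb, hab, Pi.add_apply, if_false, mono_mul_mono, e, e', ← add_smul,
          ← Nat.cast_add]
        congr 2
        obtain ⟨γ, hγ⟩ : ∃ γ : Fin m → ℕ, γ = α - Pi.single i 1 := ⟨_, rfl⟩
        obtain ⟨δ, hδ⟩ : ∃ δ : Fin m → ℕ, δ = β - Pi.single i 1 := ⟨_, rfl⟩
        have hγi : γ i = α i - 1 := by rw [hγ]; simp
        have hδi : δ i = β i - 1 := by rw [hδ]; simp
        rw [← hγ, ← hδ, split, split fun k => (γ k + β k).choose (γ k),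
          split fun k => (α k + δ k).choose (α k),
          ← hL α β α δ (fun _ _ => rfl) (fun k hk => by rw [hδ, hne β k hk]),
          ← hL α β γ β (fun k hk => by rw [hγ, hne α k hk]) (fun _ _ => rfl),
          ← add_mul, hγi, hδi]
        congr 1
        obtain ⟨x, hx⟩ := Nat.exists_eq_succ_of_ne_zero ha
        obtain ⟨y, hy⟩ := Nat.exists_eq_succ_of_ne_zero hb
        simp only [hx, hy, Nat.succ_eq_add_one, Nat.add_sub_cancel]
        have : x + 1 + (y + 1) = (x + y + 1) + 1 := by ring
        rw [this, Nat.choose_succ_succ]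
        congr 2
        ring

end DividedPower

/-! ### The superalgebra `𝔄(m, n)` -/

/-- The superalgebra `𝔄(m, n) = 𝔄(m) ⊗ Λ(n)`. Since `𝔄(m)` is purely even, the multiplication of
the super tensor product is the usual `(a ⊗ u)(b ⊗ v) = ab ⊗ uv`. -/
abbrev SuperAlg (F : Type*) [Field F] (m n : ℕ) : Type _ :=
  DividedPower F m ⊗[F] ExteriorAlgebra F (Fin n → F)

namespace SuperAlg

variable {F : Type*} [Field F] {m n : ℕ}

/-- The parity `τ` of an index; the index set `Y = Y₀ ∪ Y₁` is `Fin m ⊕ Fin n`. -/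
def tau : Fin m ⊕ Fin n → ℕ
  | .inl _ => 0
  | .inr _ => 1

variable (F) in
/-- The generators `x_r`, `r ∈ Y`. -/
def x : Fin m ⊕ Fin n → SuperAlg F m n
  | .inl i => DividedPower.mono F (Pi.single i 1) ⊗ₜ 1
  | .inr k => 1 ⊗ₜ ExteriorAlgebra.ι F (Pi.single k 1)

variable (F m n) in
/-- The homogeneous component of parity `θ`. -/
def superPart (θ : ZMod 2) : Submodule F (SuperAlg F m n) :=
  Submodule.span F {f | ∃ (a : DividedPower F m),
    ∃ u ∈ CliffordAlgebra.evenOdd (0 : QuadraticForm F (Fin n → F)) θ, f = a ⊗ₜ u}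

variable (F m n) in
/-- The parity automorphism: `f ↦ (-1)^p(f) f` on homogeneous `f`. -/
def parity : SuperAlg F m n →ₐ[F] SuperAlg F m n :=
  Algebra.TensorProduct.map (AlgHom.id F _)
    (CliffordAlgebra.involute : ExteriorAlgebra F (Fin n → F) →ₐ[F] ExteriorAlgebra F (Fin n → F))

/-- The map `f ↦ (-1)^(e p(f)) f` on homogeneous `f`. -/
def sgn (e : ℕ) : SuperAlg F m n →ₗ[F] SuperAlg F m n := (parity F m n).toLinearMap ^ e

variable (F) in
/-- The superderivations `D_r`, `r ∈ Y`: for `r ∈ Y₀` the map `x^(α) x^u ↦ x^(α - ε_r) x^u`, and for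
`r ∈ Y₁` the map `x^(α) x^u ↦ x^(α) ∂x^u/∂x_r` with the left derivative on the exterior algebra,
which is contraction with the `r`-th coordinate form. -/
def D : Fin m ⊕ Fin n → Module.End F (SuperAlg F m n)
  | .inl i => LinearMap.rTensor _ (DividedPower.partialHom i)
  | .inr k => LinearMap.lTensor _ (CliffordAlgebra.contractLeft (LinearMap.proj k))

/-- The operator `∑ r, f_r D_r` on `𝔄(m, n)`. -/
def vf : (Fin m ⊕ Fin n → SuperAlg F m n) →ₗ[F] Module.End F (SuperAlg F m n) where
  toFun f := ∑ r, LinearMap.mulLeft F (f r) ∘ₗ D F r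
  map_add' f g := by
    rw [← Finset.sum_add_distrib]
    refine Finset.sum_congr rfl fun r _ => ?_
    refine LinearMap.ext fun g => ?_
    simp [add_mul]
  map_smul' c f := by
    rw [Finset.smul_sum]
    refine Finset.sum_congr rfl fun r _ => ?_
    refine LinearMap.ext fun g => ?_
    simp [smul_mul_assoc]

/-- The divergence of `∑ r, f_r D_r`, that is, `∑ r, (-1)^(τ(r) p(f_r)) D_r(f_r)`. -/
def div : (Fin m ⊕ Fin n → SuperAlg F m n) →ₗ[F] SuperAlg F m n :=
  ∑ r, D F r ∘ₗ sgn (tau r) ∘ₗ LinearMap.proj r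

/-- `D_rs(f) = (-1)^(τ(r) τ(s)) D_r(f) D_s - (-1)^((τ(r) + τ(s)) p(f)) D_s(f) D_r`. -/
def Drs (r s : Fin m ⊕ Fin n) (f : SuperAlg F m n) : Module.End F (SuperAlg F m n) :=
  (-1 : F) ^ (tau r * tau s) • (LinearMap.mulLeft F (D F r f) ∘ₗ D F s)
    - LinearMap.mulLeft F (D F s (sgn (tau r + tau s) f)) ∘ₗ D F r

variable (F n) in
/-- `𝔄(m, n; t)`, spanned by all `x^(α) u` with `α_i ≤ π_i = p^(t_i) - 1` and `u ∈ Λ(n)`. -/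
def trunc (p : ℕ) (t : Fin m → ℕ) : Submodule F (SuperAlg F m n) :=
  Submodule.span F {f | ∃ α : Fin m → ℕ, (∀ i, α i ≤ p ^ t i - 1) ∧
    ∃ u : ExteriorAlgebra F (Fin n → F), f = DividedPower.mono F α ⊗ₜ u}

variable (F n) in
/-- Families `(f_r)` of elements of `𝔄(m, n; t)`. -/
def coeffs (p : ℕ) (t : Fin m → ℕ) : Submodule F (Fin m ⊕ Fin n → SuperAlg F m n) :=
  Submodule.pi Set.univ fun _ => trunc F n p t

variable (F n) in
/-- The special superalgebra `S(m, n; t)`, spanned by all `D_rs(f)` with `f ∈ 𝔄(m, n; t)`. -/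
def S (p : ℕ) (t : Fin m → ℕ) : Submodule F (Module.End F (SuperAlg F m n)) :=
  Submodule.span F {E | ∃ r s, ∃ f ∈ trunc F n p t, E = Drs r s f}

variable (F n) in
/-- The superalgebra of all elements `∑ r, f_r D_r` of `W(m, n; t)`, where `f_r ∈ 𝔄(m, n; t)`, with
divergence zero. -/
def Sbar (p : ℕ) (t : Fin m → ℕ) : Submodule F (Module.End F (SuperAlg F m n)) :=
  (coeffs F n p t ⊓ LinearMap.ker div).map vf

variable (F m n) in
/-- The even linear endomorphisms of `𝔄(m, n)`: those that preserve the parity. -/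
def evenEnd : Submodule F (Module.End F (SuperAlg F m n)) where
  carrier := {E | ∀ θ, ∀ f ∈ superPart F m n θ, E f ∈ superPart F m n θ}
  add_mem' h h' θ f hf := add_mem (h θ f hf) (h' θ f hf)
  zero_mem' _ _ _ := zero_mem _
  smul_mem' c _ h θ f hf := Submodule.smul_mem _ c (h θ f hf)

variable (F m n) in
/-- The canonical torus, spanned by all `Γ_r = x_r D_r`, `r ∈ Y`. -/
def torus : Submodule F (Module.End F (SuperAlg F m n)) :=
  Submodule.span F (Set.range fun r => LinearMap.mulLeft F (x F r) ∘ₗ D F r)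

/-! #### The even part of `S(m, n; t)` is closed under the commutator -/

theorem sgn_zero (f : SuperAlg F m n) : sgn 0 f = f := by simp [sgn]

theorem sgn_one (f : SuperAlg F m n) : sgn 1 f = parity F m n f := by simp [sgn]

theorem sgn_two (f : SuperAlg F m n) : sgn 2 f = f := by
  have : (parity F m n).comp (parity F m n) = AlgHom.id F _ := by
    unfold parity
    rw [← Algebra.TensorProduct.map_comp, CliffordAlgebra.involute_comp_involute]
    simp
  simpa [sgn, pow_two] using DFunLike.congr_fun this f

theorem sgn_mul (e : ℕ) (f g : SuperAlg F m n) : sgn e (f * g) = sgn e f * sgn e g := by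
  induction e generalizing f g with
  | zero => simp [sgn_zero]
  | succ e ih =>
    have h : ∀ f : SuperAlg F m n, sgn (e + 1) f = sgn e (parity F m n f) := by
      intro f; simp [sgn, pow_succ]
    rw [h, h, h, map_mul, ih]

theorem parity_tmul (a : DividedPower F m) (u : ExteriorAlgebra F (Fin n → F)) :
    parity F m n (a ⊗ₜ u) = a ⊗ₜ CliffordAlgebra.involute u := by
  simp [parity]

theorem D_inl (i : Fin m) (a : DividedPower F m) (u : ExteriorAlgebra F (Fin n → F)) :
    D F (.inl i) (a ⊗ₜ u) = DividedPower.partialHom i a ⊗ₜ u := rfl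

theorem D_inr (k : Fin n) (a : DividedPower F m) (u : ExteriorAlgebra F (Fin n → F)) :
    D F (.inr k) (a ⊗ₜ u) = a ⊗ₜ CliffordAlgebra.contractLeft (LinearMap.proj k) u := rfl

theorem contract_mul (d : Module.Dual F (Fin n → F)) (u v : ExteriorAlgebra F (Fin n → F)) :
    CliffordAlgebra.contractLeft d (u * v) = CliffordAlgebra.contractLeft d u * v
      + CliffordAlgebra.involute u * CliffordAlgebra.contractLeft d v := by
  induction u using CliffordAlgebra.induction generalizing v with
  | algebraMap r => simp [CliffordAlgebra.contractLeft_algebraMap_mul]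
  | ι y =>
    rw [CliffordAlgebra.contractLeft_ι_mul, CliffordAlgebra.contractLeft_ι,
      CliffordAlgebra.involute_ι, Algebra.smul_def, neg_mul, sub_eq_add_neg]
  | mul a b ha hb => rw [mul_assoc, ha, hb, ha, map_mul]; noncomm_ring
  | add a b ha hb => simp only [add_mul, map_add, ha, hb]; abel

theorem involute_contract (d : Module.Dual F (Fin n → F)) (u : ExteriorAlgebra F (Fin n → F)) :
    CliffordAlgebra.involute (CliffordAlgebra.contractLeft d u)
      = - CliffordAlgebra.contractLeft d (CliffordAlgebra.involute u) := by
  induction u using CliffordAlgebra.induction with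
  | algebraMap r => simp
  | ι y => simp
  | mul a b ha hb => simp only [contract_mul, map_mul, map_add, ha, hb]; noncomm_ring
  | add a b ha hb => simp only [map_add, ha, hb]; abel

theorem ι_mul (y : Fin n → F) (v : ExteriorAlgebra F (Fin n → F)) :
    ExteriorAlgebra.ι F y * v = CliffordAlgebra.involute v * ExteriorAlgebra.ι F y := by
  induction v using CliffordAlgebra.induction with
  | algebraMap r => rw [AlgHom.commutes]; exact (Algebra.commutes r _).symm
  | ι z =>
    rw [CliffordAlgebra.involute_ι, neg_mul]
    exact eq_neg_of_add_eq_zero_left (ExteriorAlgebra.ι_add_mul_swap y z)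
  | mul a b ha hb => rw [← mul_assoc, ha, mul_assoc, hb, map_mul, mul_assoc]
  | add a b ha hb => rw [mul_add, map_add, add_mul, ha, hb]

theorem ext_even_mul (u : ExteriorAlgebra F (Fin n → F))
    (hu : u ∈ CliffordAlgebra.evenOdd (0 : QuadraticForm F (Fin n → F)) 0)
    (v : ExteriorAlgebra F (Fin n → F)) : u * v = v * u := by
  induction u, hu using CliffordAlgebra.even_induction with
  | algebraMap r => exact Algebra.commutes r v
  | add a b _ _ ha hb => rw [add_mul, mul_add, ha, hb]
  | ι_mul_ι_mul y z a _ ha =>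
    rw [mul_assoc, ha]
    have h1 := ι_mul y (ExteriorAlgebra.ι F z * v)
    have h2 := ι_mul z v
    change ExteriorAlgebra.ι F y * ExteriorAlgebra.ι F z * (v * a)
      = v * (ExteriorAlgebra.ι F y * ExteriorAlgebra.ι F z * a)
    have h3 := ι_mul y (CliffordAlgebra.involute v)
    rw [CliffordAlgebra.involute_involute] at h3
    calc _ = ExteriorAlgebra.ι F y * (ExteriorAlgebra.ι F z * v) * a := by noncomm_ring
      _ = (ExteriorAlgebra.ι F y * CliffordAlgebra.involute v) * ExteriorAlgebra.ι F z * a := by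
        rw [h2]; noncomm_ring
      _ = _ := by rw [h3]; noncomm_ring

theorem ext_odd_mul (u : ExteriorAlgebra F (Fin n → F))
    (hu : u ∈ CliffordAlgebra.evenOdd (0 : QuadraticForm F (Fin n → F)) 1)
    (v : ExteriorAlgebra F (Fin n → F)) : u * v = CliffordAlgebra.involute v * u := by
  induction u, hu using CliffordAlgebra.odd_induction with
  | ι y => exact ι_mul y v
  | add a b _ _ ha hb => rw [add_mul, mul_add, ha, hb]
  | ι_mul_ι_mul y z a _ ha =>
    rw [mul_assoc, ha, ← mul_assoc,
      ext_even_mul _ (CliffordAlgebra.ι_mul_ι_mem_evenOdd_zero _ y z), mul_assoc]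

theorem superPart_ind {θ : ZMod 2} {P : SuperAlg F m n → Prop}
    (h : ∀ a, ∀ u ∈ CliffordAlgebra.evenOdd (0 : QuadraticForm F (Fin n → F)) θ, P (a ⊗ₜ u))
    (h0 : P 0) (ha : ∀ a b, P a → P b → P (a + b)) (hs : ∀ (c : F) a, P a → P (c • a))
    {f : SuperAlg F m n} (hf : f ∈ superPart F m n θ) : P f := by
  unfold superPart at hf
  induction hf using Submodule.span_induction with
  | mem f hf => obtain ⟨a, u, hu, rfl⟩ := hf; exact h a u hu
  | zero => exact h0
  | add a b _ _ h1 h2 => exact ha a b h1 h2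
  | smul c a _ h1 => exact hs c a h1

theorem sgn_of_mem (e : ℕ) (r : Fin m ⊕ Fin n) {f : SuperAlg F m n}
    (hf : f ∈ superPart F m n (tau r)) : sgn e f = (-1 : F) ^ (e * tau r) • f := by
  have key : parity F m n f = (-1 : F) ^ tau r • f := by
    refine superPart_ind (P := fun f => parity F m n f = (-1 : F) ^ tau r • f) ?_ ?_ ?_ ?_ hf
    · intro a u hu
      rw [parity_tmul]
      cases r with
      | inl i =>
        simp only [tau, Nat.cast_zero] at hu
        rw [CliffordAlgebra.involute_eq_of_mem_even hu]; simp [tau]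
      | inr i =>
        simp only [tau, Nat.cast_one] at hu
        rw [CliffordAlgebra.involute_eq_of_mem_odd hu]; simp [tau, TensorProduct.tmul_neg]
    · simp
    · intro a b ha hb; rw [map_add, ha, hb, smul_add]
    · intro c a ha; rw [map_smul, ha, smul_comm]
  induction e with
  | zero => simp [sgn_zero]
  | succ e ih =>
    have h : sgn (e + 1) f = sgn e (parity F m n f) := by simp [sgn, pow_succ]
    rw [h, key, map_smul, ih, smul_smul, ← pow_add]
    congr 2; ring

theorem mul_of_mem (r : Fin m ⊕ Fin n) {f : SuperAlg F m n}
    (hf : f ∈ superPart F m n (tau r)) (g : SuperAlg F m n) : f * g = sgn (tau r) g * f := by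
  refine superPart_ind (P := fun f => f * g = sgn (tau r) g * f) ?_ ?_ ?_ ?_ hf
  · intro a u hu
    induction g using TensorProduct.induction_on with
    | zero => simp
    | add g g' h h' => rw [mul_add, map_add, add_mul, h, h']
    | tmul b v =>
      cases r with
      | inl i =>
        simp only [tau, Nat.cast_zero] at hu
        simp only [tau, sgn_zero, Algebra.TensorProduct.tmul_mul_tmul]
        rw [ext_even_mul u hu, mul_comm a]
      | inr i =>
        simp only [tau, Nat.cast_one] at hu
        simp only [tau, sgn_one, parity_tmul, Algebra.TensorProduct.tmul_mul_tmul]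
        rw [ext_odd_mul u hu, mul_comm a]
  · simp
  · intro a b ha hb; rw [add_mul, mul_add, ha, hb]
  · intro c a ha; rw [smul_mul_assoc, mul_smul_comm, ha]

theorem swap_of_mem (r s : Fin m ⊕ Fin n) {f g : SuperAlg F m n}
    (hf : f ∈ superPart F m n (tau r)) (hg : g ∈ superPart F m n (tau s)) :
    f * g = (-1 : F) ^ (tau r * tau s) • (g * f) := by
  rw [mul_of_mem r hf, sgn_of_mem _ s hg, smul_mul_assoc]

theorem D_mul (r : Fin m ⊕ Fin n) (f g : SuperAlg F m n) :
    D F r (f * g) = D F r f * g + sgn (tau r) f * D F r g := by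
  induction f using TensorProduct.induction_on with
  | zero => simp
  | add f f' h h' => simp only [add_mul, map_add, h, h']; abel
  | tmul a u =>
    induction g using TensorProduct.induction_on with
    | zero => simp
    | add g g' h h' => simp only [mul_add, map_add, h, h']; abel
    | tmul b v =>
      cases r with
      | inl i =>
        simp only [tau, sgn_zero, D_inl, Algebra.TensorProduct.tmul_mul_tmul,
          DividedPower.partialHom_mul, TensorProduct.add_tmul]
      | inr k =>
        simp only [tau, sgn_one, D_inr, parity_tmul, Algebra.TensorProduct.tmul_mul_tmul,
          contract_mul, TensorProduct.tmul_add]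

theorem D_comm (r s : Fin m ⊕ Fin n) (f : SuperAlg F m n) :
    D F r (D F s f) = (-1 : F) ^ (tau r * tau s) • D F s (D F r f) := by
  induction f using TensorProduct.induction_on with
  | zero => simp
  | add f f' h h' => simp only [map_add, smul_add, h, h']
  | tmul a u =>
    cases r <;> cases s <;> simp only [D_inl, D_inr, tau, mul_zero, pow_zero, one_smul,
      mul_one, pow_one]
    · rw [DividedPower.partialHom_comm]
    · rw [CliffordAlgebra.contractLeft_comm, TensorProduct.tmul_neg, neg_one_smul]

theorem sgn_D (e : ℕ) (r : Fin m ⊕ Fin n) (f : SuperAlg F m n) :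
    sgn e (D F r f) = (-1 : F) ^ (e * tau r) • D F r (sgn e f) := by
  have key : ∀ f, parity F m n (D F r f) = (-1 : F) ^ tau r • D F r (parity F m n f) := by
    intro f
    induction f using TensorProduct.induction_on with
    | zero => simp
    | add f f' h h' => simp only [map_add, smul_add, h, h']
    | tmul a u =>
      cases r with
      | inl i => simp [D_inl, parity_tmul, tau]
      | inr k => simp [D_inr, parity_tmul, tau, involute_contract, TensorProduct.tmul_neg]
  induction e generalizing f with
  | zero => simp [sgn_zero]
  | succ e ih =>
    have h : ∀ f : SuperAlg F m n, sgn (e + 1) f = sgn e (parity F m n f) := by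
      intro f; simp [sgn, pow_succ]
    rw [h, key, map_smul, ih, smul_smul, ← h, ← pow_add]
    congr 2; ring

theorem D_x (r s : Fin m ⊕ Fin n) : D F r (x F s) = if r = s then 1 else 0 := by
  have h1 : ∀ i : Fin m, DividedPower.partialHom i (1 : DividedPower F m) = 0 := by
    intro i; rw [DividedPower.one_def, DividedPower.partialHom_mono]; simp
  cases r with
  | inl i =>
    cases s with
    | inl j =>
      rw [x, D_inl, DividedPower.partialHom_mono]
      by_cases h : i = j
      · subst h; simp [← DividedPower.one_def, Algebra.TensorProduct.one_def]
      · simp [h]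
    | inr l => rw [x, D_inl, h1]; simp
  | inr k =>
    cases s with
    | inl j => rw [x, D_inr]; simp
    | inr l =>
      rw [x, D_inr]
      by_cases h : k = l
      · subst h; simp [ExteriorAlgebra.ι, Algebra.TensorProduct.one_def]
      · simp [ExteriorAlgebra.ι, h]

theorem x_mem (r : Fin m ⊕ Fin n) : x F r ∈ superPart F m n (tau r) := by
  refine Submodule.subset_span ?_
  cases r with
  | inl i => exact ⟨_, 1, by simpa [tau] using SetLike.GradedOne.one_mem, rfl⟩
  | inr k =>
    exact ⟨_, _, by simpa [tau] using CliffordAlgebra.ι_mem_evenOdd_one _ _, rfl⟩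

theorem vf_apply (f : Fin m ⊕ Fin n → SuperAlg F m n) (g : SuperAlg F m n) :
    vf f g = ∑ r, f r * D F r g := by
  simp [vf]

theorem vf_x (f : Fin m ⊕ Fin n → SuperAlg F m n) (r : Fin m ⊕ Fin n) : vf f (x F r) = f r := by
  rw [vf_apply]
  simp [D_x]

theorem div_apply (f : Fin m ⊕ Fin n → SuperAlg F m n) :
    div f = ∑ r, D F r (sgn (tau r) (f r)) := by
  simp [div]

theorem vf_single (r : Fin m ⊕ Fin n) (a : SuperAlg F m n) :
    vf (Pi.single r a) = LinearMap.mulLeft F a ∘ₗ D F r := by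
  refine LinearMap.ext fun g => ?_
  rw [vf_apply, Finset.sum_eq_single r]
  · simp
  · intro s _ hs; simp [hs]
  · simp

theorem div_single (r : Fin m ⊕ Fin n) (a : SuperAlg F m n) :
    div (Pi.single r a) = D F r (sgn (tau r) a) := by
  rw [div_apply, Finset.sum_eq_single r]
  · simp
  · intro s _ hs; simp [hs]
  · simp

/-- The coefficients of `D_rs(f)`. -/
def DrsCoeff (r s : Fin m ⊕ Fin n) (f : SuperAlg F m n) : Fin m ⊕ Fin n → SuperAlg F m n :=
  (-1 : F) ^ (tau r * tau s) • (Pi.single s (D F r f) : Fin m ⊕ Fin n → SuperAlg F m n)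
    - (Pi.single r (D F s (sgn (tau r + tau s) f)) : Fin m ⊕ Fin n → SuperAlg F m n)

theorem vf_DrsCoeff (r s : Fin m ⊕ Fin n) (f : SuperAlg F m n) :
    vf (DrsCoeff r s f) = Drs r s f := by
  rw [DrsCoeff, map_sub, map_smul, vf_single, vf_single, Drs]

theorem div_DrsCoeff (r s : Fin m ⊕ Fin n) (f : SuperAlg F m n) :
    div (DrsCoeff r s f) = 0 := by
  rw [DrsCoeff, map_sub, map_smul, div_single, div_single, sgn_D, sgn_D, map_smul, map_smul,
    D_comm r s]
  have h : ∀ f : SuperAlg F m n, sgn 1 (sgn 1 f) = f := by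
    intro f
    have := sgn_two f
    rwa [sgn, pow_two] at this
  cases r <;> cases s <;> simp [tau, sgn_zero, sgn_two, h]

theorem D_trunc (p : ℕ) (t : Fin m → ℕ) (r : Fin m ⊕ Fin n) {f : SuperAlg F m n}
    (hf : f ∈ trunc F n p t) : D F r f ∈ trunc F n p t := by
  refine (Submodule.span_le (p := (trunc F n p t).comap (D F r))).2 ?_ hf
  rintro _ ⟨α, hα, u, rfl⟩
  cases r with
  | inl i =>
    rw [SetLike.mem_coe, Submodule.mem_comap, D_inl, DividedPower.partialHom_mono]
    split_ifs with h
    · rw [TensorProduct.zero_tmul]; exact zero_mem _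
    · refine Submodule.subset_span ⟨_, fun j => ?_, u, rfl⟩
      exact (Nat.sub_le _ _).trans (hα j)
  | inr k => exact Submodule.subset_span ⟨α, hα, _, rfl⟩

theorem sgn_trunc (p : ℕ) (t : Fin m → ℕ) (e : ℕ) {f : SuperAlg F m n}
    (hf : f ∈ trunc F n p t) : sgn e f ∈ trunc F n p t := by
  induction e generalizing f with
  | zero => simpa [sgn_zero] using hf
  | succ e ih =>
    have h : sgn (e + 1) f = sgn e (parity F m n f) := by simp [sgn, pow_succ]
    rw [h]
    refine ih ?_
    refine (Submodule.span_le (p := (trunc F n p t).comap (parity F m n).toLinearMap)).2 ?_ hf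
    rintro _ ⟨α, hα, u, rfl⟩
    rw [SetLike.mem_coe, Submodule.mem_comap, AlgHom.toLinearMap_apply, parity_tmul]
    exact Submodule.subset_span ⟨α, hα, _, rfl⟩

theorem choose_cast_eq_zero (p : ℕ) [Fact p.Prime] [CharP F p] {a b e : ℕ}
    (ha : a ≤ p ^ e - 1) (hb : b ≤ p ^ e - 1) (h : ¬ a + b ≤ p ^ e - 1) :
    (((a + b).choose a : ℕ) : F) = 0 := by
  have hp : p.Prime := Fact.out
  have hpos : 0 < p ^ e := pow_pos hp.pos e
  rw [CharP.cast_eq_zero_iff F p]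
  have he : e ≠ 0 := by rintro rfl; simp at ha hb; omega
  have key := Nat.factorization_choose' (p := p) (n := b) (k := a)
    (b := max e (Nat.log p (b + a)) + 1) hp (by omega)
  have hmem : e ∈ {i ∈ Finset.Ico 1 (max e (Nat.log p (b + a)) + 1) |
      p ^ i ≤ a % p ^ i + b % p ^ i} := by
    rw [Finset.mem_filter, Finset.mem_Ico, Nat.mod_eq_of_lt (by omega),
      Nat.mod_eq_of_lt (by omega)]
    omega
  have hne : ((b + a).choose a).factorization p ≠ 0 := by
    rw [key]; exact Finset.card_ne_zero_of_mem hmem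
  rw [add_comm a b]
  exact Nat.dvd_of_factorization_pos hne

theorem mul_trunc (p : ℕ) [Fact p.Prime] [CharP F p] (t : Fin m → ℕ) {f g : SuperAlg F m n}
    (hf : f ∈ trunc F n p t) (hg : g ∈ trunc F n p t) : f * g ∈ trunc F n p t := by
  unfold trunc at hf hg
  induction hf using Submodule.span_induction with
  | zero => rw [zero_mul]; exact zero_mem _
  | add a b _ _ ha hb => rw [add_mul]; exact add_mem ha hb
  | smul c a _ ha => rw [smul_mul_assoc]; exact Submodule.smul_mem _ _ ha
  | mem f hf =>
    obtain ⟨α, hα, u, rfl⟩ := hf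
    induction hg using Submodule.span_induction with
    | zero => rw [mul_zero]; exact zero_mem _
    | add a b _ _ ha hb => rw [mul_add]; exact add_mem ha hb
    | smul c a _ ha => rw [mul_smul_comm]; exact Submodule.smul_mem _ _ ha
    | mem g hg =>
      obtain ⟨β, hβ, v, rfl⟩ := hg
      rw [Algebra.TensorProduct.tmul_mul_tmul, DividedPower.mono_mul_mono,
        ← TensorProduct.smul_tmul']
      by_cases h : ∀ i, α i + β i ≤ p ^ t i - 1
      · exact Submodule.smul_mem _ _ (Submodule.subset_span ⟨_, h, _, rfl⟩)
      · push Not at h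
        obtain ⟨i, hi⟩ := h
        rw [Nat.cast_prod, Finset.prod_eq_zero (Finset.mem_univ i)
          (choose_cast_eq_zero p (hα i) (hβ i) (by omega)), zero_smul]
        exact zero_mem _

theorem vf_bracket {f g : Fin m ⊕ Fin n → SuperAlg F m n}
    (hf : ∀ r, f r ∈ superPart F m n (tau r)) (hg : ∀ r, g r ∈ superPart F m n (tau r)) :
    ⁅vf f, vf g⁆ = vf fun s => vf f (g s) - vf g (f s) := by
  have key : ∀ {f g : Fin m ⊕ Fin n → SuperAlg F m n}, (∀ r, g r ∈ superPart F m n (tau r)) →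
      ∀ h, vf f (vf g h) = (∑ s, vf f (g s) * D F s h)
        + ∑ s, ∑ r, (-1 : F) ^ (tau r * tau s) • (f r * g s * D F r (D F s h)) := by
    intro f g hg h
    rw [vf_apply g h, map_sum, ← Finset.sum_add_distrib]
    refine Finset.sum_congr rfl fun s _ => ?_
    rw [vf_apply, vf_apply, Finset.sum_mul, ← Finset.sum_add_distrib]
    refine Finset.sum_congr rfl fun r _ => ?_
    rw [D_mul, sgn_of_mem _ s (hg s), mul_add, mul_assoc, smul_mul_assoc, mul_smul_comm, mul_assoc]
  refine LinearMap.ext fun h => ?_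
  have e : ∑ s, ∑ r, (-1 : F) ^ (tau r * tau s) • (f r * g s * D F r (D F s h))
      = ∑ s, ∑ r, (-1 : F) ^ (tau r * tau s) • (g r * f s * D F r (D F s h)) := by
    rw [Finset.sum_comm]
    refine Finset.sum_congr rfl fun s _ => Finset.sum_congr rfl fun r _ => ?_
    rw [swap_of_mem s r (hf s) (hg r), D_comm s r, smul_mul_assoc, mul_smul_comm, smul_smul,
      smul_smul, ← mul_pow, mul_comm (tau s)]
    congr 1
    simp
  rw [LieRing.of_associative_ring_bracket, LinearMap.sub_apply, Module.End.mul_apply,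
    Module.End.mul_apply, key hg, key hf, e, vf_apply]
  simp only [sub_mul, Finset.sum_sub_distrib]
  abel

theorem sum_mem_of_pairs {ι M : Type*} [AddCommGroup M] [Module F M]
    (N : Submodule F M) (T : ι → ι → M) (h1 : ∀ r, T r r ∈ N)
    (h2 : ∀ r s, T r s + T s r ∈ N) (A : Finset ι) : ∑ r ∈ A, ∑ s ∈ A, T r s ∈ N := by
  classical
  induction A using Finset.induction_on with
  | empty => simp
  | insert a A ha ih =>
    have : ∑ r ∈ insert a A, ∑ s ∈ insert a A, T r s
        = T a a + (∑ s ∈ A, (T a s + T s a)) + ∑ r ∈ A, ∑ s ∈ A, T r s := by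
      rw [Finset.sum_insert ha, Finset.sum_insert ha]
      simp only [Finset.sum_insert ha, Finset.sum_add_distrib]
      abel
    rw [this]
    exact add_mem (add_mem (h1 a) (sum_mem fun s _ => h2 a s)) ih

theorem vf_of_div_eq_zero {f g : Fin m ⊕ Fin n → SuperAlg F m n}
    (hf : ∀ r, f r ∈ superPart F m n (tau r)) (h0 : div f = 0) (s : Fin m ⊕ Fin n) :
    vf f (g s) = ∑ r, (-1 : F) ^ tau r • D F r (f r * g s) := by
  have h0' : ∑ r, (-1 : F) ^ tau r • D F r (f r) = 0 := by
    rw [← h0, div_apply]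
    refine Finset.sum_congr rfl fun r _ => ?_
    rw [sgn_of_mem _ r (hf r), map_smul]
    cases r <;> simp [tau]
  have : ∑ r, (-1 : F) ^ tau r • D F r (f r * g s)
      = (∑ r, (-1 : F) ^ tau r • D F r (f r)) * g s + vf f (g s) := by
    rw [Finset.sum_mul, vf_apply, ← Finset.sum_add_distrib]
    refine Finset.sum_congr rfl fun r _ => ?_
    rw [D_mul, sgn_of_mem _ r (hf r), smul_add, smul_mul_assoc, smul_mul_assoc, smul_smul]
    cases r <;> simp [tau]
  rw [this, h0', zero_mul, zero_add]

theorem superPart_mul (r s : Fin m ⊕ Fin n) {f g : SuperAlg F m n}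
    (hf : f ∈ superPart F m n (tau r)) (hg : g ∈ superPart F m n (tau s)) (e : ℕ) :
    sgn e (f * g) = (-1 : F) ^ (e * (tau r + tau s)) • (f * g) := by
  rw [sgn_mul, sgn_of_mem e r hf, sgn_of_mem e s hg, smul_mul_assoc, mul_smul_comm, smul_smul,
    ← pow_add, mul_add]

theorem bracket_mem_S (p : ℕ) [Fact p.Prime] [CharP F p] (t : Fin m → ℕ)
    {f g : Fin m ⊕ Fin n → SuperAlg F m n}
    (hf : ∀ r, f r ∈ superPart F m n (tau r)) (hg : ∀ r, g r ∈ superPart F m n (tau r))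
    (hft : ∀ r, f r ∈ trunc F n p t) (hgt : ∀ r, g r ∈ trunc F n p t)
    (hf0 : div f = 0) (hg0 : div g = 0) : ⁅vf f, vf g⁆ ∈ S F n p t := by
  let h : Fin m ⊕ Fin n → Fin m ⊕ Fin n → SuperAlg F m n :=
    fun r s => f r * g s - g r * f s
  have hh : ∀ r s, h s r = -((-1 : F) ^ (tau r * tau s) • h r s) := by
    intro r s
    simp only [h]
    rw [swap_of_mem s r (hf s) (hg r), swap_of_mem s r (hg s) (hf r), smul_sub, mul_comm (tau s)]
    abel
  have hs : ∀ r s e, sgn e (h r s) = (-1 : F) ^ (e * (tau r + tau s)) • h r s := by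
    intro r s e
    simp only [h]
    rw [map_sub, superPart_mul r s (hf r) (hg s), superPart_mul r s (hg r) (hf s), smul_sub]
  have ht : ∀ r s, h r s ∈ trunc F n p t := fun r s =>
    sub_mem (mul_trunc p t (hft r) (hgt s)) (mul_trunc p t (hgt r) (hft s))
  let T : Fin m ⊕ Fin n → Fin m ⊕ Fin n → Module.End F (SuperAlg F m n) := fun r s =>
    (-1 : F) ^ tau r • (LinearMap.mulLeft F (D F r (h r s)) ∘ₗ D F s)
  have hT : ⁅vf f, vf g⁆ = ∑ r, ∑ s, T r s := by
    rw [vf_bracket hf hg]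
    refine LinearMap.ext fun k => ?_
    rw [vf_apply, Finset.sum_comm, LinearMap.sum_apply]
    refine Finset.sum_congr rfl fun s _ => ?_
    rw [vf_of_div_eq_zero hf hf0 s, vf_of_div_eq_zero hg hg0 s, ← Finset.sum_sub_distrib,
      Finset.sum_mul, LinearMap.sum_apply]
    refine Finset.sum_congr rfl fun r _ => ?_
    simp only [T, h, LinearMap.smul_apply, LinearMap.comp_apply, LinearMap.mulLeft_apply,
      ← smul_sub, ← map_sub, smul_mul_assoc]
  have hD : ∀ r s, ∀ k ∈ trunc F n p t, Drs r s k ∈ S F n p t := fun r s k hk =>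
    Submodule.subset_span ⟨r, s, k, hk, rfl⟩
  rw [hT]
  refine sum_mem_of_pairs _ T ?_ ?_ _
  · intro r
    cases r with
    | inl i =>
      have : h (.inl i) (.inl i) = 0 := by
        simp only [h]
        rw [swap_of_mem (.inl i) (.inl i) (hf _) (hg _)]
        simp [tau]
      simp only [T, this, map_zero]
      simp
    | inr k =>
      have e : h (.inr k) (.inr k) = f (.inr k) * g (.inr k) + f (.inr k) * g (.inr k) := by
        simp only [h]
        rw [swap_of_mem (.inr k) (.inr k) (hg _) (hf _)]
        simp [tau]
      have : T (.inr k) (.inr k) = Drs (.inr k) (.inr k) (f (.inr k) * g (.inr k)) := by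
        refine LinearMap.ext fun a => ?_
        simp only [T, e, Drs]
        simp [tau, sgn_two, add_mul]
        abel
      rw [this]
      exact hD _ _ _ (mul_trunc p t (hft _) (hgt _))
  · intro r s
    have : T r s + T s r = (-1 : F) ^ (tau r + tau r * tau s) • Drs r s (h r s) := by
      refine LinearMap.ext fun a => ?_
      simp only [T, Drs, hs, hh r s]
      cases r <;> cases s <;> simp [tau, sub_eq_add_neg]
      · exact neg_mul (α := SuperAlg F m n) _ _
      · norm_num
    rw [this]
    exact Submodule.smul_mem _ _ (hD _ _ _ (ht r s))

theorem S_le_Sbar (p : ℕ) (t : Fin m → ℕ) : S F n p t ≤ Sbar F n p t := by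
  refine Submodule.span_le.2 ?_
  rintro _ ⟨r, s, f, hf, rfl⟩
  refine ⟨DrsCoeff r s f, ⟨?_, div_DrsCoeff r s f⟩, vf_DrsCoeff r s f⟩
  have hsingle : ∀ (r : Fin m ⊕ Fin n) (a : SuperAlg F m n), a ∈ trunc F n p t →
      Pi.single r a ∈ coeffs F n p t := by
    intro r a ha s _
    by_cases h : s = r
    · subst h; simpa using ha
    · simp [h]
  exact sub_mem (Submodule.smul_mem _ _ (hsingle _ _ (D_trunc p t r hf)))
    (hsingle _ _ (D_trunc p t s (sgn_trunc p t _ hf)))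

variable (F n) in
/-- The Lie algebra `𝒮`, the even part of `S(m, n; t)`, with the commutator bracket. -/
def evenS (p : ℕ) [Fact p.Prime] [CharP F p] (t : Fin m → ℕ) :
    LieSubalgebra F (Module.End F (SuperAlg F m n)) where
  toSubmodule := S F n p t ⊓ evenEnd F m n
  lie_mem' := by
    rintro A B ⟨hA, hA'⟩ ⟨hB, hB'⟩
    refine ⟨?_, ?_⟩
    · obtain ⟨f, ⟨hft, hf0⟩, rfl⟩ := S_le_Sbar p t hA
      obtain ⟨g, ⟨hgt, hg0⟩, rfl⟩ := S_le_Sbar p t hB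
      refine bracket_mem_S p t (fun r => ?_) (fun r => ?_) (fun r => hft r trivial)
        (fun r => hgt r trivial) hf0 hg0
      · rw [← vf_x f r]; exact hA' _ _ (x_mem r)
      · rw [← vf_x g r]; exact hB' _ _ (x_mem r)
    · intro θ f hf
      rw [LieRing.of_associative_ring_bracket]
      exact sub_mem (hA' _ _ (hB' _ _ hf)) (hB' _ _ (hA' _ _ hf))

variable (F n) in
/-- The even part of the divergence-free superalgebra `Sbar`. -/
def evenSbar (p : ℕ) (t : Fin m → ℕ) : Submodule F (Module.End F (SuperAlg F m n)) :=
  Sbar F n p t ⊓ evenEnd F m n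

end SuperAlg

/-! ### Derivations of a Lie subalgebra -/

section

variable {F : Type*} [Field F] {E : Type*} [LieRing E] [LieAlgebra F E]

/-- The derivation algebra `Der(L)` of a Lie subalgebra `L` of `E`, as a subspace of the space of
all linear maps from `L` to `E`. -/
def derSpace (L : LieSubalgebra F E) : Submodule F (L →ₗ[F] E) :=
  LinearMap.range (LinearMap.compRight F L.toSubmodule.subtype ∘ₗ
    (LieDerivation.toLinearMapLieHom F L : LieDerivation F L L →ₗ[F] L →ₗ[F] L))

/-- The restriction to `L` of a linear endomorphism of `E`. -/
def restrictTo (L : LieSubalgebra F E) : Module.End F E →ₗ[F] (L →ₗ[F] E) :=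
  LinearMap.lcomp F E L.toSubmodule.subtype

/-- The map sending `e` to the restriction of `ad e` to `L`. -/
def adOn (L : LieSubalgebra F E) : E →ₗ[F] (L →ₗ[F] E) :=
  restrictTo L ∘ₗ (LieAlgebra.ad F E : E →ₗ[F] Module.End F E)

end

namespace SuperAlg

variable (F : Type*) [Field F] {m : ℕ} (n : ℕ) (p : ℕ) [Fact p.Prime] [CharP F p] (t : Fin m → ℕ)

/-- The space of the restrictions to `𝒮` of all `ad E`, where `E` is the sum of an even
divergence-free element and an element of the canonical torus. -/
def adPart : Submodule F (evenS F n p t →ₗ[F] Module.End F (SuperAlg F m n)) :=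
  (evenSbar F n p t ⊔ torus F m n).map (adOn (evenS F n p t))

/-- The span of the restrictions to `𝒮` of all `(ad D_i)^(p^r)` with `i ∈ Y₀` and `1 ≤ r < t_i`. -/
def adPowers : Submodule F (evenS F n p t →ₗ[F] Module.End F (SuperAlg F m n)) :=
  Submodule.span F {φ | ∃ (i : Fin m) (r : ℕ), 1 ≤ r ∧ r < t i ∧
    φ = restrictTo (evenS F n p t)
      (LieAlgebra.ad F (Module.End F (SuperAlg F m n)) (D F (.inl i)) ^ p ^ r)}

end SuperAlg

end

/-!
The even part `W` of `W(m, n; t)` is the space `evenW` of even vector fields, and `𝒮` is a subalgebra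
of it. The claim has two halves.

*Every derivation `φ` of `𝒮` is of the stated form.* It is convenient to let `φ` take its values in
`W`; this is `IsDer`. One subtracts derivations of the stated kind until `φ` vanishes on a set of
generators of `𝒮`:

* The operators `ad D_i`, `i ∈ Y₀`, satisfy `(ad D_i)^(p^(t_i)) = 0` on `W`, and the elements
  `h = x_i D_i + x_k D_k` are toral, `(ad h)^p = ad h`. As `p` is odd, a derivation commutes with
  `(ad x)^q`, `q` a power of `p`, up to the inner derivation of `(ad x)^(q-1) (φ x)`
  (`derivation_ad_pow`), and the centralizer of `𝒮` in `W` is zero (`eq_zero_of_lie_evenS`). So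
  `φ D_i` and `φ h` lie in the images of `ad D_i` and `ad h`, and `φ` may be changed by inner
  derivations so as to kill all of them (`exists_ad_D`, `exists_ad_hfld`).
* Now `φ` preserves weights, so on `𝔄(m; t) ⊗ sl(n)`, spanned by the fields `(a x_k) D_l`, it acts on
  the coefficients `a`. An element of the torus takes care of the values at `x_k D_l`; then all root
  spaces carry the same derivation of `𝔄(m; t)`, it commutes with the `∂_i`, and it is determined by
  the constant terms of its values at the generators `x_i^(p^r)`. Hence it is a combination of the
  `∂_i^(p^r)` (`derivation_eq_zero`, `exists_powD`).
* A multiple of the Euler field `∑ x_k D_k`, `k ∈ Y₁`, takes care of the fields `x_k x_l D_i`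
  (`exists_ad_pfld`).

A derivation that kills these generators is zero (`KillsGens.eq_zero`): brackets with the generators
reach all fields of positive degree in the odd variables, and the remaining fields
`x^(α) D_i + x^(α - ε_i) x_s D_s` are treated by induction on the degree of `x^(α)`, where the value of
`φ` has constant coefficients, so that its weight leaves few possibilities for `α` (`zfld_weight`); in
these the field is a commutator of two earlier ones. So `φ = ad E + ∑ c_ir (ad D_i)^(p^r)` with
`E ∈ W`. Then `E` normalizes `𝒮`, so that `div E` is annihilated by the `D_i` and by the elements `h`;
it is a scalar, and `E` differs from a divergence-free field by a multiple of `x_i D_i`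
(`mem_of_lie_mem`).

*The right-hand side consists of derivations, and the sum is direct.* The normalizer property of
divergence-free fields and of the torus is a computation, and `(ad D_i)^(p^r) = ad (D_i^(p^r))` in
characteristic `p`. If `ad E = ∑ c_ir (ad D_i)^(p^r)` on `𝒮` then `E` commutes with all `D_i`, so its
coefficients do not involve the even variables; comparing the constant terms of the two sides at
`x_i^(p^r) D_j`, `j ≠ i`, gives `c_ir = 0` (`powD_coeff_eq_zero`).
-/

noncomputable section

/-! ### The exterior algebra: words, contractions and parity -/

namespace SuperAlg

section Exterior

variable {F : Type*} [Field F] {n : ℕ}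

variable (F) in
/-- The generator `x_{m+k}` of the exterior algebra. -/
def gen (k : Fin n) : ExteriorAlgebra F (Fin n → F) := ExteriorAlgebra.ι F (Pi.single k 1)

variable (F) in
/-- The left derivative of the exterior algebra with respect to `gen F k`. -/
def dgen (k : Fin n) : Module.End F (ExteriorAlgebra F (Fin n → F)) :=
  CliffordAlgebra.contractLeft (LinearMap.proj k)

variable (F n) in
/-- The parity involution of the exterior algebra. -/
def inv : ExteriorAlgebra F (Fin n → F) →ₐ[F] ExteriorAlgebra F (Fin n → F) :=
  CliffordAlgebra.involute

variable (F) in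
/-- The product of the generators along a list of indices. The list may have repetitions. -/
def word (l : List (Fin n)) : ExteriorAlgebra F (Fin n → F) := (l.map (gen F)).prod

@[simp] theorem word_nil : word F ([] : List (Fin n)) = 1 := rfl

@[simp] theorem word_cons (k : Fin n) (l : List (Fin n)) :
    word F (k :: l) = gen F k * word F l := by simp [word]

@[simp] theorem inv_gen (k : Fin n) : inv F n (gen F k) = -gen F k :=
  CliffordAlgebra.involute_ι _

theorem dgen_mul (k : Fin n) (u v : ExteriorAlgebra F (Fin n → F)) :
    dgen F k (u * v) = dgen F k u * v + inv F n u * dgen F k v :=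
  contract_mul _ u v

@[simp] theorem dgen_one (k : Fin n) : dgen F k 1 = 0 :=
  CliffordAlgebra.contractLeft_one (Q := (0 : QuadraticForm F (Fin n → F))) _

theorem dgen_gen (k l : Fin n) : dgen F k (gen F l) = if k = l then 1 else 0 := by
  unfold dgen gen
  refine (CliffordAlgebra.contractLeft_ι (Q := (0 : QuadraticForm F (Fin n → F))) _ _).trans ?_
  by_cases h : k = l <;> simp [h]

@[simp] theorem dgen_gen_self (k : Fin n) : dgen F k (gen F k) = 1 := by simp [dgen_gen]

theorem dgen_gen_ne {k l : Fin n} (h : k ≠ l) : dgen F k (gen F l) = 0 := by simp [dgen_gen, h]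

theorem dgen_gen_mul (k l : Fin n) (u : ExteriorAlgebra F (Fin n → F)) :
    dgen F k (gen F l * u) = (if k = l then u else 0) - gen F l * dgen F k u := by
  rw [dgen_mul, dgen_gen, inv_gen, neg_mul, sub_eq_add_neg]
  split_ifs <;> simp

theorem dgen_self_gen_mul (k : Fin n) (u : ExteriorAlgebra F (Fin n → F)) :
    dgen F k (gen F k * u) = u - gen F k * dgen F k u := by simp [dgen_gen_mul]

theorem dgen_ne_gen_mul {k l : Fin n} (h : k ≠ l) (u : ExteriorAlgebra F (Fin n → F)) :
    dgen F k (gen F l * u) = - (gen F l * dgen F k u) := by simp [dgen_gen_mul, h]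

@[simp] theorem dgen_dgen (k : Fin n) (u : ExteriorAlgebra F (Fin n → F)) :
    dgen F k (dgen F k u) = 0 := CliffordAlgebra.contractLeft_contractLeft _ _

theorem dgen_comm (k l : Fin n) (u : ExteriorAlgebra F (Fin n → F)) :
    dgen F k (dgen F l u) = - dgen F l (dgen F k u) := CliffordAlgebra.contractLeft_comm _ _ _

theorem inv_dgen (k : Fin n) (u : ExteriorAlgebra F (Fin n → F)) :
    inv F n (dgen F k u) = - dgen F k (inv F n u) := involute_contract _ _

theorem gen_mul (k : Fin n) (u : ExteriorAlgebra F (Fin n → F)) :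
    gen F k * u = inv F n u * gen F k := ι_mul _ _

@[simp] theorem gen_mul_self (k : Fin n) : gen F k * gen F k = 0 :=
  ExteriorAlgebra.ι_sq_zero _

@[simp] theorem gen_mul_gen_mul_self (k : Fin n) (u : ExteriorAlgebra F (Fin n → F)) :
    gen F k * (gen F k * u) = 0 := by rw [← mul_assoc, gen_mul_self, zero_mul]

theorem gen_anticomm (k l : Fin n) : gen F k * gen F l = - (gen F l * gen F k) := by
  rw [gen_mul k, inv_gen, neg_mul]

theorem gen_mul_left_anticomm (k l : Fin n) (u : ExteriorAlgebra F (Fin n → F)) :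
    gen F k * (gen F l * u) = - (gen F l * (gen F k * u)) := by
  rw [← mul_assoc, gen_anticomm, neg_mul, mul_assoc]

theorem inv_word (l : List (Fin n)) : inv F n (word F l) = (-1 : F) ^ l.length • word F l := by
  induction l with
  | nil => simp
  | cons k l ih =>
    rw [word_cons, map_mul, inv_gen, ih, List.length_cons, pow_succ, mul_smul_comm, mul_neg_one,
      neg_smul, neg_mul, smul_neg]

theorem dgen_word {k : Fin n} {l : List (Fin n)} (h : k ∉ l) : dgen F k (word F l) = 0 := by
  induction l with
  | nil => simp
  | cons s l ih =>
    rw [List.mem_cons, not_or] at h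
    rw [word_cons, dgen_ne_gen_mul h.1, ih h.2, mul_zero, neg_zero]

theorem gen_dgen_word {k : Fin n} {l : List (Fin n)} (h : k ∈ l) :
    gen F k * dgen F k (word F l) = word F l := by
  induction l with
  | nil => simp at h
  | cons s l ih =>
    by_cases hs : k = s
    · subst hs
      rw [word_cons, dgen_self_gen_mul, mul_sub, gen_mul_gen_mul_self, sub_zero]
    · have hl : k ∈ l := by simpa [hs] using h
      rw [word_cons, dgen_ne_gen_mul hs, mul_neg, gen_mul_left_anticomm, neg_neg, ih hl]

theorem gen_mul_word {k : Fin n} {l : List (Fin n)} (h : k ∈ l) : gen F k * word F l = 0 := by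
  rw [← gen_dgen_word h, gen_mul_gen_mul_self]

theorem span_word : Submodule.span F (Set.range (word F : List (Fin n) → _)) = ⊤ := by
  rw [eq_top_iff]
  rintro u -
  have hmul : ∀ y : Fin n → F, ∀ v ∈ Submodule.span F (Set.range (word F : List (Fin n) → _)),
      ExteriorAlgebra.ι F y * v ∈ Submodule.span F (Set.range (word F : List (Fin n) → _)) := by
    intro y v hv
    have hy : y = ∑ k, y k • (Pi.single k 1 : Fin n → F) := by
      ext j; simp [Finset.sum_apply, Pi.single_apply]
    rw [hy, map_sum, Finset.sum_mul]
    refine Submodule.sum_mem _ fun k _ => ?_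
    rw [map_smul, smul_mul_assoc]
    refine Submodule.smul_mem _ _ ?_
    induction hv using Submodule.span_induction with
    | mem v hv =>
      obtain ⟨l, rfl⟩ := hv
      exact Submodule.subset_span ⟨k :: l, word_cons k l⟩
    | zero => rw [mul_zero]; exact zero_mem _
    | add a b _ _ ha hb => rw [mul_add]; exact add_mem ha hb
    | smul c a _ ha => rw [mul_smul_comm]; exact Submodule.smul_mem _ _ ha
  induction u using CliffordAlgebra.left_induction with
  | algebraMap r =>
    rw [Algebra.algebraMap_eq_smul_one]
    exact Submodule.smul_mem _ _ (Submodule.subset_span ⟨[], rfl⟩)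
  | add a b ha hb => exact add_mem ha hb
  | ι_mul a y ha => exact hmul y a ha

/-- An element lies in a subspace as soon as it is fixed by a linear map which sends all words into
the subspace. -/
theorem mem_of_fixed {N : Submodule F (ExteriorAlgebra F (Fin n → F))}
    (g : Module.End F (ExteriorAlgebra F (Fin n → F))) {u : ExteriorAlgebra F (Fin n → F)}
    {A : Set (List (Fin n))} (hu : u ∈ Submodule.span F (word F '' A)) (hg : g u = u)
    (h : ∀ l ∈ A, g (word F l) ∈ N) : u ∈ N := by
  have : Submodule.span F (word F '' A) ≤ N.comap g := by
    rw [Submodule.span_le]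
    rintro _ ⟨l, hl, rfl⟩
    exact h l hl
  rw [← hg]
  exact this hu

theorem mem_span_word_of_dgen {A : Set (List (Fin n))} {u : ExteriorAlgebra F (Fin n → F)}
    (hu : u ∈ Submodule.span F (word F '' A)) {s : Fin n} (hs : dgen F s u = 0) :
    u ∈ Submodule.span F (word F '' {l ∈ A | s ∉ l}) := by
  refine mem_of_fixed (LinearMap.id - LinearMap.mulLeft F (gen F s) ∘ₗ dgen F s) hu
    (by simp [hs]) fun l hl => ?_
  by_cases h : s ∈ l
  · simp [gen_dgen_word h]
  · have : word F l ∈ Submodule.span F (word F '' {l ∈ A | s ∉ l}) :=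
      Submodule.subset_span ⟨l, ⟨hl, h⟩, rfl⟩
    simpa [dgen_word h] using this

theorem mem_span_word_of_inv (h2 : (2 : F) ≠ 0) {A : Set (List (Fin n))}
    {u : ExteriorAlgebra F (Fin n → F)} (hu : u ∈ Submodule.span F (word F '' A)) (e : ℕ)
    (he : inv F n u = (-1 : F) ^ e • u) :
    u ∈ Submodule.span F (word F '' {l ∈ A | Even (l.length + e)}) := by
  have hee : (-1 : F) ^ e * (-1 : F) ^ e = 1 := by rw [← mul_pow]; simp
  refine mem_of_fixed ((2 : F)⁻¹ • (LinearMap.id + (-1 : F) ^ e • (inv F n).toLinearMap)) hu ?_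
    fun l hl => ?_
  · simp only [LinearMap.smul_apply, LinearMap.add_apply, LinearMap.id_apply,
      AlgHom.toLinearMap_apply, he, smul_smul, hee, one_smul]
    rw [← two_smul F, smul_smul, inv_mul_cancel₀ h2, one_smul]
  · simp only [LinearMap.smul_apply, LinearMap.add_apply, LinearMap.id_apply,
      AlgHom.toLinearMap_apply, inv_word, smul_smul, ← pow_add]
    rcases Nat.even_or_odd (l.length + e) with h | h
    · refine Submodule.smul_mem _ _ (add_mem ?_ (Submodule.smul_mem _ _ ?_)) <;>
        exact Submodule.subset_span ⟨l, ⟨hl, h⟩, rfl⟩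
    · rw [add_comm e, h.neg_one_pow]; simp

theorem mem_span_image_univ (u : ExteriorAlgebra F (Fin n → F)) :
    u ∈ Submodule.span F (word F '' Set.univ) := by
  rw [Set.image_univ, span_word]; trivial

theorem exists_smul_one_of_dgen {u : ExteriorAlgebra F (Fin n → F)} (h : ∀ k, dgen F k u = 0) :
    ∃ c : F, u = c • 1 := by
  have key : ∀ A : Finset (Fin n),
      u ∈ Submodule.span F (word F '' {l : List (Fin n) | ∀ k ∈ A, k ∉ l}) := by
    intro A
    induction A using Finset.induction_on with
    | empty => simpa using mem_span_image_univ u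
    | insert s A _ ih =>
      refine Submodule.span_mono (Set.image_mono ?_) (mem_span_word_of_dgen ih (h s))
      rintro l ⟨hl, hs⟩ k hk
      rcases Finset.mem_insert.1 hk with rfl | hk
      · exact hs
      · exact hl k hk
  have e : {l : List (Fin n) | ∀ k ∈ (Finset.univ : Finset (Fin n)), k ∉ l} = {[]} := by
    ext l
    simp [List.eq_nil_iff_forall_not_mem]
  have := key Finset.univ
  rw [e, Set.image_singleton, Submodule.mem_span_singleton] at this
  obtain ⟨c, hc⟩ := this
  exact ⟨c, hc.symm⟩

variable (F n) in
/-- The coefficient of `1`. -/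
def eps : ExteriorAlgebra F (Fin n → F) →ₐ[F] F := ExteriorAlgebra.algebraMapInv

theorem gen_dgen_gen_dgen (k : Fin n) (u : ExteriorAlgebra F (Fin n → F)) :
    gen F k * dgen F k (gen F k * dgen F k u) = gen F k * dgen F k u := by
  rw [dgen_self_gen_mul, dgen_dgen, mul_zero, sub_zero]

theorem gen_dgen_comm {k l : Fin n} (h : k ≠ l) (u : ExteriorAlgebra F (Fin n → F)) :
    gen F k * dgen F k (gen F l * dgen F l u) = gen F l * dgen F l (gen F k * dgen F k u) := by
  rw [dgen_ne_gen_mul h, dgen_ne_gen_mul h.symm, dgen_comm, mul_neg, mul_neg, mul_neg, neg_neg,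
    gen_mul_left_anticomm, mul_neg]

theorem dgen_eq_zero_of_gen_dgen {k : Fin n} {u : ExteriorAlgebra F (Fin n → F)}
    (h : gen F k * dgen F k u = 0) : dgen F k u = 0 := by
  have := congrArg (dgen F k) h
  rwa [dgen_self_gen_mul, dgen_dgen, mul_zero, sub_zero, map_zero] at this

theorem gen_ne_zero (k : Fin n) : gen F k ≠ 0 := by
  intro h
  have := congrArg (fun u => eps F n (dgen F k u)) h
  simp at this

end Exterior

end SuperAlg

/-! ### Coefficients in the divided power algebra -/

namespace DividedPower

variable {F : Type*} [Field F] {m : ℕ}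

/-- The coefficient of `x^(α)`. -/
def co (α : Fin m → ℕ) : DividedPower F m →ₗ[F] F := (basis F m).coord α

theorem co_mono (α β : Fin m → ℕ) : co α (mono F β) = if β = α then 1 else 0 := by
  rw [co, mono, Module.Basis.coord_apply, Module.Basis.repr_self, Finsupp.single_apply]

theorem ext_co {a b : DividedPower F m} (h : ∀ α, co α a = co α b) : a = b :=
  (basis F m).ext_elem h

/-- Two linear maps agree if they agree on all `x^(α)`. -/
theorem hom_ext {M : Type*} [AddCommGroup M] [Module F M] {f g : DividedPower F m →ₗ[F] M}
    (h : ∀ α, f (mono F α) = g (mono F α)) : f = g := (basis F m).ext h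

theorem add_single_sub (α : Fin m → ℕ) (i : Fin m) :
    α + Pi.single i 1 - Pi.single i 1 = α := by
  ext j; simp

theorem sub_single_add {α : Fin m → ℕ} {i : Fin m} (h : α i ≠ 0) :
    α - Pi.single i 1 + Pi.single i 1 = α := by
  ext j
  by_cases hj : j = i
  · subst hj; simp; omega
  · simp [hj]

theorem co_partial (i : Fin m) (α : Fin m → ℕ) (a : DividedPower F m) :
    co α (partialHom i a) = co (α + Pi.single i 1) a := by
  refine LinearMap.congr_fun (f := co α ∘ₗ partialHom i) (g := co (α + Pi.single i 1))
    (hom_ext fun β => ?_) a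
  rw [LinearMap.comp_apply, partialHom_mono, co_mono]
  by_cases h : β i = 0
  · have : β ≠ α + Pi.single i 1 := by rintro rfl; simp at h
    simp [h, this]
  · rw [if_neg h, co_mono]
    congr 1
    rw [eq_iff_iff]
    constructor
    · rintro rfl; exact (sub_single_add h).symm
    · rintro rfl; exact add_single_sub α i

/-- The linear map with `x^(α) ↦ x^(α + ε_i)`, a right inverse of `partialHom i`. -/
def raise (i : Fin m) : DividedPower F m →ₗ[F] DividedPower F m :=
  (basis F m).constr F fun α => mono F (α + Pi.single i 1)

theorem raise_mono (i : Fin m) (α : Fin m → ℕ) :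
    raise i (mono F α) = mono F (α + Pi.single i 1) := by
  rw [raise, mono, Module.Basis.constr_basis]

theorem partial_raise (i : Fin m) (a : DividedPower F m) : partialHom i (raise i a) = a := by
  refine LinearMap.congr_fun (f := partialHom i ∘ₗ raise i) (g := LinearMap.id)
    (hom_ext fun β => ?_) a
  simp [raise_mono, partialHom_mono]

theorem partial_raise_of_ne {i j : Fin m} (h : i ≠ j) (a : DividedPower F m) :
    partialHom i (raise j a) = raise j (partialHom i a) := by
  refine LinearMap.congr_fun (f := partialHom i ∘ₗ raise j) (g := raise j ∘ₗ partialHom i)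
    (hom_ext fun β => ?_) a
  simp only [LinearMap.comp_apply, raise_mono, partialHom_mono]
  by_cases hi : β i = 0
  · simp [hi, h]
  · have : β + Pi.single j 1 - Pi.single i 1 = β - Pi.single i 1 + (Pi.single j 1 : Fin m → ℕ) := by
      ext k
      by_cases hk : k = i
      · subst hk; simp [h]
      · simp [hk]
    simp [hi, h, raise_mono, this]

theorem mono_mul_mono_of_disjoint {α β : Fin m → ℕ} (h : ∀ i, α i = 0 ∨ β i = 0) :
    mono F α * mono F β = mono F (α + β) := by
  rw [mono_mul_mono, Finset.prod_eq_one, Nat.cast_one, one_smul]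
  intro i _
  rcases h i with h | h <;> simp [h]

theorem co_zero_mul (a b : DividedPower F m) : co 0 (a * b) = co 0 a * co 0 b := by
  induction a using ind with
  | h0 => simp
  | ha a a' h h' => rw [add_mul, map_add, map_add, add_mul, h, h']
  | hs c a h => rw [smul_mul_assoc, map_smul, map_smul, h, smul_mul_assoc]
  | h α =>
    induction b using ind with
    | h0 => simp
    | ha a a' h h' => rw [mul_add, map_add, map_add, mul_add, h, h']
    | hs c a h => rw [mul_smul_comm, map_smul, map_smul, h, mul_smul_comm]
    | h β =>
      rw [mono_mul_mono, map_smul, co_mono, co_mono, co_mono]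
      by_cases hα : α = 0
      · subst hα; simp
      · have : α + β ≠ 0 := fun h => hα (add_eq_zero.1 h).1
        simp [hα, this]

theorem mono_zero : mono F (0 : Fin m → ℕ) = 1 := rfl

theorem partial_one (i : Fin m) : partialHom i (1 : DividedPower F m) = 0 := by
  rw [one_def, partialHom_mono]; simp

theorem partial_var (i j : Fin m) :
    partialHom i (mono F (Pi.single j 1)) = if i = j then 1 else 0 := by
  rw [partialHom_mono]
  by_cases h : i = j
  · subst h; simp [mono_zero]
  · simp [h]

theorem var_mul_partial (i : Fin m) (α : Fin m → ℕ) :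
    mono F (Pi.single i 1) * partialHom i (mono F α) = (α i : F) • mono F α := by
  rw [partialHom_mono]
  split_ifs with h
  · simp [h]
  · rw [mono_mul_mono, add_comm, sub_single_add h]
    congr 2
    rw [Finset.prod_eq_single i]
    · simp; omega
    · intro j _ hj; simp [hj]
    · simp

/-- An element all of whose partial derivatives vanish is a scalar. -/
theorem eq_smul_one_of_partial {a : DividedPower F m} (h : ∀ i, partialHom i a = 0) :
    a = co 0 a • 1 := by
  refine ext_co fun α => ?_
  rw [map_smul, ← mono_zero, co_mono]
  by_cases hα : α = 0
  · subst hα; simp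
  · obtain ⟨i, hi⟩ : ∃ i, α i ≠ 0 := by
      by_contra! h'; exact hα (funext h')
    rw [if_neg (Ne.symm hα), smul_zero, ← sub_single_add hi, ← co_partial, h, map_zero]

/-- The truncated divided power algebra `𝔄(m; t)`. -/
def tr (p : ℕ) (t : Fin m → ℕ) : Submodule F (DividedPower F m) where
  carrier := {a | ∀ α, (¬ ∀ i, α i ≤ p ^ t i - 1) → co α a = 0}
  add_mem' h h' α hα := by rw [map_add, h α hα, h' α hα, add_zero]
  zero_mem' α _ := map_zero _
  smul_mem' c a h α hα := by rw [map_smul, h α hα, smul_zero]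

theorem mono_mem_tr {p : ℕ} {t α : Fin m → ℕ} (h : ∀ i, α i ≤ p ^ t i - 1) :
    mono F α ∈ tr p t := by
  intro β hβ
  rw [co_mono, if_neg]
  rintro rfl
  exact hβ h

theorem tr_le_span (p : ℕ) (t : Fin m → ℕ) :
    tr (F := F) p t ≤ Submodule.span F (mono F '' {α | ∀ i, α i ≤ p ^ t i - 1}) := by
  intro a ha
  rw [← (basis F m).linearCombination_repr a, Finsupp.linearCombination_apply]
  refine Submodule.sum_mem _ fun α hα => Submodule.smul_mem _ _ (Submodule.subset_span ⟨α, ?_, rfl⟩)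
  by_contra h
  exact (Finsupp.mem_support_iff.1 hα) (ha α h)

/-- To prove a linear statement on `𝔄(m; t)` it suffices to treat monomials. -/
theorem tr_induction {p : ℕ} {t : Fin m → ℕ} (N : Submodule F (DividedPower F m))
    (h : ∀ α : Fin m → ℕ, (∀ i, α i ≤ p ^ t i - 1) → mono F α ∈ N) {a : DividedPower F m}
    (ha : a ∈ tr p t) : a ∈ N := by
  refine Submodule.span_le.2 ?_ (tr_le_span p t ha)
  rintro _ ⟨α, hα, rfl⟩
  exact h α hα

theorem one_mem_tr (p : ℕ) (t : Fin m → ℕ) : (1 : DividedPower F m) ∈ tr p t :=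
  mono_mem_tr (α := 0) fun i => by simp

theorem partial_mem_tr {p : ℕ} {t : Fin m → ℕ} {a : DividedPower F m} (ha : a ∈ tr p t)
    (i : Fin m) : partialHom i a ∈ tr p t := by
  intro α hα
  rw [co_partial]
  refine ha _ fun h => hα fun j => le_trans ?_ (h j)
  simp

end DividedPower

/-! ### Coefficients in the superalgebra -/

namespace SuperAlg

open DividedPower

variable {F : Type*} [Field F] {m n : ℕ}

/-- The coefficient of `x^(α)`, an element of the exterior algebra. -/
def cf (α : Fin m → ℕ) : SuperAlg F m n →ₗ[F] ExteriorAlgebra F (Fin n → F) :=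
  Finsupp.lapply α ∘ₗ (TensorProduct.equivFinsuppOfBasisLeft (basis F m)).toLinearMap

theorem cf_tmul (α : Fin m → ℕ) (a : DividedPower F m) (u : ExteriorAlgebra F (Fin n → F)) :
    cf α (a ⊗ₜ u) = co α a • u :=
  TensorProduct.equivFinsuppOfBasisLeft_apply_tmul_apply _ _ _ _

theorem ext_cf {f g : SuperAlg F m n} (h : ∀ α, cf α f = cf α g) : f = g :=
  (TensorProduct.equivFinsuppOfBasisLeft (basis F m)).injective (Finsupp.ext h)

theorem cf_D_inl (i : Fin m) (α : Fin m → ℕ) (f : SuperAlg F m n) :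
    cf α (D F (.inl i) f) = cf (α + Pi.single i 1) f := by
  induction f using TensorProduct.induction_on with
  | zero => simp
  | add f g hf hg => rw [map_add, map_add, hf, hg, map_add]
  | tmul a u => rw [D_inl, cf_tmul, cf_tmul, co_partial]

theorem cf_D_inr (k : Fin n) (α : Fin m → ℕ) (f : SuperAlg F m n) :
    cf α (D F (.inr k) f) = dgen F k (cf α f) := by
  induction f using TensorProduct.induction_on with
  | zero => simp
  | add f g hf hg => rw [map_add, map_add, hf, hg, map_add, map_add]
  | tmul a u => rw [D_inr, cf_tmul, cf_tmul, map_smul]; rfl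

theorem D_inr_tmul (k : Fin n) (a : DividedPower F m) (u : ExteriorAlgebra F (Fin n → F)) :
    D F (.inr k) (a ⊗ₜ u) = a ⊗ₜ dgen F k u := rfl

theorem eq_one_tmul_of_D {f : SuperAlg F m n} (h : ∀ i, D F (.inl i) f = 0) :
    f = 1 ⊗ₜ cf 0 f := by
  refine ext_cf fun α => ?_
  rw [cf_tmul, ← mono_zero, co_mono]
  by_cases hα : α = 0
  · subst hα; simp
  · obtain ⟨i, hi⟩ : ∃ i, α i ≠ 0 := by
      by_contra! h'; exact hα (funext h')
    rw [if_neg (Ne.symm hα), zero_smul, ← sub_single_add hi, ← cf_D_inl, h, map_zero]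

variable (F m n) in
/-- The projection `𝔄(m, n) → 𝔄(m)` which kills the odd variables. -/
def body : SuperAlg F m n →ₗ[F] DividedPower F m :=
  (TensorProduct.rid F _).toLinearMap ∘ₗ LinearMap.lTensor _ (eps F n).toLinearMap

theorem body_tmul (a : DividedPower F m) (u : ExteriorAlgebra F (Fin n → F)) :
    body F m n (a ⊗ₜ u) = eps F n u • a := by
  simp [body]

theorem co_body (α : Fin m → ℕ) (f : SuperAlg F m n) : co α (body F m n f) = eps F n (cf α f) := by
  induction f using TensorProduct.induction_on with
  | zero => simp
  | add f g hf hg => simp only [map_add, hf, hg]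
  | tmul a u => rw [body_tmul, cf_tmul, map_smul, map_smul, smul_eq_mul, smul_eq_mul, mul_comm]

theorem eq_body_tmul_of_D {f : SuperAlg F m n} (h : ∀ k, D F (.inr k) f = 0) :
    f = body F m n f ⊗ₜ 1 := by
  refine ext_cf fun α => ?_
  obtain ⟨c, hc⟩ := exists_smul_one_of_dgen (u := cf α f) fun k => by rw [← cf_D_inr, h, map_zero]
  rw [cf_tmul, co_body, hc]
  simp

theorem mem_trunc_iff {p : ℕ} {t : Fin m → ℕ} {f : SuperAlg F m n} :
    f ∈ trunc F n p t ↔ ∀ α, (¬ ∀ i, α i ≤ p ^ t i - 1) → cf α f = 0 := by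
  constructor
  · intro hf α hα
    refine (Submodule.span_le (p := LinearMap.ker (cf α))).2 ?_ hf
    rintro _ ⟨β, hβ, u, rfl⟩
    rw [SetLike.mem_coe, LinearMap.mem_ker, cf_tmul, co_mono, if_neg, zero_smul]
    rintro rfl
    exact hα hβ
  · intro h
    rw [← (TensorProduct.equivFinsuppOfBasisLeft (basis F m)).symm_apply_apply f,
      TensorProduct.equivFinsuppOfBasisLeft_symm_apply]
    refine Submodule.sum_mem _ fun α hα => Submodule.subset_span ⟨α, ?_, _, rfl⟩
    by_contra h'
    exact (Finsupp.mem_support_iff.1 hα) (h α h')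

theorem tmul_mem_trunc {p : ℕ} {t : Fin m → ℕ} {a : DividedPower F m} (ha : a ∈ tr p t)
    (u : ExteriorAlgebra F (Fin n → F)) : a ⊗ₜ u ∈ trunc F n p t :=
  mem_trunc_iff.2 fun α hα => by rw [cf_tmul, ha α hα, zero_smul]

theorem mem_tr_of_tmul {p : ℕ} {t : Fin m → ℕ} {a : DividedPower F m}
    {u : ExteriorAlgebra F (Fin n → F)} (hu : u ≠ 0) (h : a ⊗ₜ u ∈ trunc F n p t) :
    a ∈ tr p t := by
  intro α hα
  have := mem_trunc_iff.1 h α hα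
  rw [cf_tmul] at this
  exact (smul_eq_zero.1 this).resolve_right hu

theorem mul_mem_tr {p : ℕ} [Fact p.Prime] [CharP F p] {t : Fin m → ℕ} {a b : DividedPower F m}
    (ha : a ∈ tr p t) (hb : b ∈ tr p t) : a * b ∈ tr p t := by
  refine mem_tr_of_tmul (n := 0) (one_ne_zero) ?_
  have := mul_trunc p t (tmul_mem_trunc (n := 0) ha 1) (tmul_mem_trunc hb 1)
  rwa [Algebra.TensorProduct.tmul_mul_tmul, mul_one] at this

theorem var_mem_tr {p : ℕ} [Fact p.Prime] {t : Fin m → ℕ} (ht : ∀ i, 1 ≤ t i) (i : Fin m) :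
    mono F (Pi.single i 1) ∈ tr p t := by
  refine mono_mem_tr fun j => ?_
  have : p ^ 1 ≤ p ^ t j := Nat.pow_le_pow_right (Fact.out : p.Prime).pos (ht j)
  have := (Fact.out : p.Prime).two_le
  rw [pow_one] at *
  by_cases h : j = i
  · subst h; simp; omega
  · simp [h]

/-- The linear map with `x^(α) u ↦ x^(α + ε_i) u`. -/
def lift (i : Fin m) : Module.End F (SuperAlg F m n) := LinearMap.rTensor _ (raise i)

theorem lift_tmul (i : Fin m) (a : DividedPower F m) (u : ExteriorAlgebra F (Fin n → F)) :
    lift i (a ⊗ₜ[F] u) = raise i a ⊗ₜ u := rfl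

theorem D_lift (i : Fin m) (f : SuperAlg F m n) : D F (.inl i) (lift i f) = f := by
  induction f using TensorProduct.induction_on with
  | zero => simp
  | add f g hf hg => simp only [map_add, hf, hg]
  | tmul a u => rw [lift_tmul, D_inl, partial_raise]

theorem D_lift_of_ne {i j : Fin m} (h : i ≠ j) (f : SuperAlg F m n) :
    D F (.inl i) (lift j f) = lift j (D F (.inl i) f) := by
  induction f using TensorProduct.induction_on with
  | zero => simp
  | add f g hf hg => simp only [map_add, hf, hg]
  | tmul a u => rw [lift_tmul, D_inl, D_inl, lift_tmul, partial_raise_of_ne h]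

theorem sgn_lift (e : ℕ) (i : Fin m) (f : SuperAlg F m n) :
    sgn e (lift i f) = lift i (sgn e f) := by
  have key : ∀ f : SuperAlg F m n, parity F m n (lift i f) = lift i (parity F m n f) := by
    intro f
    induction f using TensorProduct.induction_on with
    | zero => simp
    | add f g hf hg => simp only [map_add, hf, hg]
    | tmul a u => rw [lift_tmul, parity_tmul, parity_tmul, lift_tmul]
  induction e generalizing f with
  | zero => simp [sgn_zero]
  | succ e ih =>
    have h : ∀ f : SuperAlg F m n, sgn (e + 1) f = sgn e (parity F m n f) := by
      intro f; simp [sgn, pow_succ]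
    rw [h, key, ih, h]

theorem cf_D_pow (i : Fin m) (N : ℕ) (α : Fin m → ℕ) (f : SuperAlg F m n) :
    cf α ((D F (.inl i) ^ N) f) = cf (α + Pi.single i N) f := by
  induction N generalizing α with
  | zero => simp
  | succ N ih =>
    rw [pow_succ', Module.End.mul_apply, cf_D_inl, ih, add_assoc, ← Pi.single_add, add_comm 1]

theorem D_pow_trunc {p : ℕ} [Fact p.Prime] {t : Fin m → ℕ} {f : SuperAlg F m n}
    (hf : f ∈ trunc F n p t) (i : Fin m) : (D F (.inl i) ^ p ^ t i) f = 0 := by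
  refine ext_cf fun α => ?_
  rw [cf_D_pow, map_zero]
  refine mem_trunc_iff.1 hf _ fun h => ?_
  have h1 := h i
  have : 0 < p ^ t i := pow_pos (Fact.out : p.Prime).pos _
  simp at h1
  omega

theorem lift_mem_trunc {p : ℕ} [Fact p.Prime] {t : Fin m → ℕ} {f : SuperAlg F m n}
    (hf : f ∈ trunc F n p t) {i : Fin m} (h : (D F (.inl i) ^ (p ^ t i - 1)) f = 0) :
    lift i f ∈ trunc F n p t := by
  rw [mem_trunc_iff]
  intro α hα
  by_cases hi : α i = 0
  · -- `lift i f` is the image of `lift i`, whose coefficients at `α i = 0` vanish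
    clear hα hf h
    induction f using TensorProduct.induction_on with
    | zero => simp
    | add f g hf hg => rw [map_add, map_add, hf, hg, add_zero]
    | tmul a u =>
      rw [lift_tmul, cf_tmul]
      have : co α (raise i a) = 0 := by
        refine LinearMap.congr_fun (f := co α ∘ₗ raise i) (g := 0) (hom_ext fun β => ?_) a
        rw [LinearMap.comp_apply, raise_mono, co_mono, if_neg]
        · rfl
        · rintro rfl; simp at hi
      rw [this, zero_smul]
  · have e : cf α (lift i f) = cf (α - Pi.single i 1) f := by
      conv_lhs => rw [← sub_single_add hi]
      rw [← cf_D_inl, D_lift]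
    rw [e]
    by_cases hb : ∀ j, (α - Pi.single i 1 : Fin m → ℕ) j ≤ p ^ t j - 1
    · have hle : p ^ t i - 1 < α i := by
        by_contra hc
        refine hα fun j => ?_
        by_cases hj : j = i
        · subst hj; omega
        · have := hb j; simpa [hj] using this
      have hα' : α - Pi.single i 1 = (α - Pi.single i (p ^ t i)) + Pi.single i (p ^ t i - 1) := by
        ext j
        by_cases hj : j = i
        · subst hj
          have : 0 < p ^ t j := pow_pos (Fact.out : p.Prime).pos _
          simp; omega
        · simp [hj]
      rw [hα', ← cf_D_pow, h, map_zero]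
    · exact mem_trunc_iff.1 hf _ hb

end SuperAlg

/-! ### Parity -/

namespace SuperAlg

open DividedPower

variable {F : Type*} [Field F] {m n : ℕ}

theorem two_ne_zero_of_char (p : ℕ) [Fact p.Prime] [CharP F p] (hp : 3 < p) : (2 : F) ≠ 0 := by
  intro h
  have : ((2 : ℕ) : F) = 0 := by exact_mod_cast h
  rw [CharP.cast_eq_zero_iff F p] at this
  exact absurd (Nat.le_of_dvd (by norm_num) this) (by omega)

theorem three_ne_zero_of_char (p : ℕ) [Fact p.Prime] [CharP F p] (hp : 3 < p) : (3 : F) ≠ 0 := by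
  intro h
  have : ((3 : ℕ) : F) = 0 := by exact_mod_cast h
  rw [CharP.cast_eq_zero_iff F p] at this
  exact absurd (Nat.le_of_dvd (by norm_num) this) (by omega)

theorem mem_evenOdd_of_inv (r : Fin m ⊕ Fin n)
    (u : ExteriorAlgebra F (Fin n → F)) :
    u + (-1 : F) ^ tau r • inv F n u ∈
      CliffordAlgebra.evenOdd (0 : QuadraticForm F (Fin n → F)) (tau r : ZMod 2) := by
  obtain ⟨a, ha, b, hb, rfl⟩ := Submodule.mem_sup.1
    ((CliffordAlgebra.evenOdd_isCompl (0 : QuadraticForm F (Fin n → F))).sup_eq_top ▸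
      Submodule.mem_top (x := u))
  rw [inv, map_add, CliffordAlgebra.involute_eq_of_mem_even ha,
    CliffordAlgebra.involute_eq_of_mem_odd hb]
  cases r with
  | inl i =>
    have : a + b + (-1 : F) ^ tau (Sum.inl i : Fin m ⊕ Fin n) • (a + -b) = (2 : F) • a := by
      rw [two_smul]; simp [tau]; abel
    rw [this]
    exact Submodule.smul_mem _ _ (by simpa [tau] using ha)
  | inr i =>
    have : a + b + (-1 : F) ^ tau (Sum.inr i : Fin m ⊕ Fin n) • (a + -b) = (2 : F) • b := by
      rw [two_smul]; simp [tau]; abel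
    rw [this]
    exact Submodule.smul_mem _ _ (by simpa [tau] using hb)

theorem mem_superPart_iff (h2 : (2 : F) ≠ 0) (r : Fin m ⊕ Fin n) {f : SuperAlg F m n} :
    f ∈ superPart F m n (tau r) ↔ parity F m n f = (-1 : F) ^ tau r • f := by
  refine ⟨fun h => ?_, fun h => ?_⟩
  · have := sgn_of_mem 1 r h
    rwa [sgn_one, one_mul] at this
  · have key : ∀ f : SuperAlg F m n,
        f + (-1 : F) ^ tau r • parity F m n f ∈ superPart F m n (tau r) := by
      intro f
      induction f using TensorProduct.induction_on with
      | zero => simp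
      | add f g hf hg =>
        have := add_mem hf hg
        rw [map_add, smul_add]
        convert this using 1
        abel
      | tmul a u =>
        rw [parity_tmul, ← TensorProduct.tmul_smul, ← TensorProduct.tmul_add]
        exact Submodule.subset_span ⟨a, _, mem_evenOdd_of_inv r u, rfl⟩
    have h' := key f
    rw [h, smul_smul, ← mul_pow] at h'
    simp only [mul_neg, mul_one, neg_neg, one_pow, one_smul, ← two_smul F f] at h'
    have := Submodule.smul_mem _ (2 : F)⁻¹ h'
    rwa [smul_smul, inv_mul_cancel₀ h2, one_smul] at this

theorem tmul_mem_inl (h2 : (2 : F) ≠ 0) (i : Fin m) (a : DividedPower F m)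
    {u : ExteriorAlgebra F (Fin n → F)} (hu : inv F n u = u) :
    a ⊗ₜ u ∈ superPart F m n (tau (Sum.inl i : Fin m ⊕ Fin n)) := by
  rw [mem_superPart_iff h2, parity_tmul]
  change a ⊗ₜ inv F n u = _
  simp [hu, tau]

theorem tmul_mem_inr (h2 : (2 : F) ≠ 0) (k : Fin n) (a : DividedPower F m)
    {u : ExteriorAlgebra F (Fin n → F)} (hu : inv F n u = -u) :
    a ⊗ₜ u ∈ superPart F m n (tau (Sum.inr k : Fin m ⊕ Fin n)) := by
  rw [mem_superPart_iff h2, parity_tmul]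
  change a ⊗ₜ inv F n u = _
  simp [hu, tau, TensorProduct.tmul_neg]

theorem parity_D (r : Fin m ⊕ Fin n) (f : SuperAlg F m n) :
    parity F m n (D F r f) = (-1 : F) ^ tau r • D F r (parity F m n f) := by
  have := sgn_D 1 r f
  rwa [sgn_one, sgn_one, one_mul] at this

theorem parity_parity (f : SuperAlg F m n) : parity F m n (parity F m n f) = f := by
  have := sgn_two f
  rwa [sgn, pow_two] at this

theorem neg_one_pow_mul_self (e : ℕ) : (-1 : F) ^ e * (-1 : F) ^ e = 1 := by
  rw [← mul_pow]; simp

/-! ### Even vector fields -/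

/-- The operator `f D_r`. -/
def fld (f : SuperAlg F m n) (r : Fin m ⊕ Fin n) : Module.End F (SuperAlg F m n) :=
  LinearMap.mulLeft F f ∘ₗ D F r

theorem fld_apply (f : SuperAlg F m n) (r : Fin m ⊕ Fin n) (g : SuperAlg F m n) :
    fld f r g = f * D F r g := rfl

theorem vf_single_eq (r : Fin m ⊕ Fin n) (f : SuperAlg F m n) : vf (Pi.single r f) = fld f r :=
  vf_single r f

theorem fld_x (f : SuperAlg F m n) (r s : Fin m ⊕ Fin n) :
    fld f r (x F s) = if r = s then f else 0 := by
  rw [fld_apply, D_x]; split_ifs <;> simp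

theorem fld_add (f g : SuperAlg F m n) (r : Fin m ⊕ Fin n) :
    fld (f + g) r = fld f r + fld g r := by
  rw [← vf_single_eq, Pi.single_add, map_add, vf_single_eq, vf_single_eq]

theorem fld_sub (f g : SuperAlg F m n) (r : Fin m ⊕ Fin n) :
    fld (f - g) r = fld f r - fld g r := by
  rw [← vf_single_eq, Pi.single_sub, map_sub, vf_single_eq, vf_single_eq]

theorem fld_smul (c : F) (f : SuperAlg F m n) (r : Fin m ⊕ Fin n) :
    fld (c • f) r = c • fld f r := by
  rw [← vf_single_eq, Pi.single_smul, map_smul, vf_single_eq]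

theorem fld_neg (f : SuperAlg F m n) (r : Fin m ⊕ Fin n) : fld (-f) r = -fld f r := by
  rw [← vf_single_eq, Pi.single_neg, map_neg, vf_single_eq]

@[simp] theorem fld_zero (r : Fin m ⊕ Fin n) : fld (0 : SuperAlg F m n) r = 0 := by
  rw [← vf_single_eq, Pi.single_zero, map_zero]

theorem fld_one (r : Fin m ⊕ Fin n) : fld (1 : SuperAlg F m n) r = D F r :=
  LinearMap.ext fun g => by rw [fld_apply, one_mul]

/-- The commutator of two even fields `f D_r` and `g D_s`. -/
theorem lie_fld {r s : Fin m ⊕ Fin n} {f g : SuperAlg F m n}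
    (hf : f ∈ superPart F m n (tau r)) (hg : g ∈ superPart F m n (tau s)) :
    ⁅fld f r, fld g s⁆ = fld (f * D F r g) s - fld (g * D F s f) r := by
  have hs : ∀ (r : Fin m ⊕ Fin n) (f : SuperAlg F m n), f ∈ superPart F m n (tau r) →
      ∀ q, (Pi.single r f : Fin m ⊕ Fin n → SuperAlg F m n) q ∈ superPart F m n (tau q) := by
    intro r f hf q
    by_cases h : q = r
    · subst h; simpa using hf
    · simp [h]
  rw [← vf_single_eq, ← vf_single_eq, vf_bracket (hs r f hf) (hs s g hg), ← vf_single_eq,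
    ← vf_single_eq, ← map_sub]
  congr 1
  funext q
  rw [vf_single_eq, vf_single_eq, Pi.sub_apply, fld_apply, fld_apply]
  congr 1
  · by_cases h : q = s
    · subst h; simp
    · simp [h]
  · by_cases h : q = r
    · subst h; simp
    · simp [h]

/-- The commutator of `D_i`, `i ∈ Y₀`, with `g D_s`. No parity condition is needed. -/
theorem lie_D_fld (i : Fin m) (g : SuperAlg F m n) (s : Fin m ⊕ Fin n) :
    ⁅(D F (.inl i) : Module.End F (SuperAlg F m n)), fld g s⁆ = fld (D F (.inl i) g) s := by
  refine LinearMap.ext fun h => ?_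
  rw [LieRing.of_associative_ring_bracket, LinearMap.sub_apply, Module.End.mul_apply,
    Module.End.mul_apply, fld_apply, fld_apply, fld_apply, D_mul, D_comm (.inl i) s]
  simp [tau, sgn_zero]

variable (F n) in
/-- The even part of `W(m, n; t)`. An operator is a vector field if it is determined by its values
on the generators `x_r`, which are its coefficients. -/
def evenW (p : ℕ) (t : Fin m → ℕ) : Submodule F (Module.End F (SuperAlg F m n)) where
  carrier := {E | E = vf (fun r => E (x F r)) ∧
    ∀ r, E (x F r) ∈ trunc F n p t ∧ E (x F r) ∈ superPart F m n (tau r)}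
  add_mem' := by
    rintro E G ⟨hE, hE'⟩ ⟨hG, hG'⟩
    refine ⟨?_, fun r => ⟨add_mem (hE' r).1 (hG' r).1, add_mem (hE' r).2 (hG' r).2⟩⟩
    have : (fun r => (E + G) (x F r)) = (fun r => E (x F r)) + fun r => G (x F r) := rfl
    rw [this, map_add, ← hE, ← hG]
  zero_mem' := by
    refine ⟨?_, fun r => ⟨zero_mem _, zero_mem _⟩⟩
    have : (fun r => (0 : Module.End F (SuperAlg F m n)) (x F r)) = 0 := rfl
    rw [this, map_zero]
  smul_mem' := by
    rintro c E ⟨hE, hE'⟩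
    refine ⟨?_, fun r => ⟨Submodule.smul_mem _ _ (hE' r).1, Submodule.smul_mem _ _ (hE' r).2⟩⟩
    have : (fun r => (c • E) (x F r)) = c • fun r => E (x F r) := rfl
    rw [this, map_smul, ← hE]

variable {p : ℕ} {t : Fin m → ℕ}

theorem vf_mem_evenW {f : Fin m ⊕ Fin n → SuperAlg F m n} (h : ∀ r, f r ∈ trunc F n p t)
    (h' : ∀ r, f r ∈ superPart F m n (tau r)) : vf f ∈ evenW F n p t := by
  have e : (fun r => vf f (x F r)) = f := funext fun r => vf_x f r
  refine ⟨by rw [e], fun r => ?_⟩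
  rw [vf_x]
  exact ⟨h r, h' r⟩

theorem fld_mem_evenW {r : Fin m ⊕ Fin n} {f : SuperAlg F m n} (h : f ∈ trunc F n p t)
    (h' : f ∈ superPart F m n (tau r)) : fld f r ∈ evenW F n p t := by
  rw [← vf_single_eq]
  refine vf_mem_evenW (fun s => ?_) fun s => ?_ <;>
  · by_cases hs : s = r
    · subst hs; simpa using ‹_›
    · simp [hs]

theorem evenW_ext {E G : Module.End F (SuperAlg F m n)} (hE : E ∈ evenW F n p t)
    (hG : G ∈ evenW F n p t) (h : ∀ r, E (x F r) = G (x F r)) : E = G := by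
  rw [hE.1, hG.1]
  congr 1
  exact funext h

theorem evenW_apply {E : Module.End F (SuperAlg F m n)} (hE : E ∈ evenW F n p t)
    (f : SuperAlg F m n) : E f = ∑ r, E (x F r) * D F r f := by
  conv_lhs => rw [hE.1]
  exact vf_apply _ _

theorem evenW_mul {E : Module.End F (SuperAlg F m n)} (hE : E ∈ evenW F n p t)
    (f g : SuperAlg F m n) : E (f * g) = E f * g + f * E g := by
  rw [evenW_apply hE, evenW_apply hE f, evenW_apply hE g, Finset.sum_mul, Finset.mul_sum,
    ← Finset.sum_add_distrib]
  refine Finset.sum_congr rfl fun r _ => ?_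
  have : ∀ f : SuperAlg F m n, sgn (tau r) (sgn (tau r) f) = f := by
    intro f
    cases r
    · simp [tau, sgn_zero]
    · simp [tau, sgn_one, parity_parity]
  rw [D_mul, mul_add, mul_assoc, ← mul_assoc _ (sgn _ f), ← mul_assoc f,
    mul_of_mem r (hE.2 r).2 (sgn _ f), this]

theorem lie_apply (E G : Module.End F (SuperAlg F m n)) (f : SuperAlg F m n) :
    ⁅E, G⁆ f = E (G f) - G (E f) := by
  rw [LieRing.of_associative_ring_bracket]; rfl

theorem evenW_apply_trunc [Fact p.Prime] [CharP F p] {E : Module.End F (SuperAlg F m n)}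
    (hE : E ∈ evenW F n p t) {f : SuperAlg F m n} (hf : f ∈ trunc F n p t) :
    E f ∈ trunc F n p t := by
  rw [evenW_apply hE]
  exact Submodule.sum_mem _ fun r _ => mul_trunc p t (hE.2 r).1 (D_trunc p t r hf)

theorem evenW_parity {E : Module.End F (SuperAlg F m n)} (hE : E ∈ evenW F n p t)
    (f : SuperAlg F m n) : parity F m n (E f) = E (parity F m n f) := by
  rw [evenW_apply hE, evenW_apply hE, map_sum]
  refine Finset.sum_congr rfl fun r _ => ?_
  have := sgn_of_mem 1 r (hE.2 r).2
  rw [sgn_one, one_mul] at this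
  rw [map_mul, parity_D, this, smul_mul_assoc, mul_smul_comm, smul_smul, neg_one_pow_mul_self,
    one_smul]

theorem lie_mem_evenW [Fact p.Prime] [CharP F p] (h2 : (2 : F) ≠ 0)
    {E G : Module.End F (SuperAlg F m n)} (hE : E ∈ evenW F n p t) (hG : G ∈ evenW F n p t) :
    ⁅E, G⁆ ∈ evenW F n p t := by
  have key : ∀ {E G : Module.End F (SuperAlg F m n)}, E ∈ evenW F n p t → G ∈ evenW F n p t →
      ∀ r, E (G (x F r)) ∈ superPart F m n (tau r) := by
    intro E G hE hG r
    rw [mem_superPart_iff h2, evenW_parity hE, (mem_superPart_iff h2 r).1 (hG.2 r).2, map_smul]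
  have e : ⁅E, G⁆ = vf fun r => E (G (x F r)) - G (E (x F r)) := by
    conv_lhs => rw [hE.1, hG.1]
    rw [vf_bracket (fun r => (hE.2 r).2) fun r => (hG.2 r).2, ← hE.1, ← hG.1]
  rw [e]
  exact vf_mem_evenW
    (fun r => sub_mem (evenW_apply_trunc hE (hG.2 r).1) (evenW_apply_trunc hG (hE.2 r).1))
    fun r => sub_mem (key hE hG r) (key hG hE r)

theorem evenW_le_evenEnd (h2 : (2 : F) ≠ 0) (i : Fin m) (k : Fin n) :
    evenW F n p t ≤ evenEnd F m n := by
  intro E hE θ f hf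
  obtain ⟨r, rfl⟩ : ∃ r : Fin m ⊕ Fin n, θ = tau r := by
    fin_cases θ
    · exact ⟨.inl i, rfl⟩
    · exact ⟨.inr k, rfl⟩
  rw [mem_superPart_iff h2] at hf ⊢
  rw [evenW_parity hE, hf, map_smul]

theorem Sbar_inf_evenEnd_le : Sbar F n p t ⊓ evenEnd F m n ≤ evenW F n p t := by
  rintro _ ⟨⟨f, ⟨hf, -⟩, rfl⟩, h'⟩
  refine vf_mem_evenW (fun r => hf r trivial) fun r => ?_
  rw [← vf_x f r]
  exact h' _ _ (x_mem r)

theorem evenS_le_evenW [Fact p.Prime] [CharP F p] {E : Module.End F (SuperAlg F m n)}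
    (hE : E ∈ evenS F n p t) : E ∈ evenW F n p t :=
  Sbar_inf_evenEnd_le ⟨S_le_Sbar p t hE.1, hE.2⟩

/-! ### Elements of `𝒮` -/

theorem Drs_eq (r s : Fin m ⊕ Fin n) (f : SuperAlg F m n) :
    Drs r s f = (-1 : F) ^ (tau r * tau s) • fld (D F r f) s
      - fld (D F s (sgn (tau r + tau s) f)) r := rfl

/-- The field `(a w) D_i + (∂_i a) w x_s D_s`; for even `w` which does not involve `x_s` it is
`D_is(a x_s w)`. -/
def zfld (a : DividedPower F m) (w : ExteriorAlgebra F (Fin n → F)) (i : Fin m) (s : Fin n) :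
    Module.End F (SuperAlg F m n) :=
  fld (a ⊗ₜ w) (.inl i) + fld (partialHom i a ⊗ₜ (w * gen F s)) (.inr s)

theorem zfld_eq_Drs (a : DividedPower F m) {w : ExteriorAlgebra F (Fin n → F)} (i : Fin m)
    {s : Fin n} (hw : inv F n w = w) (hs : dgen F s w = 0) :
    zfld a w i s = Drs (.inl i) (.inr s) (a ⊗ₜ (w * gen F s)) := by
  rw [Drs_eq, zfld]
  simp only [tau, zero_mul, pow_zero, one_smul, zero_add, sgn_one, parity_tmul, D_inl, D_inr_tmul]
  have : CliffordAlgebra.involute (w * gen F s) = -(w * gen F s) := by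
    change inv F n _ = _
    rw [map_mul, hw, inv_gen, mul_neg]
  rw [this, map_neg, dgen_mul, hs, hw]
  simp [TensorProduct.tmul_neg, fld_neg, add_comm]

theorem inv_mul_gen {w : ExteriorAlgebra F (Fin n → F)} (hw : inv F n w = w) (s : Fin n) :
    inv F n (w * gen F s) = -(w * gen F s) := by rw [map_mul, hw, inv_gen, mul_neg]

theorem zfld_mem_evenW (h2 : (2 : F) ≠ 0) {a : DividedPower F m} (ha : a ∈ tr p t)
    {w : ExteriorAlgebra F (Fin n → F)} (i : Fin m) (s : Fin n) (hw : inv F n w = w) :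
    zfld a w i s ∈ evenW F n p t :=
  add_mem (fld_mem_evenW (tmul_mem_trunc ha _) (tmul_mem_inl h2 i a hw))
    (fld_mem_evenW (tmul_mem_trunc (partial_mem_tr ha i) _) (tmul_mem_inr h2 s _ (inv_mul_gen hw s)))

theorem zfld_mem [Fact p.Prime] [CharP F p] (h2 : (2 : F) ≠ 0) {a : DividedPower F m}
    (ha : a ∈ tr p t) {w : ExteriorAlgebra F (Fin n → F)} (i : Fin m) {s : Fin n}
    (hw : inv F n w = w) (hs : dgen F s w = 0) : zfld a w i s ∈ evenS F n p t := by
  refine ⟨?_, evenW_le_evenEnd h2 i s (zfld_mem_evenW h2 ha i s hw)⟩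
  rw [zfld_eq_Drs a i hw hs]
  exact Submodule.subset_span ⟨_, _, _, tmul_mem_trunc ha _, rfl⟩

theorem bfld_mem [Fact p.Prime] [CharP F p] (h2 : (2 : F) ≠ 0) (i : Fin m) {a : DividedPower F m}
    (ha : a ∈ tr p t) {v : ExteriorAlgebra F (Fin n → F)} {s : Fin n}
    (hv : inv F n v = -v) (hs : dgen F s v = 0) : fld (a ⊗ₜ v) (.inr s) ∈ evenS F n p t := by
  refine ⟨?_, evenW_le_evenEnd h2 i s
    (fld_mem_evenW (tmul_mem_trunc ha _) (tmul_mem_inr h2 s a hv))⟩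
  have : fld (a ⊗ₜ v) (.inr s) = (-(2 : F)⁻¹) • Drs (.inr s) (.inr s) (a ⊗ₜ (gen F s * v)) := by
    rw [Drs_eq]
    simp only [tau, mul_one, pow_one, Nat.reduceAdd, sgn_two, D_inr_tmul, dgen_self_gen_mul, hs,
      mul_zero, sub_zero]
    have e : ∀ X : Module.End F (SuperAlg F m n), X = (-(2 : F)⁻¹) • ((-1 : F) • X - X) := by
      intro X
      match_scalars
      field_simp
      norm_num
    exact e _
  rw [this]
  exact Submodule.smul_mem _ _ (Submodule.subset_span ⟨_, _, _, tmul_mem_trunc ha _, rfl⟩)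

/-- The element `x_i D_i + x_k D_k` of the canonical torus, for `i ∈ Y₀` and `k ∈ Y₁`. -/
def hfld (F : Type*) [Field F] {m n : ℕ} (i : Fin m) (k : Fin n) :
    Module.End F (SuperAlg F m n) :=
  fld (x F (.inl i)) (.inl i) + fld (x F (.inr k)) (.inr k)

theorem hfld_eq (i : Fin m) (k : Fin n) :
    hfld F i k = zfld (mono F (Pi.single i 1)) 1 i k := by
  rw [hfld, zfld, partial_var, if_pos rfl, one_mul]; rfl

theorem D_eq_zfld (i : Fin m) (k : Fin n) : D F (.inl i) = zfld (1 : DividedPower F m) 1 i k := by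
  rw [zfld, partial_one, TensorProduct.zero_tmul, fld_zero, add_zero,
    ← Algebra.TensorProduct.one_def, fld_one]

theorem D_mem [Fact p.Prime] [CharP F p] (h2 : (2 : F) ≠ 0) (i : Fin m) (k : Fin n) :
    D F (.inl i) ∈ evenS F n p t := by
  rw [D_eq_zfld i k]
  exact zfld_mem h2 (one_mem_tr p t) i (map_one _) (dgen_one _)

theorem hfld_mem [Fact p.Prime] [CharP F p] (h2 : (2 : F) ≠ 0) (ht : ∀ i, 1 ≤ t i) (i : Fin m)
    (k : Fin n) : hfld F i k ∈ evenS F n p t := by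
  rw [hfld_eq]
  exact zfld_mem h2 (var_mem_tr ht i) i (map_one _) (dgen_one _)

theorem gen_fld_mem [Fact p.Prime] [CharP F p] (h2 : (2 : F) ≠ 0) (i : Fin m)
    {a : DividedPower F m} (ha : a ∈ tr p t) {k l : Fin n} (h : k ≠ l) :
    fld (a ⊗ₜ gen F k) (.inr l) ∈ evenS F n p t :=
  bfld_mem h2 i ha (inv_gen k) (dgen_gen_ne h.symm)

end SuperAlg

/-! ### Commutators in `𝒮` -/

namespace SuperAlg

open DividedPower

variable {F : Type*} [Field F] {m n : ℕ} {a b c : DividedPower F m}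
  {u v w : ExteriorAlgebra F (Fin n → F)}

theorem lie_inl_inl (h2 : (2 : F) ≠ 0) (i j : Fin m) (hu : inv F n u = u) (hv : inv F n v = v) :
    ⁅fld (a ⊗ₜ u) (.inl i), fld (b ⊗ₜ v) (.inl j)⁆
      = fld ((a * partialHom i b) ⊗ₜ (u * v)) (.inl j)
        - fld ((b * partialHom j a) ⊗ₜ (v * u)) (.inl i) := by
  rw [lie_fld (tmul_mem_inl h2 i a hu) (tmul_mem_inl h2 j b hv), D_inl, D_inl,
    Algebra.TensorProduct.tmul_mul_tmul, Algebra.TensorProduct.tmul_mul_tmul]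

theorem lie_inl_inr (h2 : (2 : F) ≠ 0) (i : Fin m) (k : Fin n) (hu : inv F n u = u)
    (hv : inv F n v = -v) :
    ⁅fld (a ⊗ₜ u) (.inl i), fld (b ⊗ₜ v) (.inr k)⁆
      = fld ((a * partialHom i b) ⊗ₜ (u * v)) (.inr k)
        - fld ((b * a) ⊗ₜ (v * dgen F k u)) (.inl i) := by
  rw [lie_fld (tmul_mem_inl h2 i a hu) (tmul_mem_inr h2 k b hv), D_inl, D_inr_tmul,
    Algebra.TensorProduct.tmul_mul_tmul, Algebra.TensorProduct.tmul_mul_tmul]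

theorem lie_inr_inl (h2 : (2 : F) ≠ 0) (k : Fin n) (j : Fin m) (hu : inv F n u = -u)
    (hv : inv F n v = v) :
    ⁅fld (a ⊗ₜ u) (.inr k), fld (b ⊗ₜ v) (.inl j)⁆
      = fld ((a * b) ⊗ₜ (u * dgen F k v)) (.inl j)
        - fld ((b * partialHom j a) ⊗ₜ (v * u)) (.inr k) := by
  rw [lie_fld (tmul_mem_inr h2 k a hu) (tmul_mem_inl h2 j b hv), D_inl, D_inr_tmul,
    Algebra.TensorProduct.tmul_mul_tmul, Algebra.TensorProduct.tmul_mul_tmul]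

theorem lie_inr_inr (h2 : (2 : F) ≠ 0) (k l : Fin n) (hu : inv F n u = -u)
    (hv : inv F n v = -v) :
    ⁅fld (a ⊗ₜ u) (.inr k), fld (b ⊗ₜ v) (.inr l)⁆
      = fld ((a * b) ⊗ₜ (u * dgen F k v)) (.inr l)
        - fld ((b * a) ⊗ₜ (v * dgen F l u)) (.inr k) := by
  rw [lie_fld (tmul_mem_inr h2 k a hu) (tmul_mem_inr h2 l b hv), D_inr_tmul, D_inr_tmul,
    Algebra.TensorProduct.tmul_mul_tmul, Algebra.TensorProduct.tmul_mul_tmul]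

theorem inv_gen_mul_gen (k l : Fin n) : inv F n (gen F k * gen F l) = gen F k * gen F l := by
  rw [map_mul, inv_gen, inv_gen, neg_mul_neg]

theorem dgen_gen_mul_gen_left {k l : Fin n} (h : k ≠ l) :
    dgen F k (gen F k * gen F l) = gen F l := by
  rw [dgen_self_gen_mul, dgen_gen_ne h, mul_zero, sub_zero]

theorem dgen_gen_mul_gen_right {k l : Fin n} (h : l ≠ k) :
    dgen F l (gen F k * gen F l) = -gen F k := by
  rw [dgen_ne_gen_mul h, dgen_gen_self, mul_one]

theorem dgen_gen_mul_gen_ne {s k l : Fin n} (hk : s ≠ k) (hl : s ≠ l) :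
    dgen F s (gen F k * gen F l) = 0 := by
  rw [dgen_ne_gen_mul hk, dgen_gen_ne hl, mul_zero, neg_zero]

theorem dgen_mul_gen (hw : inv F n w = w) {s : Fin n} (hs : dgen F s w = 0) :
    dgen F s (w * gen F s) = w := by
  rw [dgen_mul, hs, hw, dgen_gen_self, zero_mul, zero_add, mul_one]

/-- The bracket of two root vectors of `𝔄(m) ⊗ sl(n)` whose roots add up to a root. -/
theorem lie_gen_fld (h2 : (2 : F) ≠ 0) {k l j : Fin n} (hkj : k ≠ j) :
    ⁅(fld (a ⊗ₜ gen F k) (.inr l) : Module.End F (SuperAlg F m n)), fld (b ⊗ₜ gen F l) (.inr j)⁆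
      = fld ((a * b) ⊗ₜ gen F k) (.inr j) := by
  rw [lie_inr_inr h2 l j (inv_gen k) (inv_gen l), dgen_gen_self, dgen_gen_ne hkj.symm]
  simp

theorem lie_gen_fld_swap (h2 : (2 : F) ≠ 0) (k l : Fin n) :
    ⁅(fld (a ⊗ₜ gen F k) (.inr l) : Module.End F (SuperAlg F m n)), fld (b ⊗ₜ gen F l) (.inr k)⁆
      = fld ((a * b) ⊗ₜ gen F k) (.inr k) - fld ((a * b) ⊗ₜ gen F l) (.inr l) := by
  rw [lie_inr_inr h2 l k (inv_gen k) (inv_gen l), dgen_gen_self, dgen_gen_self, mul_one, mul_one,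
    mul_comm b a]

/-- The subspace `{(c x_k) D_l}` is stable under the bracket with `a D_i + (∂_i a) x_s D_s`. -/
theorem lie_zfld_gen_fld (h2 : (2 : F) ≠ 0) (i : Fin m) (s : Fin n) {k l : Fin n} (h : k ≠ l) :
    ⁅(zfld a 1 i s : Module.End F (SuperAlg F m n)), fld (b ⊗ₜ gen F k) (.inr l)⁆
      = fld ((a * partialHom i b + (if s = k then partialHom i a * b else 0)
          - (if s = l then partialHom i a * b else 0)) ⊗ₜ gen F k) (.inr l) := by
  rw [zfld, add_lie, lie_inl_inr h2 i l (map_one _) (inv_gen k), one_mul (gen F s), one_mul,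
    lie_inr_inr h2 s l (inv_gen s) (inv_gen k), dgen_one, dgen_gen, dgen_gen]
  by_cases hk : s = k
  · subst hk
    simp [h, h.symm, TensorProduct.add_tmul, fld_add]
  · by_cases hl : s = l
    · subst hl
      simp [hk, sub_eq_add_neg, mul_comm b, TensorProduct.add_tmul, TensorProduct.neg_tmul, fld_add,
        fld_neg]
    · simp [hk, hl, Ne.symm hl]

theorem lie_fld_gen_mul_gen (h2 : (2 : F) ≠ 0) (i : Fin m) {s r : Fin n} (h : s ≠ r)
    (hv : inv F n v = -v) :
    ⁅(fld (a ⊗ₜ v) (.inr s) : Module.End F (SuperAlg F m n)),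
      fld (1 ⊗ₜ (gen F s * gen F r)) (.inl i)⁆ = zfld a (v * gen F r) i s := by
  rw [lie_inr_inl h2 s i hv (inv_gen_mul_gen s r), dgen_gen_mul_gen_left h, zfld, mul_one, one_mul,
    sub_eq_add_neg, ← fld_neg, ← TensorProduct.tmul_neg]
  congr 3
  rw [mul_assoc, gen_mul, gen_mul r v, hv, mul_assoc, gen_anticomm r s]
  simp [mul_assoc, hv, gen_anticomm s r]

theorem lie_one_fld_gen (h2 : (2 : F) ≠ 0) (i : Fin m) {s : Fin n} (k : Fin n)
    (hw : inv F n w = w) (hs : dgen F s w = 0) :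
    ⁅(fld (1 ⊗ₜ w) (.inl i) : Module.End F (SuperAlg F m n)), fld (b ⊗ₜ gen F k) (.inr s)⁆
      = fld (partialHom i b ⊗ₜ (w * gen F k)) (.inr s) := by
  rw [lie_inl_inr h2 i s hw (inv_gen k), hs]
  simp

theorem lie_zfld_var_gen (h2 : (2 : F) ≠ 0) (i : Fin m) {s k : Fin n} (h : s ≠ k)
    (hw : inv F n w = w) (hs : dgen F s w = 0) :
    ⁅(zfld a w i s : Module.End F (SuperAlg F m n)),
      fld (mono F (Pi.single i 1) ⊗ₜ gen F k) (.inr s)⁆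
      = fld ((a - mono F (Pi.single i 1) * partialHom i a) ⊗ₜ (w * gen F k)) (.inr s) := by
  rw [zfld, add_lie, lie_inl_inr h2 i s hw (inv_gen k), hs, partial_var, if_pos rfl,
    lie_inr_inr h2 s s (inv_mul_gen hw s) (inv_gen k), dgen_gen_ne h, dgen_mul_gen hw hs,
    gen_mul k w, hw, TensorProduct.sub_tmul, fld_sub]
  simp [sub_eq_add_neg]

theorem lie_gen_mul_fld (h2 : (2 : F) ≠ 0) (k l : Fin n)
    (hw : inv F n w = w) (hk : dgen F k w = 0) :
    ⁅(fld (1 ⊗ₜ (gen F k * w)) (.inr l) : Module.End F (SuperAlg F m n)),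
      fld (a ⊗ₜ gen F l) (.inr k)⁆
      = fld (a ⊗ₜ (gen F k * w)) (.inr k) - fld (a ⊗ₜ (gen F l * w)) (.inr l) := by
  have e : inv F n (gen F k * w) = -(gen F k * w) := by rw [map_mul, hw, inv_gen, neg_mul]
  rw [lie_inr_inr h2 l k e (inv_gen l), dgen_gen_self, dgen_self_gen_mul, hk]
  simp

/-- The map `a ↦ a D_i + (∂_i a) x_s D_s` sends the action of `x_k x_l D_j` to a derivative. -/
theorem lie_zfld_gen_mul_gen (h2 : (2 : F) ≠ 0) (i j : Fin m) {s k l : Fin n} (hk : s ≠ k)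
    (hl : s ≠ l) :
    ⁅(zfld a 1 i s : Module.End F (SuperAlg F m n)), fld (1 ⊗ₜ (gen F k * gen F l)) (.inl j)⁆
      = -zfld (partialHom j a) (gen F k * gen F l) i s := by
  rw [zfld, add_lie, lie_inl_inl h2 i j (map_one _) (inv_gen_mul_gen k l), one_mul (gen F s),
    lie_inr_inl h2 s j (inv_gen s) (inv_gen_mul_gen k l), dgen_gen_mul_gen_ne hk hl, partial_one,
    zfld, partialHom_comm i j]
  simp [add_comm]

theorem lie_zfld_zfld (h2 : (2 : F) ≠ 0) (i : Fin m) (s : Fin n) (hb : partialHom i b = 0) :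
    ⁅(zfld b 1 i s : Module.End F (SuperAlg F m n)), zfld c 1 i s⁆
      = zfld (b * partialHom i c) 1 i s := by
  rw [zfld, hb, TensorProduct.zero_tmul, fld_zero, add_zero, zfld, lie_add,
    lie_inl_inl h2 i i (map_one _) (map_one _), one_mul (gen F s),
    lie_inl_inr h2 i s (map_one _) (inv_gen s), hb, zfld, partialHom_mul, hb]
  simp

theorem lie_D_zfld (j i : Fin m) (s : Fin n) :
    ⁅(D F (.inl j) : Module.End F (SuperAlg F m n)), zfld a w i s⁆
      = zfld (partialHom j a) w i s := by
  rw [zfld, lie_add, lie_D_fld, lie_D_fld, D_inl, D_inl, zfld, partialHom_comm]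

theorem lie_gen_fld_gen_mul_gen (h2 : (2 : F) ≠ 0) (i : Fin m) {r k l : Fin n} (hk : l ≠ k) :
    ⁅(fld (1 ⊗ₜ gen F r) (.inr l) : Module.End F (SuperAlg F m n)),
      fld (1 ⊗ₜ (gen F k * gen F l)) (.inl i)⁆ = fld (1 ⊗ₜ (gen F k * gen F r)) (.inl i) := by
  rw [lie_inr_inl h2 l i (inv_gen r) (inv_gen_mul_gen k l), dgen_gen_mul_gen_right hk, partial_one,
    mul_neg, ← gen_anticomm k r]
  simp

theorem zfld_one_eq (i : Fin m) (s : Fin n) :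
    (zfld 1 w i s : Module.End F (SuperAlg F m n)) = fld (1 ⊗ₜ w) (.inl i) := by
  rw [zfld, partial_one, TensorProduct.zero_tmul, fld_zero, add_zero]

/-! ### Weights of vector fields with constant coefficients in the even variables -/

theorem hfld_x (i : Fin m) (k : Fin n) (r : Fin m ⊕ Fin n) :
    hfld F i k (x F r)
      = ((if r = .inl i then 1 else 0) + (if r = .inr k then 1 else 0) : F) • x F r := by
  rw [hfld, LinearMap.add_apply, fld_x, fld_x, add_smul]
  congr 1
  · by_cases h : r = .inl i
    · subst h; simp
    · simp [h, Ne.symm h]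
  · by_cases h : r = .inr k
    · subst h; simp
    · simp [h, Ne.symm h]

theorem hfld_tmul (i : Fin m) (k : Fin n) (α : Fin m → ℕ) (u : ExteriorAlgebra F (Fin n → F)) :
    hfld F i k (mono F α ⊗ₜ u) = mono F α ⊗ₜ ((α i : F) • u + gen F k * dgen F k u) := by
  rw [hfld, LinearMap.add_apply, fld_apply, fld_apply, D_inl, D_inr_tmul]
  change (mono F (Pi.single i 1) ⊗ₜ 1) * _ + (1 ⊗ₜ gen F k) * _ = _
  rw [Algebra.TensorProduct.tmul_mul_tmul, Algebra.TensorProduct.tmul_mul_tmul, var_mul_partial,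
    one_mul, one_mul, TensorProduct.tmul_add, TensorProduct.smul_tmul]

theorem hfld_one_tmul (i : Fin m) (k : Fin n) (u : ExteriorAlgebra F (Fin n → F)) :
    hfld F i k ((1 : DividedPower F m) ⊗ₜ u) = 1 ⊗ₜ (gen F k * dgen F k u) := by
  have := hfld_tmul i k 0 u
  simpa [mono_zero] using this

/-- The commutator with an element of the torus, coefficient by coefficient. -/
theorem lie_hfld_apply (i : Fin m) (k : Fin n) (E : Module.End F (SuperAlg F m n))
    (r : Fin m ⊕ Fin n) : ⁅hfld F i k, E⁆ (x F r) = hfld F i k (E (x F r))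
      - ((if r = .inl i then 1 else 0) + (if r = .inr k then 1 else 0) : F) • E (x F r) := by
  rw [lie_apply, hfld_x, map_smul]

end SuperAlg

/-! ### Fields that commute with the partial derivatives and with `𝔄(m; t) ⊗ sl(n)` -/

namespace SuperAlg

open DividedPower

variable {F : Type*} [Field F] {m n p : ℕ} {t : Fin m → ℕ}
  {E : Module.End F (SuperAlg F m n)}

/-- The constant term of the coefficient of `D_r` in a field. -/
def cc (E : Module.End F (SuperAlg F m n)) (r : Fin m ⊕ Fin n) : ExteriorAlgebra F (Fin n → F) :=
  cf 0 (E (x F r))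

theorem x_inl (i : Fin m) : x F (.inl i : Fin m ⊕ Fin n) = mono F (Pi.single i 1) ⊗ₜ 1 := rfl

theorem x_inr (k : Fin n) : x F (.inr k : Fin m ⊕ Fin n) = 1 ⊗ₜ gen F k := rfl

theorem D_one (r : Fin m ⊕ Fin n) : D F r (1 : SuperAlg F m n) = 0 := by
  rw [Algebra.TensorProduct.one_def]
  cases r with
  | inl i => rw [D_inl, partial_one, TensorProduct.zero_tmul]
  | inr k => rw [D_inr_tmul, dgen_one, TensorProduct.tmul_zero]

theorem evenW_one (hE : E ∈ evenW F n p t) : E 1 = 0 := by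
  rw [evenW_apply hE]
  exact Finset.sum_eq_zero fun r _ => by rw [D_one, mul_zero]

/-- The operators that commute with all `D_i`, `i ∈ Y₀`. For a vector field this means that its
coefficients do not involve the even variables. -/
abbrev ConstCoef (E : Module.End F (SuperAlg F m n)) : Prop :=
  ∀ j : Fin m, ⁅(D F (.inl j) : Module.End F (SuperAlg F m n)), E⁆ = 0

/-- A field that commutes with all `D_i`, `i ∈ Y₀`, has its coefficients in the exterior algebra. -/
theorem apply_x_eq (hE : E ∈ evenW F n p t) (hC : ConstCoef E)
    (r : Fin m ⊕ Fin n) : E (x F r) = 1 ⊗ₜ cc E r := by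
  refine eq_one_tmul_of_D fun j => ?_
  have := LinearMap.congr_fun (hC j) (x F r)
  rw [lie_apply, D_x, LinearMap.zero_apply, sub_eq_zero] at this
  rw [this]
  split_ifs
  · exact evenW_one hE
  · exact map_zero _

theorem one_tmul_inj {u v : ExteriorAlgebra F (Fin n → F)}
    (h : (1 : DividedPower F m) ⊗ₜ[F] u = 1 ⊗ₜ v) : u = v := by
  have := congrArg (cf 0) h
  rw [cf_tmul, cf_tmul, ← mono_zero, co_mono] at this
  simpa using this

theorem inv_cc_inl (hE : E ∈ evenW F n p t) (hC : ConstCoef E) (j : Fin m) :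
    inv F n (cc E (.inl j)) = cc E (.inl j) := by
  have := sgn_of_mem 1 _ (hE.2 (.inl j)).2
  rw [sgn_one, apply_x_eq hE hC, parity_tmul] at this
  simp only [tau, mul_zero, pow_zero, one_smul] at this
  exact one_tmul_inj this

/-- The weight space condition for a field with constant coefficients. -/
theorem gen_dgen_cc (hE : E ∈ evenW F n p t) (hC : ConstCoef E) {q : Fin m}
    {k : Fin n} {c : F} (h : ⁅hfld F q k, E⁆ = c • E) (r : Fin m ⊕ Fin n) :
    gen F k * dgen F k (cc E r)
      = (c + ((if r = .inl q then 1 else 0) + (if r = .inr k then 1 else 0))) • cc E r := by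
  have := LinearMap.congr_fun h (x F r)
  rw [lie_hfld_apply, LinearMap.smul_apply, sub_eq_iff_eq_add, ← add_smul, apply_x_eq hE hC,
    hfld_one_tmul, ← TensorProduct.tmul_smul] at this
  exact one_tmul_inj this

theorem smul_eq_self_of_ne_zero {c d : F} {u : ExteriorAlgebra F (Fin n → F)} (hu : u ≠ 0)
    (h : c • u = d • u) : c = d := smul_left_injective F hu h

theorem gen_dgen_eq_self {k : Fin n} {u : ExteriorAlgebra F (Fin n → F)} (h : gen F k * u = 0) :
    gen F k * dgen F k u = u := by
  have := dgen_self_gen_mul k u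
  rw [h, map_zero, eq_comm, sub_eq_zero] at this
  exact this.symm

/-- A field with constant coefficients which commutes with `𝔄(m; t) ⊗ sl(n)` is the sum of a multiple
of the Euler field `∑ x_k D_k`, `k ∈ Y₁`, and of a combination of the `D_i`, `i ∈ Y₀`, whose
coefficients are annihilated by all odd variables. -/
theorem cc_of_lie_gen_fld [Fact p.Prime] (ht : ∀ i, 1 ≤ t i) (hn : 2 ≤ n)
    (hE : E ∈ evenW F n p t) (hC : ConstCoef E)
    (hL : ∀ b ∈ tr p t, ∀ k l, k ≠ l →
      ⁅E, (fld (b ⊗ₜ gen F k) (.inr l) : Module.End F (SuperAlg F m n))⁆ = 0) :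
    (∃ c : F, ∀ k, cc E (.inr k) = c • gen F k) ∧ ∀ j k, gen F k * cc E (.inl j) = 0 := by
  have h1 : ∀ b ∈ tr p t, ∀ k l, k ≠ l → E (b ⊗ₜ gen F k) = b ⊗ₜ (gen F k * dgen F l (cc E (.inr l))) := by
    intro b hb k l hkl
    have := LinearMap.congr_fun (hL b hb k l hkl) (x F (.inr l))
    rw [lie_apply, fld_x, if_pos rfl, LinearMap.zero_apply, sub_eq_zero] at this
    rw [this, fld_apply, apply_x_eq hE hC, D_inr_tmul, Algebra.TensorProduct.tmul_mul_tmul, mul_one]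
  have h2 : ∀ k l, k ≠ l → cc E (.inr k) = gen F k * dgen F l (cc E (.inr l)) := by
    intro k l hkl
    refine one_tmul_inj (m := m) ?_
    rw [← h1 1 (one_mem_tr p t) k l hkl, ← x_inr, apply_x_eq hE hC]
  have h3 : ∀ k l : Fin n, k ≠ l → dgen F l (cc E (.inr k)) = 0 := by
    intro k l hkl
    rw [h2 k l hkl, dgen_ne_gen_mul hkl.symm, dgen_dgen, mul_zero, neg_zero]
  have hex : ∀ k : Fin n, ∃ l, k ≠ l := by
    intro k
    by_contra! h
    have h0 := h ⟨0, by omega⟩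
    have h1 := h ⟨1, by omega⟩
    rw [h0] at h1
    simp at h1
  have h4 : ∀ k, ∃ c : F, cc E (.inr k) = c • gen F k := by
    intro k
    obtain ⟨l, hl⟩ := hex k
    obtain ⟨c, hc⟩ := exists_smul_one_of_dgen (u := dgen F k (cc E (.inr k))) fun r => by
      by_cases hr : k = r
      · subst hr; exact dgen_dgen _ _
      · rw [dgen_comm, h3 k r hr, map_zero, neg_zero]
    refine ⟨c, ?_⟩
    have : gen F k * cc E (.inr k) = 0 := by rw [h2 k l hl, gen_mul_gen_mul_self]
    rw [← gen_dgen_eq_self this, hc, mul_smul_comm, mul_one]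
  choose c hc using h4
  refine ⟨⟨c ⟨0, by omega⟩, fun k => ?_⟩, fun j k => ?_⟩
  · by_cases hk : k = ⟨0, by omega⟩
    · rw [hk, hc]
    · rw [h2 k _ hk, hc ⟨0, by omega⟩, map_smul, dgen_gen_self, mul_smul_comm, mul_one]
  · obtain ⟨l, hl⟩ := hex k
    have e := h1 _ (var_mem_tr ht j) k l hl
    have e' : (mono F (Pi.single j 1) ⊗ₜ gen F k : SuperAlg F m n) = x F (.inl j) * x F (.inr k) := by
      rw [x_inl, x_inr, Algebra.TensorProduct.tmul_mul_tmul, mul_one, one_mul]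
    rw [← h2 k l hl, e', evenW_mul hE, apply_x_eq hE hC, apply_x_eq hE hC, x_inl, x_inr,
      Algebra.TensorProduct.tmul_mul_tmul, Algebra.TensorProduct.tmul_mul_tmul, mul_one, mul_one,
      one_mul, add_eq_right] at e
    rw [gen_mul, inv_cc_inl hE hC]
    refine one_tmul_inj (m := m) ?_
    rw [e, TensorProduct.tmul_zero]

theorem cc_inr_eq_zero (h2 : (2 : F) ≠ 0) (hE : E ∈ evenW F n p t)
    (hC : ConstCoef E) {c : F} (hc : ∀ k, cc E (.inr k) = c • gen F k)
    {k l : Fin n} (hkl : k ≠ l) {i : Fin m}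
    (h : ⁅E, fld (1 ⊗ₜ (gen F k * gen F l)) (.inl i)⁆ = 0) (r : Fin n) : cc E (.inr r) = 0 := by
  have e := LinearMap.congr_fun h (x F (.inl i))
  have e' : (1 ⊗ₜ (gen F k * gen F l) : SuperAlg F m n) = x F (.inr k) * x F (.inr l) := by
    rw [x_inr, x_inr, Algebra.TensorProduct.tmul_mul_tmul, mul_one]
  rw [lie_apply, fld_x, if_pos rfl, LinearMap.zero_apply, fld_apply, apply_x_eq hE hC, D_inl,
    partial_one, TensorProduct.zero_tmul, mul_zero, sub_zero, e', evenW_mul hE,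
    apply_x_eq hE hC, apply_x_eq hE hC, x_inr, x_inr,
    Algebra.TensorProduct.tmul_mul_tmul, Algebra.TensorProduct.tmul_mul_tmul, mul_one, hc, hc,
    smul_mul_assoc, mul_smul_comm, ← TensorProduct.tmul_add, ← two_smul F, smul_smul] at e
  have e2 := one_tmul_inj (m := m) (e.trans (TensorProduct.tmul_zero _ _).symm)
  have e3 := congrArg (dgen F k) e2
  rw [map_smul, dgen_gen_mul_gen_left hkl, map_zero, smul_eq_zero, mul_eq_zero] at e3
  have : c = 0 := by
    rcases e3 with (h | h) | h
    · exact absurd h h2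
    · exact h
    · exact absurd h (gen_ne_zero l)
  rw [hc, this, zero_smul]

/-- If the coefficient of `D_j` is annihilated by all odd variables then it has odd weight
`(1, …, 1)`; this restricts the weight of the field. -/
theorem weight_of_cc_inl (hE : E ∈ evenW F n p t) (hC : ConstCoef E) {j : Fin m}
    {k : Fin n} (h0 : gen F k * cc E (.inl j) = 0) (hj : cc E (.inl j) ≠ 0) {q : Fin m} {c : F}
    (h : ⁅hfld F q k, E⁆ = c • E) : c + (if j = q then 1 else 0) = 1 := by
  have := gen_dgen_cc hE hC h (.inl j)
  rw [gen_dgen_eq_self h0] at this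
  refine smul_eq_self_of_ne_zero hj ?_
  simpa using this.symm

theorem eq_zero_of_cc (hE : E ∈ evenW F n p t) (hC : ConstCoef E)
    (h : ∀ r, cc E r = 0) : E = 0 := by
  refine evenW_ext hE (zero_mem _) fun r => ?_
  rw [apply_x_eq hE hC, h, TensorProduct.tmul_zero, LinearMap.zero_apply]

/-- The centralizer of `𝒮` in the even part of `W(m, n; t)` is zero. -/
theorem eq_zero_of_lie_evenS [Fact p.Prime] [CharP F p] (h2 : (2 : F) ≠ 0) (hm : 2 ≤ m)
    (hn : 3 ≤ n) (ht : ∀ i, 1 ≤ t i) (hE : E ∈ evenW F n p t)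
    (h : ∀ G ∈ evenS F n p t, ⁅E, G⁆ = 0) : E = 0 := by
  let i0 : Fin m := ⟨0, by omega⟩
  let k0 : Fin n := ⟨0, by omega⟩
  let k1 : Fin n := ⟨1, by omega⟩
  let k2 : Fin n := ⟨2, by omega⟩
  have hC : ConstCoef E := fun j => by
    rw [← lie_skew, h _ (D_mem h2 j k0), neg_zero]
  obtain ⟨⟨c, hc⟩, htop⟩ := cc_of_lie_gen_fld ht (by omega) hE hC fun b hb k l hkl =>
    h _ (gen_fld_mem h2 i0 hb hkl)
  have hmem : fld (1 ⊗ₜ (gen F k0 * gen F k1)) (.inl i0) ∈ evenS F n p t := by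
    rw [← zfld_one_eq i0 k2]
    exact zfld_mem h2 (one_mem_tr p t) i0 (inv_gen_mul_gen _ _)
      (dgen_gen_mul_gen_ne (by simp [k2, k0]) (by simp [k2, k1]))
  refine eq_zero_of_cc hE hC fun r => ?_
  cases r with
  | inr k => exact cc_inr_eq_zero h2 hE hC hc (by simp [k0, k1]) (h _ hmem) k
  | inl j =>
    by_contra hj
    obtain ⟨q, hq⟩ : ∃ q, j ≠ q := by
      by_contra! h
      have h0 := h i0
      have h1 := h ⟨1, by omega⟩
      rw [h0] at h1
      simp [i0] at h1
    have := weight_of_cc_inl hE hC (htop j k0) hj (q := q) (c := 0)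
      (by rw [zero_smul, ← lie_skew, h _ (hfld_mem h2 ht q k0), neg_zero])
    simp [hq] at this

theorem lie_D_apply (i : Fin m) {E : Module.End F (SuperAlg F m n)} (hE : E ∈ evenW F n p t)
    (r : Fin m ⊕ Fin n) :
    ⁅(D F (.inl i) : Module.End F (SuperAlg F m n)), E⁆ (x F r) = D F (.inl i) (E (x F r)) := by
  rw [lie_apply, D_x]
  split_ifs
  · rw [evenW_one hE, sub_zero]
  · rw [map_zero, sub_zero]

theorem lie_D_D (i j : Fin m) :
    ⁅(D F (.inl i) : Module.End F (SuperAlg F m n)),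
      (D F (.inl j) : Module.End F (SuperAlg F m n))⁆ = 0 := by
  refine LinearMap.ext fun f => ?_
  rw [lie_apply, D_comm (.inl i) (.inl j)]
  simp [tau]

end SuperAlg

/-! ### Derivations and powers of inner derivations in characteristic `p` -/

section CharP

variable {F : Type*} [Field F] {p : ℕ} [Fact p.Prime] [CharP F p]

theorem sub_pow_char_pow_of_algebra {R : Type*} [Ring R] [Algebra F R] {x y : R}
    (h : Commute x y) (e : ℕ) : (x - y) ^ p ^ e = x ^ p ^ e - y ^ p ^ e := by
  rcases subsingleton_or_nontrivial R with hR | hR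
  · exact Subsingleton.elim _ _
  · have : CharP R p := charP_of_injective_algebraMap (algebraMap F R).injective p
    exact sub_pow_char_pow_of_commute _ _ h

theorem ad_pow_char {A : Type*} [Ring A] [Algebra F A] (x : A) (e : ℕ) :
    LieAlgebra.ad F A x ^ p ^ e = LieAlgebra.ad F A (x ^ p ^ e) := by
  have h : ∀ x : A, LieAlgebra.ad F A x = LinearMap.mulLeft F x - LinearMap.mulRight F x := by
    intro x
    refine LinearMap.ext fun y => ?_
    rw [LieAlgebra.ad_apply, LieRing.of_associative_ring_bracket]; rfl
  rw [h, h, sub_pow_char_pow_of_algebra (F := F) (p := p) (LinearMap.commute_mulLeft_right x x),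
    LinearMap.pow_mulLeft, LinearMap.pow_mulRight]

/-- The failure of a derivation to commute with `(ad D)^(p^e)` is the inner derivation given by
`(ad D)^(p^e - 1) (φ D)`. -/
theorem derivation_ad_pow {A : Type*} [LieRing A] [LieAlgebra F A] (S : LieSubalgebra F A)
    (hp : Odd p) {φ : Module.End F A}
    (hφ : ∀ y ∈ S, ∀ z ∈ S, φ ⁅y, z⁆ = ⁅φ y, z⁆ + ⁅y, φ z⁆) {D : A} (hD : D ∈ S) (e : ℕ) {y : A}
    (hy : y ∈ S) : φ ((LieAlgebra.ad F A D ^ p ^ e) y)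
      = (LieAlgebra.ad F A D ^ p ^ e) (φ y)
        + ⁅(LieAlgebra.ad F A D ^ (p ^ e - 1)) (φ D), y⁆ := by
  -- left and right composition with `ad D` are commuting operators on the linear maps `S → A`
  let a : Module.End F S := LieAlgebra.ad F S ⟨D, hD⟩
  let R : Module.End F (S →ₗ[F] A) := LinearMap.lcomp F A a
  let L : Module.End F (S →ₗ[F] A) := LinearMap.compRight F (LieAlgebra.ad F A D)
  let f : S →ₗ[F] A := φ ∘ₗ S.toSubmodule.subtype
  let g : A → (S →ₗ[F] A) := fun w => (LieAlgebra.ad F A w) ∘ₗ S.toSubmodule.subtype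
  have hRL : Commute R L := LinearMap.ext fun k => LinearMap.ext fun z => rfl
  have hR : ∀ (N : ℕ) (k : S →ₗ[F] A) (z : S), (R ^ N) k z = k ((a ^ N) z) := by
    intro N
    induction N with
    | zero => intro k z; rfl
    | succ N ih =>
      intro k z
      rw [pow_succ, Module.End.mul_apply, ih, pow_succ', Module.End.mul_apply]
      rfl
  have hL : ∀ (N : ℕ) (k : S →ₗ[F] A) (z : S),
      (L ^ N) k z = (LieAlgebra.ad F A D ^ N) (k z) := by
    intro N
    induction N with
    | zero => intro k z; rfl
    | succ N ih =>
      intro k z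
      rw [pow_succ, Module.End.mul_apply, ih, pow_succ, Module.End.mul_apply]
      rfl
  have ha : ∀ (N : ℕ) (z : S), ((a ^ N) z : A) = (LieAlgebra.ad F A D ^ N) (z : A) := by
    intro N
    induction N with
    | zero => intro z; rfl
    | succ N ih =>
      intro z
      rw [pow_succ, Module.End.mul_apply, ih, pow_succ, Module.End.mul_apply]
      rfl
  have h1 : (R - L) f = g (φ D) := by
    refine LinearMap.ext fun z => ?_
    change φ ⁅D, (z : A)⁆ - ⁅D, φ z⁆ = ⁅φ D, (z : A)⁆
    rw [hφ D hD z z.2, add_sub_cancel_right]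
  have h2 : ∀ w, (R - L) (g w) = g (-⁅D, w⁆) := by
    intro w
    refine LinearMap.ext fun z => ?_
    change ⁅w, ⁅D, (z : A)⁆⁆ - ⁅D, ⁅w, (z : A)⁆⁆ = ⁅-⁅D, w⁆, (z : A)⁆
    rw [neg_lie, lie_lie, neg_sub]
  have h3 : ∀ (N : ℕ) w, ((R - L) ^ N) (g w) = g ((-1 : F) ^ N • (LieAlgebra.ad F A D ^ N) w) := by
    intro N
    induction N with
    | zero => intro w; simp
    | succ N ih =>
      intro w
      rw [pow_succ, Module.End.mul_apply, h2, ih, map_neg, pow_succ, pow_succ, Module.End.mul_apply,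
        LieAlgebra.ad_apply, mul_neg_one, neg_smul, smul_neg]
  have hq : p ^ e - 1 + 1 = p ^ e := Nat.sub_add_cancel (pow_pos (Fact.out : p.Prime).pos e)
  have hq' : Even (p ^ e - 1) := Nat.Odd.sub_odd (hp.pow) odd_one
  have key := LinearMap.congr_fun (sub_pow_char_pow_of_algebra (F := F) (p := p) hRL e) f
  rw [← hq, pow_succ, Module.End.mul_apply, h1, h3, hq'.neg_one_pow, one_smul, hq] at key
  have key' := LinearMap.congr_fun key ⟨y, hy⟩
  rw [LinearMap.sub_apply, LinearMap.sub_apply, hR, hL] at key'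
  have e1 : f ((a ^ p ^ e) ⟨y, hy⟩) = φ ((LieAlgebra.ad F A D ^ p ^ e) y) := congrArg φ (ha _ _)
  rw [e1, eq_sub_iff_add_eq] at key'
  rw [← key', add_comm]
  rfl

end CharP

/-! ### Normalizing a derivation on the partial derivatives and on the torus -/

namespace SuperAlg

open DividedPower

variable {F : Type*} [Field F] {m n p : ℕ} [Fact p.Prime] [CharP F p] {t : Fin m → ℕ}

variable (n p t) in
/-- A linear operator on the space of all operators whose restriction to `𝒮` is a derivation with
values in the even part of `W(m, n; t)`. -/
structure IsDer (φ : Module.End F (Module.End F (SuperAlg F m n))) : Prop where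
  mem : ∀ y ∈ evenS F n p t, φ y ∈ evenW F n p t
  leib : ∀ y ∈ evenS F n p t, ∀ z ∈ evenS F n p t, φ ⁅y, z⁆ = ⁅φ y, z⁆ + ⁅y, φ z⁆

/-- The operator `ad w`. -/
abbrev adE (w : Module.End F (SuperAlg F m n)) : Module.End F (Module.End F (SuperAlg F m n)) :=
  LieAlgebra.ad F (Module.End F (SuperAlg F m n)) w

variable {φ ψ : Module.End F (Module.End F (SuperAlg F m n))}

theorem isDer_ad (h2 : (2 : F) ≠ 0) {w : Module.End F (SuperAlg F m n)}
    (hw : w ∈ evenW F n p t) : IsDer n p t (adE w) where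
  mem y hy := lie_mem_evenW h2 hw (evenS_le_evenW hy)
  leib y _ z _ := by rw [LieAlgebra.ad_apply, LieAlgebra.ad_apply, LieAlgebra.ad_apply, leibniz_lie]

theorem IsDer.sub (hφ : IsDer n p t φ) (hψ : IsDer n p t ψ) : IsDer n p t (φ - ψ) where
  mem y hy := sub_mem (hφ.mem y hy) (hψ.mem y hy)
  leib y hy z hz := by
    rw [LinearMap.sub_apply, LinearMap.sub_apply, LinearMap.sub_apply, hφ.leib y hy z hz,
      hψ.leib y hy z hz, sub_lie, lie_sub]
    abel

theorem ad_D_pow_apply (h2 : (2 : F) ≠ 0) (i : Fin m) (k : Fin n)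
    {E : Module.End F (SuperAlg F m n)} (hE : E ∈ evenW F n p t) (N : ℕ) :
    (adE (D F (.inl i)) ^ N) E ∈ evenW F n p t ∧
      ∀ r, (adE (D F (.inl i)) ^ N) E (x F r) = (D F (.inl i) ^ N) (E (x F r)) := by
  induction N with
  | zero => exact ⟨hE, fun r => rfl⟩
  | succ N ih =>
    rw [pow_succ', Module.End.mul_apply, LieAlgebra.ad_apply]
    refine ⟨lie_mem_evenW h2 (evenS_le_evenW (D_mem h2 i k)) ih.1, fun r => ?_⟩
    rw [lie_D_apply i ih.1, ih.2, pow_succ', Module.End.mul_apply]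

theorem odd_of_three_lt (hp : 3 < p) : Odd p := (Fact.out : p.Prime).odd_of_ne_two (by omega)

/-- Up to an inner derivation, a derivation kills all `D_i`, `i ∈ Y₀`. -/
theorem exists_ad_D (hp : 3 < p) (hm : 3 ≤ m) (hn : 3 ≤ n) (ht : ∀ i, 1 ≤ t i)
    (hφ : IsDer n p t φ) :
    ∃ w ∈ evenW F n p t, ∀ i : Fin m, φ (D F (.inl i)) = ⁅w, D F (.inl i)⁆ := by
  have h2 : (2 : F) ≠ 0 := two_ne_zero_of_char p hp
  let k0 : Fin n := ⟨0, by omega⟩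
  have key : ∀ s : Finset (Fin m), ∃ w ∈ evenW F n p t,
      ∀ i ∈ s, φ (D F (.inl i)) = ⁅w, D F (.inl i)⁆ := by
    intro s
    induction s using Finset.induction_on with
    | empty => exact ⟨0, zero_mem _, by simp⟩
    | insert i s hi ih =>
      obtain ⟨w, hw, hws⟩ := ih
      have hψ := hφ.sub (isDer_ad h2 hw)
      obtain ⟨E, hE⟩ : ∃ E, E = (φ - adE w) (D F (.inl i)) := ⟨_, rfl⟩
      have hEW : E ∈ evenW F n p t := hE ▸ hψ.mem _ (D_mem h2 i k0)
      have hcomm : ∀ j ∈ s, ∀ r, D F (.inl j) (E (x F r)) = 0 := by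
        intro j hj r
        have h0 : (φ - adE w) (D F (.inl j)) = 0 := by
          rw [LinearMap.sub_apply, hws j hj, LieAlgebra.ad_apply, sub_self]
        have := hψ.leib _ (D_mem h2 j k0) _ (D_mem h2 i k0)
        rw [lie_D_D, map_zero, h0, zero_lie, zero_add, ← hE] at this
        rw [← lie_D_apply j hEW, ← this, LinearMap.zero_apply]
      have hpow : ∀ r, (D F (.inl i) ^ (p ^ t i - 1)) (E (x F r)) = 0 := by
        have h0 : (adE (D F (.inl i)) ^ (p ^ t i - 1)) E = 0 := by
          refine eq_zero_of_lie_evenS h2 (by omega) hn ht (ad_D_pow_apply h2 i k0 hEW _).1 ?_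
          intro G hG
          have hz : ∀ G ∈ evenW F n p t, (adE (D F (.inl i)) ^ p ^ t i) G = 0 := by
            intro G hG
            have h := ad_D_pow_apply h2 i k0 hG (p ^ t i)
            refine evenW_ext h.1 (zero_mem _) fun r => ?_
            rw [h.2, D_pow_trunc (hG.2 r).1, LinearMap.zero_apply]
          have := derivation_ad_pow (evenS F n p t) (odd_of_three_lt hp) hψ.leib (D_mem h2 i k0)
            (t i) hG
          rw [hz G (evenS_le_evenW hG), hz _ (hψ.mem G hG), map_zero, zero_add, ← hE] at this
          exact this.symm
        intro r
        rw [← (ad_D_pow_apply h2 i k0 hEW _).2, h0, LinearMap.zero_apply]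
      have hv : vf (fun r => lift i (E (x F r))) ∈ evenW F n p t := by
        refine vf_mem_evenW (fun r => lift_mem_trunc (hEW.2 r).1 (hpow r)) fun r => ?_
        have h := sgn_of_mem 1 r (hEW.2 r).2
        rw [mem_superPart_iff h2, ← sgn_one, sgn_lift, h, map_smul, one_mul]
      refine ⟨w - vf (fun r => lift i (E (x F r))), sub_mem hw hv, fun j hj => ?_⟩
      have hcoef : ∀ j r, ⁅(D F (.inl j) : Module.End F (SuperAlg F m n)),
          vf (fun r => lift i (E (x F r)))⁆ (x F r) = D F (.inl j) (lift i (E (x F r))) := by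
        intro j r
        rw [lie_D_apply j hv, vf_x]
      have hlie := fun j => lie_mem_evenW h2 (evenS_le_evenW (D_mem h2 j k0)) hv
      rw [sub_lie, ← lie_skew (vf _) (D F (.inl j)), sub_neg_eq_add]
      rcases Finset.mem_insert.1 hj with rfl | hj
      · have : ⁅(D F (.inl j) : Module.End F (SuperAlg F m n)),
            vf (fun r => lift j (E (x F r)))⁆ = E :=
          evenW_ext (hlie j) hEW fun r => by rw [hcoef, D_lift]
        rw [this, hE, LinearMap.sub_apply, LieAlgebra.ad_apply, add_sub_cancel]
      · have hji : j ≠ i := fun h => hi (h ▸ hj)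
        have : ⁅(D F (.inl j) : Module.End F (SuperAlg F m n)),
            vf (fun r => lift i (E (x F r)))⁆ = 0 :=
          evenW_ext (hlie j) (zero_mem _) fun r => by
            rw [hcoef, D_lift_of_ne hji, hcomm j hj, map_zero, LinearMap.zero_apply]
        rw [this, add_zero, hws j hj]
  obtain ⟨w, hw, h⟩ := key Finset.univ
  exact ⟨w, hw, fun i => h i (Finset.mem_univ i)⟩

/-- The elements `x_i D_i + x_k D_k` of the torus are toral: they equal their `p`-th power. -/
theorem hfld_pow_char (i : Fin m) (k : Fin n) :
    (hfld F i k : Module.End F (SuperAlg F m n)) ^ p = hfld F i k := by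
  let N : Module.End F (ExteriorAlgebra F (Fin n → F)) :=
    LinearMap.mulLeft F (gen F k) ∘ₗ dgen F k
  have hN : ∀ j, 1 ≤ j → N ^ j = N := by
    intro j hj
    induction j, hj using Nat.le_induction with
    | base => exact pow_one N
    | succ j _ ih =>
      rw [pow_succ, ih]
      exact LinearMap.ext fun u => gen_dgen_gen_dgen k u
  have key : ∀ (α : Fin m → ℕ) (j : ℕ) (u : ExteriorAlgebra F (Fin n → F)),
      (hfld F i k ^ j) (mono F α ⊗ₜ u)
        = mono F α ⊗ₜ (((algebraMap F (Module.End F (ExteriorAlgebra F (Fin n → F))) (α i) + N) ^ j) u) := by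
    intro α j
    induction j with
    | zero => intro u; simp
    | succ j ih =>
      intro u
      rw [pow_succ, Module.End.mul_apply, hfld_tmul, ih, pow_succ, Module.End.mul_apply]
      rfl
  refine LinearMap.ext fun f => ?_
  induction f using TensorProduct.induction_on with
  | zero => simp
  | add f g hf hg => rw [map_add, map_add, hf, hg]
  | tmul a u =>
    induction a using DividedPower.ind with
    | h0 => simp
    | ha a a' h h' => rw [TensorProduct.add_tmul, map_add, map_add, h, h']
    | hs c a h => rw [← TensorProduct.smul_tmul', map_smul, map_smul, h]
    | h α =>
      have hc : Commute (algebraMap F (Module.End F (ExteriorAlgebra F (Fin n → F))) (α i)) (-N) :=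
        Algebra.commutes _ _
      have h1 := sub_pow_char_pow_of_algebra (F := F) (p := p) hc 1
      have hodd : (-N) ^ p = -N := by
        rcases (Fact.out : p.Prime).eq_two_or_odd' with h | h
        · subst h
          have : (2 : F) = 0 := by exact_mod_cast CharP.cast_eq_zero F 2
          rw [neg_sq, hN 2 (by norm_num), eq_neg_iff_add_eq_zero, ← two_smul F, this, zero_smul]
        · rw [h.neg_pow, hN p (Fact.out : p.Prime).one_lt.le]
      have hα : (α i : F) ^ p = α i := by rw [← frobenius_def, map_natCast]
      rw [pow_one, hodd, sub_neg_eq_add, sub_neg_eq_add, ← map_pow, hα] at h1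
      rw [key, h1, hfld_tmul]
      rfl

theorem lie_D_hfld (j i : Fin m) (k : Fin n) :
    ⁅(D F (.inl j) : Module.End F (SuperAlg F m n)), hfld F i k⁆
      = if j = i then D F (.inl i) else 0 := by
  rw [hfld_eq, lie_D_zfld, partial_var]
  split_ifs with h
  · exact (D_eq_zfld i k).symm
  · simp [zfld]

theorem lie_hfld_hfld (i j : Fin m) (k l : Fin n) :
    ⁅(hfld F i k : Module.End F (SuperAlg F m n)),
      (hfld F j l : Module.End F (SuperAlg F m n))⁆ = 0 := by
  refine LinearMap.ext fun f => ?_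
  induction f using TensorProduct.induction_on with
  | zero => simp
  | add f g hf hg => rw [map_add, hf, hg, map_add]
  | tmul a u =>
    induction a using DividedPower.ind with
    | h0 => simp
    | ha a a' h h' => rw [TensorProduct.add_tmul, map_add, h, h', map_add]
    | hs c a h => rw [← TensorProduct.smul_tmul', map_smul, h, map_smul]
    | h α =>
      rw [lie_apply, hfld_tmul, hfld_tmul, hfld_tmul, hfld_tmul, LinearMap.zero_apply,
        ← TensorProduct.tmul_sub]
      have : gen F k * dgen F k (gen F l * dgen F l u)
          = gen F l * dgen F l (gen F k * dgen F k u) := by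
        by_cases h : k = l
        · rw [h]
        · exact gen_dgen_comm h u
      simp only [map_add, map_smul, mul_add, mul_smul_comm, smul_add, this,
        smul_comm (α i : F) (α j : F)]
      refine (congrArg _ ?_).trans (TensorProduct.tmul_zero _ _)
      abel

/-- The value of a derivation at a toral element `h` lies in the image of `ad h`. -/
theorem IsDer.lie_toral (hφ : IsDer n p t φ) (hp : 3 < p) (hm : 3 ≤ m) (hn : 3 ≤ n)
    (ht : ∀ i, 1 ≤ t i) {h : Module.End F (SuperAlg F m n)} (hh : h ∈ evenS F n p t)
    (hpow : adE h ^ p = adE h) : ⁅h, (adE h ^ (p - 2)) (φ h)⁆ = φ h := by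
  have h2 : (2 : F) ≠ 0 := two_ne_zero_of_char p hp
  have hX : ∀ N, (adE h ^ N) (φ h) ∈ evenW F n p t := by
    intro N
    induction N with
    | zero => exact hφ.mem h hh
    | succ N ih =>
      rw [pow_succ', Module.End.mul_apply]
      exact lie_mem_evenW h2 (evenS_le_evenW hh) ih
  have hfix : φ h - (adE h ^ (p - 1)) (φ h) = 0 := by
    refine eq_zero_of_lie_evenS h2 (by omega) hn ht (sub_mem (hφ.mem h hh) (hX _)) fun G hG => ?_
    have key := derivation_ad_pow (evenS F n p t) (odd_of_three_lt hp) hφ.leib hh 1 hG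
    rw [pow_one, hpow] at key
    have key' := (hφ.leib h hh G hG).symm.trans key
    rw [add_comm] at key'
    rw [sub_lie, sub_eq_zero]
    exact add_left_cancel key'
  have e : p - 1 = p - 2 + 1 := by omega
  rw [e, pow_succ', Module.End.mul_apply, sub_eq_zero] at hfix
  exact hfix.symm

/-- Up to an inner derivation, a derivation that kills all `D_i` also kills the torus of `𝒮`. -/
theorem exists_ad_hfld (hp : 3 < p) (hm : 3 ≤ m) (hn : 3 ≤ n) (ht : ∀ i, 1 ≤ t i)
    (hφ : IsDer n p t φ) (hD : ∀ i : Fin m, φ (D F (.inl i)) = 0) :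
    ∃ w ∈ evenW F n p t, ConstCoef w ∧ ∀ (i : Fin m) (k : Fin n),
      φ (hfld F i k) = ⁅w, hfld F i k⁆ := by
  have h2 : (2 : F) ≠ 0 := two_ne_zero_of_char p hp
  have key : ∀ s : Finset (Fin m × Fin n), ∃ w ∈ evenW F n p t, ConstCoef w ∧
      ∀ q ∈ s, φ (hfld F q.1 q.2) = ⁅w, hfld F q.1 q.2⁆ := by
    intro s
    induction s using Finset.induction_on with
    | empty => exact ⟨0, zero_mem _, fun j => lie_zero _, by simp⟩
    | insert q s _ ih =>
      obtain ⟨w, hw, hwC, hws⟩ := ih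
      have hψ := hφ.sub (isDer_ad h2 hw)
      have hψD : ∀ i : Fin m, (φ - adE w) (D F (.inl i)) = 0 := by
        intro i
        rw [LinearMap.sub_apply, hD, LieAlgebra.ad_apply, ← lie_skew, hwC, neg_zero, sub_zero]
      obtain ⟨E, hE⟩ : ∃ E, E = (φ - adE w) (hfld F q.1 q.2) := ⟨_, rfl⟩
      have hmem := hfld_mem (p := p) (t := t) (n := n) h2 ht
      have hEW : E ∈ evenW F n p t := hE ▸ hψ.mem _ (hmem q.1 q.2)
      have hX : ∀ N, (adE (hfld F q.1 q.2) ^ N) E ∈ evenW F n p t ∧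
          ConstCoef ((adE (hfld F q.1 q.2) ^ N) E) ∧
          ∀ r ∈ s, ⁅hfld F r.1 r.2, (adE (hfld F q.1 q.2) ^ N) E⁆ = 0 := by
        intro N
        induction N with
        | zero =>
          refine ⟨hEW, fun j => ?_, fun r hr => ?_⟩
          · have := hψ.leib _ (D_mem h2 j q.2) _ (hmem q.1 q.2)
            rw [hψD, zero_lie, zero_add, lie_D_hfld, ← hE] at this
            refine this.symm.trans ?_
            split_ifs
            · exact hψD _
            · exact map_zero _
          · have h0 : (φ - adE w) (hfld F r.1 r.2) = 0 := by
              rw [LinearMap.sub_apply, hws r hr, LieAlgebra.ad_apply, sub_self]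
            have := hψ.leib _ (hmem r.1 r.2) _ (hmem q.1 q.2)
            rw [lie_hfld_hfld, map_zero, h0, zero_lie, zero_add, ← hE] at this
            exact this.symm
        | succ N ih =>
          rw [pow_succ', Module.End.mul_apply, LieAlgebra.ad_apply]
          refine ⟨lie_mem_evenW h2 (evenS_le_evenW (hmem q.1 q.2)) ih.1, fun j => ?_, fun r hr => ?_⟩
          · rw [leibniz_lie, ih.2.1 j, lie_zero, add_zero, lie_D_hfld]
            split_ifs
            · exact ih.2.1 _
            · exact zero_lie _
          · rw [leibniz_lie, ih.2.2 r hr, lie_zero, add_zero, lie_hfld_hfld,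
              zero_lie]
      have hpow : adE (hfld F q.1 q.2) ^ p = adE (hfld F q.1 q.2) := by
        have := ad_pow_char (F := F) (p := p) (hfld F q.1 q.2 : Module.End F (SuperAlg F m n)) 1
        rwa [pow_one, hfld_pow_char] at this
      have hE' : ⁅hfld F q.1 q.2, (adE (hfld F q.1 q.2) ^ (p - 2)) E⁆ = E := by
        rw [hE]
        exact hψ.lie_toral hp hm hn ht (hmem q.1 q.2) hpow
      refine ⟨w - (adE (hfld F q.1 q.2) ^ (p - 2)) E, sub_mem hw (hX _).1, fun j => ?_,
        fun r hr => ?_⟩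
      · rw [lie_sub, hwC, (hX _).2.1 j, sub_zero]
      · rw [sub_lie, ← lie_skew ((adE _ ^ _) E) (hfld F r.1 r.2), sub_neg_eq_add]
        rcases Finset.mem_insert.1 hr with rfl | hr
        · rw [hE', hE, LinearMap.sub_apply, LieAlgebra.ad_apply, add_sub_cancel]
        · rw [(hX _).2.2 r hr, add_zero, hws r hr]
  obtain ⟨w, hw, hC, h⟩ := key Finset.univ
  exact ⟨w, hw, hC, fun i k => h (i, k) (Finset.mem_univ _)⟩

end SuperAlg

/-! ### Derivations of the truncated divided power algebra -/

/-- The binomial coefficient at the leading `p`-adic digit is the digit itself, so it is not divisible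
by `p`. -/
theorem not_dvd_choose_pow_log {p : ℕ} [Fact p.Prime] {a : ℕ} (ha : a ≠ 0) :
    ¬ p ∣ a.choose (p ^ Nat.log p a) := by
  have hp := (Fact.out : p.Prime)
  induction a using Nat.strong_induction_on with
  | _ a ih =>
    by_cases h : a < p
    · rw [Nat.log_of_lt h, pow_zero, Nat.choose_one_right]
      exact fun hd => absurd (Nat.le_of_dvd (Nat.pos_of_ne_zero ha) hd) (by omega)
    · have hlog : Nat.log p a = Nat.log p (a / p) + 1 := Nat.log_of_one_lt_of_le hp.one_lt (by omega)
      have hdiv : a / p ≠ 0 := (Nat.div_pos (by omega) hp.pos).ne'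
      have key := Choose.choose_modEq_choose_mod_mul_choose_div_nat (n := a)
        (k := p ^ Nat.log p a) (p := p)
      have e1 : p ^ Nat.log p a % p = 0 := by rw [hlog, pow_succ]; exact Nat.mul_mod_left _ _
      have e2 : p ^ Nat.log p a / p = p ^ Nat.log p (a / p) := by
        rw [hlog, pow_succ]; exact Nat.mul_div_cancel _ hp.pos
      rw [e1, e2, Nat.choose_zero_right, one_mul] at key
      rw [key.dvd_iff (dvd_refl p)]
      exact ih _ (Nat.div_lt_self (by omega) hp.one_lt) hdiv

namespace DividedPower

variable {F : Type*} [Field F] {m : ℕ} {p : ℕ} {t : Fin m → ℕ}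

theorem mono_single_mul (i : Fin m) (a b : ℕ) :
    mono F (Pi.single i a) * mono F (Pi.single i b)
      = (((a + b).choose a : ℕ) : F) • mono F (Pi.single i (a + b)) := by
  rw [mono_mul_mono, Pi.single_add]
  congr 2
  rw [Finset.prod_eq_single i]
  · simp
  · intro j _ hj; simp [hj]
  · simp

theorem mono_eq_single_mul (α : Fin m → ℕ) (i : Fin m) :
    mono F α = mono F (Pi.single i (α i)) * mono F (Function.update α i 0) := by
  rw [mono_mul_mono_of_disjoint]
  · congr 1
    ext j
    by_cases h : j = i
    · subst h; simp
    · simp [h]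
  · intro j
    by_cases h : j = i
    · subst h; simp
    · simp [h]

theorem single_le {α : Fin m → ℕ} (hα : ∀ i, α i ≤ p ^ t i - 1) {i : Fin m} {a : ℕ}
    (ha : a ≤ α i) (j : Fin m) : (Pi.single i a : Fin m → ℕ) j ≤ p ^ t j - 1 := by
  by_cases h : j = i
  · subst h; simpa using ha.trans (hα j)
  · simp [h]

theorem update_le {α : Fin m → ℕ} (hα : ∀ i, α i ≤ p ^ t i - 1) (i : Fin m)
    (j : Fin m) : Function.update α i 0 j ≤ p ^ t j - 1 := by
  by_cases h : j = i
  · subst h; simp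
  · simpa [h] using hα j

theorem co_zero_mono {α : Fin m → ℕ} (h : α ≠ 0) : co 0 (mono F α) = 0 := by
  rw [co_mono, if_neg h]

theorem co_zero_mul_derivation {Φ : DividedPower F m →ₗ[F] DividedPower F m}
    (hmul : ∀ a ∈ tr p t, ∀ b ∈ tr p t, Φ (a * b) = Φ a * b + a * Φ b) {α β : Fin m → ℕ}
    (hα : ∀ i, α i ≤ p ^ t i - 1) (hβ : ∀ i, β i ≤ p ^ t i - 1) (hα0 : α ≠ 0) (hβ0 : β ≠ 0) :
    co 0 (Φ (mono F α * mono F β)) = 0 := by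
  rw [hmul _ (mono_mem_tr hα) _ (mono_mem_tr hβ), map_add, co_zero_mul, co_zero_mul,
    co_zero_mono hα0, co_zero_mono hβ0, mul_zero, zero_mul, add_zero]

/-- A derivation of `𝔄(m; t)` that commutes with all `∂_i` vanishes as soon as its values at the
algebra generators `x_i^(p^r)` have no constant term. -/
theorem derivation_eq_zero [Fact p.Prime] [CharP F p]
    {Φ : DividedPower F m →ₗ[F] DividedPower F m}
    (hmul : ∀ a ∈ tr p t, ∀ b ∈ tr p t, Φ (a * b) = Φ a * b + a * Φ b)
    (hpar : ∀ a ∈ tr p t, ∀ i, Φ (partialHom i a) = partialHom i (Φ a))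
    (hgen : ∀ i, ∀ r < t i, co 0 (Φ (mono F (Pi.single i (p ^ r)))) = 0)
    {a : DividedPower F m} (ha : a ∈ tr p t) : Φ a = 0 := by
  have hp := (Fact.out : p.Prime)
  have hmono : ∀ α : Fin m → ℕ, (∀ i, α i ≤ p ^ t i - 1) → co 0 (Φ (mono F α)) = 0 := by
    intro α hα
    by_cases h0 : α = 0
    · subst h0
      have h1 := hmul 1 (one_mem_tr p t) 1 (one_mem_tr p t)
      rw [mul_one, mul_one, one_mul, left_eq_add] at h1
      rw [mono_zero, h1, map_zero]
    obtain ⟨i, hi⟩ : ∃ i, α i ≠ 0 := by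
      by_contra! h'; exact h0 (funext h')
    have hsi : ∀ {a : ℕ}, a ≠ 0 → (Pi.single i a : Fin m → ℕ) ≠ 0 := by
      intro a ha h; simp at h; exact ha h
    by_cases hu : Function.update α i 0 = 0
    · have hα' : α = Pi.single i (α i) := by
        ext j
        by_cases hj : j = i
        · subst hj; simp
        · have := congrFun hu j; simpa [hj] using this
      have hle : p ^ Nat.log p (α i) ≤ α i := Nat.pow_log_le_self p hi
      by_cases he : p ^ Nat.log p (α i) = α i
      · rw [hα', ← he]
        refine hgen i _ ?_
        have h1 := hα i
        have : 0 < p ^ t i := pow_pos hp.pos _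
        exact (Nat.pow_lt_pow_iff_right hp.one_lt).1 (by omega)
      · have hk : p ^ Nat.log p (α i) ≠ 0 := (pow_pos hp.pos _).ne'
        have key := co_zero_mul_derivation hmul (single_le hα hle)
          (single_le hα (Nat.sub_le (α i) (p ^ Nat.log p (α i)))) (hsi hk) (hsi (by omega))
        rw [mono_single_mul, Nat.add_sub_cancel' hle, map_smul, map_smul, smul_eq_mul,
          mul_eq_zero, CharP.cast_eq_zero_iff F p] at key
        rw [hα']
        exact key.resolve_left (not_dvd_choose_pow_log hi)
    · rw [mono_eq_single_mul α i]
      exact co_zero_mul_derivation hmul (single_le hα le_rfl) (update_le hα i) (hsi hi) hu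
  have hall : ∀ a ∈ tr p t, co 0 (Φ a) = 0 := fun a ha =>
    tr_induction (LinearMap.ker (co 0 ∘ₗ Φ)) hmono ha
  refine ext_co fun β => ?_
  rw [map_zero]
  obtain ⟨N, hN⟩ : ∃ N, ∑ i, β i = N := ⟨_, rfl⟩
  induction N generalizing β a with
  | zero =>
    have : β = 0 := funext fun i => by
      have := (Finset.sum_eq_zero_iff.1 hN) i (Finset.mem_univ i)
      simpa using this
    rw [this, hall a ha]
  | succ N ih =>
    obtain ⟨i, -, hi⟩ : ∃ i ∈ Finset.univ, β i ≠ 0 :=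
      Finset.exists_ne_zero_of_sum_ne_zero (by omega)
    rw [← sub_single_add hi, ← co_partial, ← hpar a ha]
    refine ih (partial_mem_tr ha i) _ ?_
    have h := congrArg (fun β : Fin m → ℕ => ∑ j, β j) (sub_single_add hi)
    simp only [Pi.add_apply, Finset.sum_add_distrib, Finset.sum_pi_single', Finset.mem_univ,
      if_true] at h
    simp only [Pi.sub_apply] at h ⊢
    have h' : ∑ x, (Pi.single i 1 : Fin m → ℕ) x = 1 := by simp
    omega

theorem co_partial_pow (i : Fin m) (N : ℕ) (α : Fin m → ℕ) (a : DividedPower F m) :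
    co α ((partialHom i ^ N : Module.End F (DividedPower F m)) a)
      = co (α + Pi.single i N) a := by
  induction N generalizing α with
  | zero => simp
  | succ N ih =>
    rw [pow_succ', Module.End.mul_apply, co_partial, ih, add_assoc, ← Pi.single_add, add_comm 1]

variable (p t) in
/-- The operator `∑ c_ir ∂_i^(p^r)`, where `1 ≤ r < t_i`. -/
def powP (c : Fin m → ℕ → F) : Module.End F (DividedPower F m) :=
  ∑ i, ∑ r ∈ Finset.Ico 1 (t i), c i r • (partialHom i : Module.End F (DividedPower F m)) ^ p ^ r

theorem co_zero_powP [Fact p.Prime] (c : Fin m → ℕ → F) (i : Fin m) {s : ℕ} (hs : 1 ≤ s)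
    (hst : s < t i) : co 0 (powP p t c (mono F (Pi.single i (p ^ s)))) = c i s := by
  have hp := (Fact.out : p.Prime)
  rw [powP, LinearMap.sum_apply, map_sum, Finset.sum_eq_single i]
  · rw [LinearMap.sum_apply, map_sum, Finset.sum_eq_single s]
    · rw [LinearMap.smul_apply, map_smul, co_partial_pow, zero_add, co_mono, if_pos rfl,
        smul_eq_mul, mul_one]
    · intro r _ hr
      rw [LinearMap.smul_apply, map_smul, co_partial_pow, zero_add, co_mono, if_neg, smul_zero]
      intro h
      exact hr ((Nat.pow_right_injective hp.two_le (Pi.single_injective i h)).symm)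
    · intro h; exact absurd (Finset.mem_Ico.2 ⟨hs, hst⟩) h
  · intro j _ hj
    rw [LinearMap.sum_apply, map_sum]
    refine Finset.sum_eq_zero fun r _ => ?_
    rw [LinearMap.smul_apply, map_smul, co_partial_pow, zero_add, co_mono, if_neg, smul_zero]
    intro h
    have := congrFun h j
    have hpos : 0 < p ^ r := pow_pos hp.pos r
    simp [hj] at this
    omega
  · simp

end DividedPower

namespace SuperAlg

open DividedPower

variable {F : Type*} [Field F] {m n p : ℕ} {t : Fin m → ℕ}

variable (n p t) in
/-- The operator `∑ c_ir D_i^(p^r)`, where `1 ≤ r < t_i`. -/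
def powD (c : Fin m → ℕ → F) : Module.End F (SuperAlg F m n) :=
  ∑ i, ∑ r ∈ Finset.Ico 1 (t i), c i r • (D F (.inl i) : Module.End F (SuperAlg F m n)) ^ p ^ r

theorem D_pow_tmul (i : Fin m) (N : ℕ) (a : DividedPower F m) (u : ExteriorAlgebra F (Fin n → F)) :
    (D F (.inl i) ^ N) (a ⊗ₜ u)
      = ((partialHom i ^ N : Module.End F (DividedPower F m)) a) ⊗ₜ[F] u := by
  induction N generalizing a with
  | zero => rfl
  | succ N ih => rw [pow_succ, Module.End.mul_apply, D_inl, ih, pow_succ, Module.End.mul_apply]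

theorem powD_tmul (c : Fin m → ℕ → F) (a : DividedPower F m) (u : ExteriorAlgebra F (Fin n → F)) :
    powD n p t c (a ⊗ₜ u) = powP p t c a ⊗ₜ u := by
  simp only [powD, powP, LinearMap.sum_apply, LinearMap.smul_apply, TensorProduct.sum_tmul,
    D_pow_tmul, TensorProduct.smul_tmul']

theorem ad_D_pow_fld (i : Fin m) (N : ℕ) (f : SuperAlg F m n) (r : Fin m ⊕ Fin n) :
    (adE (D F (.inl i)) ^ N) (fld f r) = fld ((D F (.inl i) ^ N) f) r := by
  induction N generalizing f with
  | zero => rfl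
  | succ N ih =>
    rw [pow_succ, Module.End.mul_apply, LieAlgebra.ad_apply, lie_D_fld, ih, pow_succ,
      Module.End.mul_apply]

theorem ad_powD [Fact p.Prime] [CharP F p] (c : Fin m → ℕ → F)
    (y : Module.End F (SuperAlg F m n)) : ⁅powD n p t c, y⁆
      = ∑ i, ∑ r ∈ Finset.Ico 1 (t i), c i r • (adE (D F (.inl i)) ^ p ^ r) y := by
  rw [powD, sum_lie]
  refine Finset.sum_congr rfl fun i _ => ?_
  rw [sum_lie]
  refine Finset.sum_congr rfl fun r _ => ?_
  rw [ad_pow_char, LieAlgebra.ad_apply]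
  exact smul_lie (L := Module.End F (SuperAlg F m n)) (c i r) (D F (.inl i) ^ p ^ r) y

theorem lie_powD_fld [Fact p.Prime] [CharP F p] (c : Fin m → ℕ → F) (f : SuperAlg F m n)
    (r : Fin m ⊕ Fin n) : ⁅powD n p t c, fld f r⁆ = fld (powD n p t c f) r := by
  have hsum : ∀ {ι : Type} (s : Finset ι) (g : ι → SuperAlg F m n),
      fld (∑ i ∈ s, g i) r = ∑ i ∈ s, fld (g i) r := by
    intro ι s g
    classical
    induction s using Finset.induction_on with
    | empty => simp
    | insert a s ha ih => rw [Finset.sum_insert ha, Finset.sum_insert ha, fld_add, ih]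
  rw [ad_powD, powD, LinearMap.sum_apply, hsum]
  refine Finset.sum_congr rfl fun i _ => ?_
  rw [LinearMap.sum_apply, hsum]
  refine Finset.sum_congr rfl fun s _ => ?_
  rw [ad_D_pow_fld, LinearMap.smul_apply, fld_smul]

theorem ad_D_pow_mem [Fact p.Prime] [CharP F p] (h2 : (2 : F) ≠ 0) (k : Fin n) (i : Fin m) (N : ℕ)
    {y : Module.End F (SuperAlg F m n)} (hy : y ∈ evenS F n p t) :
    (adE (D F (.inl i)) ^ N) y ∈ evenS F n p t := by
  induction N with
  | zero => exact hy
  | succ N ih =>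
    rw [pow_succ', Module.End.mul_apply, LieAlgebra.ad_apply]
    exact (evenS F n p t).lie_mem (D_mem h2 i k) ih

theorem lie_powD_mem [Fact p.Prime] [CharP F p] (h2 : (2 : F) ≠ 0) (k : Fin n)
    (c : Fin m → ℕ → F) {y : Module.End F (SuperAlg F m n)} (hy : y ∈ evenS F n p t) :
    ⁅powD n p t c, y⁆ ∈ evenS F n p t := by
  rw [ad_powD]
  exact sum_mem fun i _ => sum_mem fun r _ =>
    Submodule.smul_mem (evenS F n p t).toSubmodule _ (ad_D_pow_mem h2 k i _ hy)

theorem isDer_powD [Fact p.Prime] [CharP F p] (h2 : (2 : F) ≠ 0) (k : Fin n)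
    (c : Fin m → ℕ → F) : IsDer n p t (adE (powD n p t c)) where
  mem y hy := evenS_le_evenW (lie_powD_mem h2 k c hy)
  leib y _ z _ := by rw [LieAlgebra.ad_apply, LieAlgebra.ad_apply, LieAlgebra.ad_apply, leibniz_lie]

theorem lie_powD_of_lie_D [Fact p.Prime] [CharP F p] (c : Fin m → ℕ → F)
    {y : Module.End F (SuperAlg F m n)} (hy : ∀ i : Fin m,
      ⁅(D F (.inl i) : Module.End F (SuperAlg F m n)),
        ⁅(D F (.inl i) : Module.End F (SuperAlg F m n)), y⁆⁆ = 0) :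
    ⁅powD n p t c, y⁆ = 0 := by
  rw [ad_powD]
  refine Finset.sum_eq_zero fun i _ => Finset.sum_eq_zero fun r hr => ?_
  have : 2 ≤ p ^ r := (Fact.out : p.Prime).two_le.trans
    (Nat.le_self_pow (by have := (Finset.mem_Ico.1 hr).1; omega) p)
  obtain ⟨N, hN⟩ := Nat.exists_eq_add_of_le' this
  rw [hN, pow_add, Module.End.mul_apply, pow_two, Module.End.mul_apply, LieAlgebra.ad_apply,
    LieAlgebra.ad_apply, hy, map_zero, smul_zero]

end SuperAlg

/-! ### Derivations on `𝔄(m; t) ⊗ sl(n)` -/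

namespace SuperAlg

open DividedPower

variable {F : Type*} [Field F] {m n p : ℕ} {t : Fin m → ℕ}
  {E : Module.End F (SuperAlg F m n)}

variable (F m) in
/-- The element `x_k D_k` of the canonical torus, for `k ∈ Y₁`. -/
def gfld (k : Fin n) : Module.End F (SuperAlg F m n) := fld (1 ⊗ₜ gen F k) (.inr k)

theorem gfld_mem_evenW (h2 : (2 : F) ≠ 0) (k : Fin n) : gfld F m k ∈ evenW F n p t :=
  fld_mem_evenW (tmul_mem_trunc (one_mem_tr p t) _) (tmul_mem_inr h2 k 1 (inv_gen k))

theorem lie_gfld_apply (q : Fin n) (E : Module.End F (SuperAlg F m n)) (r : Fin m ⊕ Fin n) :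
    ⁅gfld F m q, E⁆ (x F r) = x F (.inr q) * D F (.inr q) (E (x F r))
      - (if r = .inr q then 1 else 0 : F) • E (x F r) := by
  rw [lie_apply, gfld, fld_x, fld_apply, x_inr]
  congr 1
  by_cases h : r = .inr q
  · subst h; simp [x_inr]
  · simp [h, Ne.symm h]

theorem hfld_sub_hfld (i : Fin m) (q r : Fin n) :
    hfld F i q - hfld F i r = gfld F m q - gfld F m r := by
  rw [hfld, hfld, gfld, gfld, x_inr, x_inr]
  abel

theorem lie_gfld_gen_fld (h2 : (2 : F) ≠ 0) (q k l : Fin n) (a : DividedPower F m) :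
    ⁅gfld F m q, fld (a ⊗ₜ gen F k) (.inr l)⁆
      = ((if q = k then 1 else 0) - (if q = l then 1 else 0) : F) •
        fld (a ⊗ₜ gen F k) (.inr l) := by
  rw [gfld, lie_inr_inr h2 q l (inv_gen q) (inv_gen k), dgen_gen, dgen_gen, one_mul, mul_one]
  by_cases h : q = k <;> by_cases h' : q = l
  · simp [← h, ← h']
  · subst h; simp [h', Ne.symm h']
  · subst h'
    simp only [h, if_false, if_true, zero_sub, mul_one, mul_zero,
      TensorProduct.tmul_zero, fld_zero]
    exact (neg_one_smul F _).symm
  · simp [h, h', Ne.symm h']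

theorem lie_gfld_D (q : Fin n) (j : Fin m) :
    ⁅(D F (.inl j) : Module.End F (SuperAlg F m n)), gfld F m q⁆ = 0 := by
  rw [gfld, lie_D_fld, D_inl, partial_one, TensorProduct.zero_tmul, fld_zero]

/-- The eigenvalue equation for the difference of two commuting idempotents. -/
theorem gen_dgen_sub {k l : Fin n} (hkl : k ≠ l) {c : F} (hc : c ≠ 0)
    {u : ExteriorAlgebra F (Fin n → F)}
    (h : gen F k * dgen F k u - gen F l * dgen F l u = c • u) :
    (1 - c) • (gen F k * dgen F k u) = 0 ∧ (1 + c) • (gen F l * dgen F l u) = 0 := by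
  obtain ⟨P, hP⟩ : ∃ P, P = gen F k * dgen F k (gen F l * dgen F l u) := ⟨_, rfl⟩
  have h1 := congrArg (fun u => gen F k * dgen F k u) h
  have h2 := congrArg (fun u => gen F l * dgen F l u) h
  simp only [map_sub, mul_sub, gen_dgen_gen_dgen, map_smul, mul_smul_comm] at h1 h2
  rw [← hP] at h1
  rw [← gen_dgen_comm hkl, ← hP] at h2
  have hPk : gen F k * dgen F k P = P := by rw [hP, gen_dgen_gen_dgen]
  have h3 := congrArg (fun u => gen F k * dgen F k u) h2
  simp only [map_sub, mul_sub, map_smul, mul_smul_comm, hPk, ← hP, sub_self] at h3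
  have hP0 : P = 0 := (smul_eq_zero.1 h3.symm).resolve_left hc
  rw [hP0] at h1 h2
  constructor
  · rw [sub_smul, one_smul, ← h1, sub_zero, sub_self]
  · rw [add_smul, one_smul, ← h2, zero_sub, add_neg_cancel]

theorem cf_gen_mul (k : Fin n) (α : Fin m → ℕ) (f : SuperAlg F m n) :
    cf α (x F (.inr k) * f) = gen F k * cf α f := by
  rw [x_inr]
  induction f using TensorProduct.induction_on with
  | zero => simp
  | add f g hf hg => rw [mul_add, map_add, hf, hg, map_add, mul_add]
  | tmul a u =>
    rw [Algebra.TensorProduct.tmul_mul_tmul, cf_tmul, cf_tmul, one_mul, mul_smul_comm]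

/-- The coefficient `a` of the field `(a x_k) D_l`. -/
def rootCoef (k l : Fin n) : Module.End F (SuperAlg F m n) →ₗ[F] DividedPower F m :=
  body F m n ∘ₗ D F (.inr k) ∘ₗ LinearMap.applyₗ (x F (.inr l))

theorem rootCoef_fld (k l : Fin n) (a : DividedPower F m) :
    rootCoef k l (fld (a ⊗ₜ gen F k) (.inr l)) = a := by
  change body F m n (D F (.inr k) (fld (a ⊗ₜ gen F k) (.inr l) (x F (.inr l)))) = a
  rw [fld_x, if_pos rfl, D_inr_tmul, body_tmul]
  simp

/-- A field of weight `ε_k - ε_l` for the torus of `sl(n)` is of the form `(a x_k) D_l`. -/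
theorem eq_fld_of_weight (h2 : (2 : F) ≠ 0) (h3 : (3 : F) ≠ 0) (hE : E ∈ evenW F n p t)
    {k l : Fin n} (hkl : k ≠ l)
    (hw : ∀ q r : Fin n, ⁅gfld F m q - gfld F m r, E⁆
      = (((if q = k then 1 else 0) - (if q = l then 1 else 0))
        - ((if r = k then 1 else 0) - (if r = l then 1 else 0)) : F) • E) :
    E = fld (rootCoef k l E ⊗ₜ gen F k) (.inr l) := by
  have key : ∀ (q r : Fin n) (s : Fin m ⊕ Fin n) (α : Fin m → ℕ),
      gen F q * dgen F q (cf α (E (x F s))) - gen F r * dgen F r (cf α (E (x F s)))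
        = ((((if q = k then 1 else 0) - (if q = l then 1 else 0))
        - ((if r = k then 1 else 0) - (if r = l then 1 else 0)))
        + ((if s = .inr q then 1 else 0) - (if s = .inr r then 1 else 0)) : F)
          • cf α (E (x F s)) := by
    intro q r s α
    have := congrArg (cf α) (LinearMap.congr_fun (hw q r) (x F s))
    rw [sub_lie, LinearMap.sub_apply, lie_gfld_apply, lie_gfld_apply, LinearMap.smul_apply,
      map_sub, map_sub, map_sub, cf_gen_mul, cf_gen_mul, cf_D_inr, cf_D_inr, map_smul, map_smul,
      map_smul] at this
    rw [add_smul, ← this, sub_smul (if s = .inr q then (1 : F) else 0)]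
    abel
  have h6 : (2 : F) * 2 ≠ 0 := mul_ne_zero h2 h2
  have hne : ∀ s, s ≠ .inr l → E (x F s) = 0 := by
    intro s hs
    refine ext_cf fun α => ?_
    have h := key k l s α
    simp only [if_true, hkl, hkl.symm, if_false, hs, sub_zero, zero_sub, sub_neg_eq_add] at h
    rw [map_zero]
    by_cases hsk : s = .inr k
    · rw [if_pos hsk] at h
      have e : (1 + 1 + 1 : F) = 3 := by norm_num
      rw [e] at h
      obtain ⟨h4, h5⟩ := gen_dgen_sub hkl h3 h
      have e1 : (1 - 3 : F) ≠ 0 := by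
        intro h; apply h2; linear_combination -h
      have e2 : (1 + 3 : F) ≠ 0 := by
        intro h; apply h6; linear_combination h
      rw [(smul_eq_zero.1 h4).resolve_left e1, (smul_eq_zero.1 h5).resolve_left e2, sub_zero] at h
      exact (smul_eq_zero.1 h.symm).resolve_left h3
    · rw [if_neg hsk] at h
      have e : (1 + 1 + 0 : F) = 2 := by norm_num
      rw [e] at h
      obtain ⟨h4, h5⟩ := gen_dgen_sub hkl h2 h
      have e1 : (1 - 2 : F) ≠ 0 := by
        intro h; apply one_ne_zero (α := F); linear_combination -h
      have e2 : (1 + 2 : F) ≠ 0 := by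
        intro h; apply h3; linear_combination h
      rw [(smul_eq_zero.1 h4).resolve_left e1, (smul_eq_zero.1 h5).resolve_left e2, sub_zero] at h
      exact (smul_eq_zero.1 h.symm).resolve_left h2
  have hcf : ∀ α, gen F k * dgen F k (cf α (E (x F (.inr l)))) = cf α (E (x F (.inr l))) ∧
      ∀ q, q ≠ k → dgen F q (cf α (E (x F (.inr l)))) = 0 := by
    intro α
    have h := key k l (.inr l) α
    have hlk : (Sum.inr l : Fin m ⊕ Fin n) ≠ .inr k := by simpa using hkl.symm
    simp only [if_true, hkl, hkl.symm, if_false, hlk, sub_zero, zero_sub, sub_neg_eq_add] at h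
    have e : (1 + 1 + -1 : F) = 1 := by norm_num
    rw [e] at h
    have h5 := (gen_dgen_sub hkl one_ne_zero h).2
    have e2 : (1 + 1 : F) ≠ 0 := by rwa [one_add_one_eq_two]
    have h5 := (smul_eq_zero.1 h5).resolve_left e2
    rw [h5, sub_zero, one_smul] at h
    refine ⟨h, fun q hq => ?_⟩
    by_cases hql : q = l
    · rw [hql]; exact dgen_eq_zero_of_gen_dgen h5
    · have h' := key q l (.inr l) α
      have hlq : (Sum.inr l : Fin m ⊕ Fin n) ≠ .inr q := by simpa using Ne.symm hql
      simp only [if_true, hkl.symm, if_false, hlq, hq, hql, sub_zero, zero_sub, sub_neg_eq_add,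
        h5, zero_add, add_neg_cancel, zero_smul] at h'
      exact dgen_eq_zero_of_gen_dgen h'
  have hbody : D F (.inr k) (E (x F (.inr l))) = rootCoef k l E ⊗ₜ 1 := by
    refine eq_body_tmul_of_D fun q => ext_cf fun α => ?_
    rw [cf_D_inr, cf_D_inr, map_zero]
    by_cases hq : q = k
    · rw [hq, dgen_dgen]
    · rw [dgen_comm, (hcf α).2 q hq, map_zero, neg_zero]
  have hl : E (x F (.inr l)) = rootCoef k l E ⊗ₜ gen F k := by
    have e : E (x F (.inr l)) = x F (.inr k) * D F (.inr k) (E (x F (.inr l))) :=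
      ext_cf fun α => by rw [cf_gen_mul, cf_D_inr, (hcf α).1]
    rw [e, hbody, x_inr, Algebra.TensorProduct.tmul_mul_tmul, one_mul, mul_one]
  have hfE : fld (rootCoef k l E ⊗ₜ gen F k) (.inr l) ∈ evenW F n p t := by
    rw [← hl]
    exact fld_mem_evenW (hE.2 _).1 (hE.2 _).2
  refine evenW_ext hE hfE fun s => ?_
  rw [fld_x]
  by_cases hs : s = .inr l
  · rw [if_pos hs.symm, hs, hl]
  · rw [if_neg (Ne.symm hs), hne s hs]

end SuperAlg

namespace DividedPower

variable {F : Type*} [Field F] {m : ℕ} {p : ℕ} {t : Fin m → ℕ}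

/-- The `p^r`-th power of a derivation is a derivation. -/
theorem partial_pow_char_mul [Fact p.Prime] [CharP F p] (i : Fin m) (r : ℕ) (a b : DividedPower F m) :
    (partialHom i ^ p ^ r : Module.End F (DividedPower F m)) (a * b)
      = (partialHom i ^ p ^ r : Module.End F (DividedPower F m)) a * b
        + a * (partialHom i ^ p ^ r : Module.End F (DividedPower F m)) b := by
  have key : ∀ N, ∀ a : DividedPower F m,
      (LieAlgebra.ad F (Module.End F (DividedPower F m)) (partialHom i) ^ N) (LinearMap.mulLeft F a)
        = LinearMap.mulLeft F ((partialHom i ^ N : Module.End F (DividedPower F m)) a) := by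
    intro N
    induction N with
    | zero => intro a; rfl
    | succ N ih =>
      intro a
      have : ⁅(partialHom i : Module.End F (DividedPower F m)), LinearMap.mulLeft F a⁆
          = LinearMap.mulLeft F (partialHom i a) := by
        refine LinearMap.ext fun b => ?_
        rw [LieRing.of_associative_ring_bracket, LinearMap.sub_apply, Module.End.mul_apply,
          Module.End.mul_apply, LinearMap.mulLeft_apply, LinearMap.mulLeft_apply,
          LinearMap.mulLeft_apply, partialHom_mul, add_sub_cancel_right]
      rw [pow_succ, Module.End.mul_apply, LieAlgebra.ad_apply, this, ih, pow_succ,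
        Module.End.mul_apply]
  have h := LinearMap.congr_fun (key (p ^ r) a) b
  rw [ad_pow_char, LieAlgebra.ad_apply, LieRing.of_associative_ring_bracket, LinearMap.sub_apply,
    Module.End.mul_apply, Module.End.mul_apply, LinearMap.mulLeft_apply, LinearMap.mulLeft_apply,
    LinearMap.mulLeft_apply, sub_eq_iff_eq_add] at h
  exact h

theorem powP_mul [Fact p.Prime] [CharP F p] (c : Fin m → ℕ → F) (a b : DividedPower F m) :
    powP p t c (a * b) = powP p t c a * b + a * powP p t c b := by
  simp only [powP, LinearMap.sum_apply, LinearMap.smul_apply, partial_pow_char_mul, smul_add,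
    Finset.sum_add_distrib, Finset.sum_mul, Finset.mul_sum, smul_mul_assoc, mul_smul_comm]

theorem powP_partial (c : Fin m → ℕ → F) (i : Fin m) (a : DividedPower F m) :
    powP p t c (partialHom i a) = partialHom i (powP p t c a) := by
  have key : ∀ (j : Fin m) (N : ℕ), (partialHom j ^ N : Module.End F (DividedPower F m))
      (partialHom i a) = partialHom i ((partialHom j ^ N : Module.End F (DividedPower F m)) a) := by
    intro j N
    have hc : Commute (partialHom j : Module.End F (DividedPower F m)) (partialHom i) :=
      LinearMap.ext fun b => partialHom_comm j i b
    exact LinearMap.congr_fun (hc.pow_left N) a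
  simp only [powP, LinearMap.sum_apply, LinearMap.smul_apply, map_sum, map_smul, key]

theorem co_zero_powP_var [Fact p.Prime] (c : Fin m → ℕ → F) (i : Fin m) :
    co 0 (powP p t c (mono F (Pi.single i 1))) = 0 := by
  simp only [powP, LinearMap.sum_apply, LinearMap.smul_apply, map_sum, map_smul, co_partial_pow]
  refine Finset.sum_eq_zero fun j _ => Finset.sum_eq_zero fun r hr => ?_
  rw [zero_add, co_mono, if_neg, smul_zero]
  intro h
  have hlt : 1 < p ^ r := Nat.one_lt_pow (by have := (Finset.mem_Ico.1 hr).1; omega)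
    (Fact.out : p.Prime).one_lt
  have h := congrFun h j
  by_cases hij : j = i
  · subst hij; simp at h; omega
  · simp [hij] at h; omega

end DividedPower

namespace SuperAlg

open DividedPower

variable {F : Type*} [Field F] {m n p : ℕ} [Fact p.Prime] [CharP F p] {t : Fin m → ℕ}
  {φ : Module.End F (Module.End F (SuperAlg F m n))}

theorem smul_lie_end (c : F) (E G : Module.End F (SuperAlg F m n)) : ⁅c • E, G⁆ = c • ⁅E, G⁆ :=
  smul_lie (L := Module.End F (SuperAlg F m n)) c E G

theorem lie_smul_end (c : F) (E G : Module.End F (SuperAlg F m n)) : ⁅E, c • G⁆ = c • ⁅E, G⁆ :=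
  lie_smul (L := Module.End F (SuperAlg F m n)) c E G

theorem add_smul_end (c d : F) (E : Module.End F (SuperAlg F m n)) :
    (c + d) • E = c • E + d • E := add_smul c d E

theorem sub_smul_end (c d : F) (E : Module.End F (SuperAlg F m n)) :
    (c - d) • E = c • E - d • E := sub_smul c d E

/-- The map `a ↦ (a ⊗ u) D_r`. -/
def fldMap (u : ExteriorAlgebra F (Fin n → F)) (r : Fin m ⊕ Fin n) :
    DividedPower F m →ₗ[F] Module.End F (SuperAlg F m n) where
  toFun a := fld (a ⊗ₜ u) r
  map_add' a b := by rw [TensorProduct.add_tmul, fld_add]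
  map_smul' c a := by rw [← TensorProduct.smul_tmul', fld_smul]; rfl

/-- The action on coefficients of a derivation that preserves the root space of `(a x_k) D_l`. -/
def rootEnd (φ : Module.End F (Module.End F (SuperAlg F m n))) (k l : Fin n) :
    DividedPower F m →ₗ[F] DividedPower F m :=
  rootCoef k l ∘ₗ φ ∘ₗ fldMap (gen F k) (.inr l)

theorem fld_gen_injective {k l : Fin n} {a b : DividedPower F m}
    (h : (fld (a ⊗ₜ gen F k) (.inr l) : Module.End F (SuperAlg F m n))
      = fld (b ⊗ₜ gen F k) (.inr l)) : a = b := by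
  rw [← rootCoef_fld k l a, h, rootCoef_fld]

theorem lie_hfld_gen_fld (h2 : (2 : F) ≠ 0) (i : Fin m) {q k l : Fin n} (hkl : k ≠ l)
    (hqk : q ≠ k) (hql : q ≠ l) (a : DividedPower F m) :
    ⁅(hfld F i q : Module.End F (SuperAlg F m n)), fld (a ⊗ₜ gen F k) (.inr l)⁆
      = fld ((mono F (Pi.single i 1) * partialHom i a) ⊗ₜ gen F k) (.inr l) := by
  rw [hfld_eq, lie_zfld_gen_fld h2 i q hkl, if_neg hqk, if_neg hql, add_zero, sub_zero]

theorem lie_gfld_gfld (h2 : (2 : F) ≠ 0) (k l : Fin n) : ⁅gfld F m k, gfld F m l⁆ = 0 := by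
  rw [gfld, gfld, lie_inr_inr h2 k l (inv_gen k) (inv_gen l), dgen_gen, dgen_gen]
  by_cases h : k = l
  · subst h; simp
  · simp [h, Ne.symm h]

theorem lie_gfld_hfld (h2 : (2 : F) ≠ 0) (k : Fin n) (i : Fin m) (l : Fin n) :
    ⁅gfld F m k, hfld F i l⁆ = 0 := by
  have : hfld F i l = fld (mono F (Pi.single i 1) ⊗ₜ 1) (.inl i) + gfld F m l := rfl
  rw [this, lie_add, lie_gfld_gfld h2, add_zero, gfld, lie_inr_inl h2 k i (inv_gen k) (map_one _),
    dgen_one, partial_one]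
  simp

theorem smul_gfld_sub_eq_zero {k l : Fin n} (hkl : k ≠ l) {c : F}
    (h : c • (gfld F m k - gfld F m l) = 0) : c = 0 := by
  have := LinearMap.congr_fun h (x F (.inr k))
  rw [LinearMap.smul_apply, LinearMap.sub_apply, gfld, gfld, fld_x, if_pos rfl, fld_x,
    if_neg (by simpa using hkl.symm), sub_zero, LinearMap.zero_apply, TensorProduct.smul_tmul'] at this
  have := congrArg (cf 0) this
  rw [cf_tmul, map_zero, map_smul, ← mono_zero, co_mono, if_pos rfl, smul_eq_mul, mul_one] at this
  exact (smul_eq_zero.1 this).resolve_right (gen_ne_zero k)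

namespace IsDer

theorem lie_D (h2 : (2 : F) ≠ 0) (hφ : IsDer n p t φ) (hD : ∀ i : Fin m, φ (D F (.inl i)) = 0)
    (k : Fin n) (i : Fin m) {y : Module.End F (SuperAlg F m n)} (hy : y ∈ evenS F n p t) :
    φ ⁅(D F (.inl i) : Module.End F (SuperAlg F m n)), y⁆ = ⁅(D F (.inl i) : Module.End F (SuperAlg F m n)), φ y⁆ := by
  rw [hφ.leib _ (D_mem h2 i k) _ hy, hD, zero_lie, zero_add]

theorem lie_hfld (h2 : (2 : F) ≠ 0) (hφ : IsDer n p t φ) (ht : ∀ i, 1 ≤ t i)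
    (hh : ∀ (i : Fin m) (k : Fin n), φ (hfld F i k) = 0)
    (i : Fin m) (k : Fin n) {y : Module.End F (SuperAlg F m n)} (hy : y ∈ evenS F n p t) :
    φ ⁅hfld F i k, y⁆ = ⁅hfld F i k, φ y⁆ := by
  rw [hφ.leib _ (hfld_mem h2 ht i k) _ hy, hh, zero_lie, zero_add]

theorem apply_gen_fld (hφ : IsDer n p t φ) (hp : 3 < p) (hm : 3 ≤ m) (ht : ∀ i, 1 ≤ t i)
    (hh : ∀ (i : Fin m) (k : Fin n), φ (hfld F i k) = 0) {k l : Fin n} (hkl : k ≠ l)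
    {a : DividedPower F m} (ha : a ∈ tr p t) :
    φ (fld (a ⊗ₜ gen F k) (.inr l)) = fld (rootEnd φ k l a ⊗ₜ gen F k) (.inr l) := by
  have h2 : (2 : F) ≠ 0 := two_ne_zero_of_char p hp
  let i0 : Fin m := ⟨0, by omega⟩
  have hy := gen_fld_mem h2 i0 ha hkl
  refine eq_fld_of_weight h2 (three_ne_zero_of_char p hp) (hφ.mem _ hy) hkl fun q r => ?_
  rw [← hfld_sub_hfld i0, sub_lie, ← hφ.lie_hfld h2 ht hh i0 q hy, ← hφ.lie_hfld h2 ht hh i0 r hy,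
    ← map_sub, ← sub_lie, hfld_sub_hfld, sub_lie, lie_gfld_gen_fld h2, lie_gfld_gen_fld h2,
    ← map_smul]
  congr 1
  exact (sub_smul (R := F) (M := Module.End F (SuperAlg F m n)) _ _ _).symm

theorem rootEnd_partial (hφ : IsDer n p t φ) (hp : 3 < p) (hm : 3 ≤ m) (ht : ∀ i, 1 ≤ t i)
    (hD : ∀ i : Fin m, φ (D F (.inl i)) = 0)
    (hh : ∀ (i : Fin m) (k : Fin n), φ (hfld F i k) = 0) {k l : Fin n} (hkl : k ≠ l)
    {a : DividedPower F m} (ha : a ∈ tr p t) (i : Fin m) :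
    rootEnd φ k l (partialHom i a) = partialHom i (rootEnd φ k l a) := by
  have h2 : (2 : F) ≠ 0 := two_ne_zero_of_char p hp
  have h := hφ.lie_D h2 hD k i (gen_fld_mem h2 i ha hkl)
  rw [hφ.apply_gen_fld hp hm ht hh hkl ha, lie_D_fld, lie_D_fld, D_inl, D_inl,
    hφ.apply_gen_fld hp hm ht hh hkl (partial_mem_tr ha i)] at h
  exact fld_gen_injective h

theorem rootEnd_mul (hφ : IsDer n p t φ) (hp : 3 < p) (hm : 3 ≤ m) (ht : ∀ i, 1 ≤ t i)
    (hh : ∀ (i : Fin m) (k : Fin n), φ (hfld F i k) = 0) {k l j : Fin n} (hkl : k ≠ l)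
    (hlj : l ≠ j) (hkj : k ≠ j) {a b : DividedPower F m} (ha : a ∈ tr p t) (hb : b ∈ tr p t) :
    φ (fld ((a * b) ⊗ₜ gen F k) (.inr j))
      = fld ((rootEnd φ k l a * b + a * rootEnd φ l j b) ⊗ₜ gen F k) (.inr j) := by
  have h2 : (2 : F) ≠ 0 := two_ne_zero_of_char p hp
  let i0 : Fin m := ⟨0, by omega⟩
  rw [← lie_gen_fld h2 hkj, hφ.leib _ (gen_fld_mem h2 i0 ha hkl) _ (gen_fld_mem h2 i0 hb hlj),
    hφ.apply_gen_fld hp hm ht hh hkl ha, hφ.apply_gen_fld hp hm ht hh hlj hb,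
    lie_gen_fld h2 hkj, lie_gen_fld h2 hkj, TensorProduct.add_tmul, fld_add]

/-- The values at `x_k D_l` are multiples `s_kl x_k D_l`, where `s_kl` is additive in the roots, so
they agree with those of an element of the torus. -/
theorem exists_ad_gfld (hφ : IsDer n p t φ) (hp : 3 < p) (hm : 3 ≤ m) (hn : 3 ≤ n)
    (ht : ∀ i, 1 ≤ t i) (hD : ∀ i : Fin m, φ (D F (.inl i)) = 0)
    (hh : ∀ (i : Fin m) (k : Fin n), φ (hfld F i k) = 0) :
    ∃ w ∈ evenW F n p t, ConstCoef w ∧ (∀ (i : Fin m) (k : Fin n), ⁅w, hfld F i k⁆ = 0) ∧ ∀ k l : Fin n, k ≠ l →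
      φ (fld (1 ⊗ₜ gen F k) (.inr l)) = ⁅w, fld (1 ⊗ₜ gen F k) (.inr l)⁆ := by
  have h2 : (2 : F) ≠ 0 := two_ne_zero_of_char p hp
  have h1 := one_mem_tr (F := F) p t
  let i0 : Fin m := ⟨0, by omega⟩
  let o : Fin n := ⟨0, by omega⟩
  have hs : ∀ k l : Fin n, ∃ s : F, k ≠ l → rootEnd φ k l 1 = s • 1 := by
    intro k l
    refine ⟨co 0 (rootEnd φ k l 1), fun hkl => eq_smul_one_of_partial fun i => ?_⟩
    rw [← hφ.rootEnd_partial hp hm ht hD hh hkl h1, partial_one, map_zero]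
  choose s hs using hs
  have hφs : ∀ k l, k ≠ l → φ (fld (1 ⊗ₜ gen F k) (.inr l))
      = s k l • fld (1 ⊗ₜ gen F k) (.inr l) := by
    intro k l hkl
    rw [hφ.apply_gen_fld hp hm ht hh hkl h1, hs k l hkl, ← TensorProduct.smul_tmul', fld_smul]
  have hadd : ∀ k l j, k ≠ l → l ≠ j → k ≠ j → s k j = s k l + s l j := by
    intro k l j hkl hlj hkj
    have e := hφ.rootEnd_mul hp hm ht hh hkl hlj hkj h1 h1
    rw [mul_one, hφ.apply_gen_fld hp hm ht hh hkj h1] at e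
    have e := fld_gen_injective e
    rw [hs k j hkj, hs k l hkl, hs l j hlj, mul_one, one_mul, ← add_smul] at e
    have := congrArg (co 0) e
    rwa [map_smul, map_smul, ← mono_zero, co_mono, if_pos rfl, smul_eq_mul, smul_eq_mul, mul_one,
      mul_one] at this
  have hneg : ∀ k l, k ≠ l → s k l + s l k = 0 := by
    intro k l hkl
    refine smul_gfld_sub_eq_zero (m := m) hkl ?_
    have e := lie_gen_fld_swap (m := m) (a := 1) (b := 1) h2 k l
    rw [mul_one] at e
    have e' : φ (fld (1 ⊗ₜ gen F k) (.inr k) - fld (1 ⊗ₜ gen F l) (.inr l)) = 0 := by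
      change φ (gfld F m k - gfld F m l) = 0
      rw [← hfld_sub_hfld i0, map_sub, hh, hh, sub_zero]
    rw [← e, hφ.leib _ (gen_fld_mem h2 i0 h1 hkl) _ (gen_fld_mem h2 i0 h1 hkl.symm), hφs k l hkl,
      hφs l k hkl.symm, smul_lie_end, lie_smul_end, ← add_smul_end, e] at e'
    exact e'
  let σ : Fin n → F := fun k => if k = o then 0 else s k o
  have hσ : ∀ k l, k ≠ l → s k l = σ k - σ l := by
    intro k l hkl
    by_cases hk : k = o
    · have hl : l ≠ o := fun h => hkl (hk.trans h.symm)
      simp only [σ, hk, if_true, hl, if_false]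
      rw [zero_sub, eq_neg_iff_add_eq_zero]
      exact hneg o l (Ne.symm hl)
    · by_cases hl : l = o
      · simp [σ, hk, hl]
      · simp only [σ, hk, hl, if_false]
        rw [hadd k l o hkl hl hk, add_sub_cancel_right]
  refine ⟨∑ q, σ q • gfld F m q, sum_mem fun q _ => Submodule.smul_mem _ _ (gfld_mem_evenW h2 q),
    fun j => ?_, fun i k => ?_, fun k l hkl => ?_⟩
  · rw [lie_sum]
    exact Finset.sum_eq_zero fun q _ => by rw [lie_smul_end, lie_gfld_D, smul_zero]
  · rw [sum_lie]
    exact Finset.sum_eq_zero fun q _ => by rw [smul_lie_end, lie_gfld_hfld h2, smul_zero]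
  · rw [hφs k l hkl, sum_lie, hσ k l hkl]
    have : ∀ q, ⁅σ q • gfld F m q,
        (fld (1 ⊗ₜ gen F k) (.inr l) : Module.End F (SuperAlg F m n))⁆
        = (if q = k then σ q else 0) • fld (1 ⊗ₜ gen F k) (.inr l)
          - (if q = l then σ q else 0) • fld (1 ⊗ₜ gen F k) (.inr l) := by
      intro q
      rw [smul_lie_end, lie_gfld_gen_fld h2, smul_smul, mul_sub, mul_ite, mul_ite, mul_one, mul_zero]
      exact sub_smul_end _ _ _
    simp only [this]
    rw [Finset.sum_sub_distrib, ← Finset.sum_smul, ← Finset.sum_smul]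
    simp only [Finset.sum_ite_eq', Finset.mem_univ, if_true]
    exact sub_smul_end _ _ _

/-- Up to the operators `D_i^(p^r)`, a derivation that kills all `D_i`, the torus of `𝒮` and all
`x_k D_l` also kills `𝔄(m; t) ⊗ sl(n)`: it acts there through a single derivation of `𝔄(m; t)` which
commutes with all `∂_i`. -/
theorem exists_powD (hφ : IsDer n p t φ) (hp : 3 < p) (hm : 3 ≤ m) (hn : 3 ≤ n)
    (ht : ∀ i, 1 ≤ t i) (hD : ∀ i : Fin m, φ (D F (.inl i)) = 0)
    (hh : ∀ (i : Fin m) (k : Fin n), φ (hfld F i k) = 0)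
    (hL : ∀ k l : Fin n, k ≠ l → φ (fld (1 ⊗ₜ gen F k) (.inr l)) = 0) :
    ∃ c : Fin m → ℕ → F, ∀ a ∈ tr p t, ∀ k l : Fin n, k ≠ l →
      φ (fld (a ⊗ₜ gen F k) (.inr l)) = ⁅powD n p t c, fld (a ⊗ₜ gen F k) (.inr l)⁆ := by
  have h2 : (2 : F) ≠ 0 := two_ne_zero_of_char p hp
  have h1 := one_mem_tr (F := F) p t
  let i0 : Fin m := ⟨0, by omega⟩
  let o : Fin n := ⟨0, by omega⟩
  let k1 : Fin n := ⟨1, by omega⟩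
  let k2 : Fin n := ⟨2, by omega⟩
  have ho1 : o ≠ k1 := by simp [o, k1]
  have ho2 : o ≠ k2 := by simp [o, k2]
  have h12 : k1 ≠ k2 := by simp [k1, k2]
  have hΦ1 : ∀ k l, k ≠ l → rootEnd φ k l 1 = 0 := by
    intro k l hkl
    have e := hφ.apply_gen_fld hp hm ht hh hkl h1
    rw [hL k l hkl] at e
    refine fld_gen_injective (k := k) (l := l) ?_
    rw [← e, TensorProduct.zero_tmul, fld_zero]
  have hrow : ∀ a ∈ tr p t, ∀ k l j, k ≠ l → k ≠ j → rootEnd φ k j a = rootEnd φ k l a := by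
    intro a ha k l j hkl hkj
    by_cases hlj : l = j
    · rw [hlj]
    have e := hφ.rootEnd_mul hp hm ht hh hkl hlj hkj ha h1
    rw [mul_one, hφ.apply_gen_fld hp hm ht hh hkj ha, hΦ1 l j hlj, mul_zero, add_zero, mul_one] at e
    exact fld_gen_injective e
  have hcol : ∀ a ∈ tr p t, ∀ k l j, k ≠ j → l ≠ j → rootEnd φ k j a = rootEnd φ l j a := by
    intro a ha k l j hkj hlj
    by_cases hkl : k = l
    · rw [hkl]
    have e := hφ.rootEnd_mul hp hm ht hh hkl hlj hkj h1 ha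
    rw [one_mul, hφ.apply_gen_fld hp hm ht hh hkj ha, hΦ1 k l hkl, zero_mul, zero_add, one_mul] at e
    exact fld_gen_injective e
  obtain ⟨Φ, hΦdef⟩ : ∃ Φ, Φ = rootEnd φ o k1 := ⟨_, rfl⟩
  have hall : ∀ a ∈ tr p t, ∀ k l, k ≠ l → rootEnd φ k l a = Φ a := by
    intro a ha k l hkl
    rw [hΦdef]
    by_cases hk : k = k1
    · subst hk
      rw [hrow a ha k1 k2 l h12 hkl, hcol a ha k1 o k2 h12 ho2, hrow a ha o k1 k2 ho1 ho2]
    · rw [hrow a ha k k1 l hk hkl, hcol a ha k o k1 hk ho1]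
  have hmul : ∀ a ∈ tr p t, ∀ b ∈ tr p t, Φ (a * b) = Φ a * b + a * Φ b := by
    intro a ha b hb
    have e := hφ.rootEnd_mul hp hm ht hh ho1 h12 ho2 ha hb
    rw [hφ.apply_gen_fld hp hm ht hh ho2 (mul_mem_tr ha hb)] at e
    have e := fld_gen_injective e
    rwa [hall _ (mul_mem_tr ha hb) _ _ ho2, hall a ha _ _ ho1, hall b hb _ _ h12] at e
  have hpar : ∀ a ∈ tr p t, ∀ i, Φ (partialHom i a) = partialHom i (Φ a) := by
    intro a ha i
    rw [hΦdef]
    exact hφ.rootEnd_partial hp hm ht hD hh ho1 ha i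
  have hvar : ∀ i, Φ (mono F (Pi.single i 1)) = 0 := by
    intro i
    have hv := var_mem_tr (F := F) (p := p) ht i
    have e := hφ.lie_hfld h2 ht hh i k2 (gen_fld_mem h2 i hv ho1)
    have e1 : partialHom i (mono F (Pi.single i 1)) = 1 := by rw [partial_var, if_pos rfl]
    have e2 : partialHom i (Φ (mono F (Pi.single i 1))) = 0 := by
      rw [← hpar _ hv, e1, hΦdef, hΦ1 _ _ ho1]
    rw [lie_hfld_gen_fld h2 i ho1 ho2.symm h12.symm, e1, mul_one,
      hφ.apply_gen_fld hp hm ht hh ho1 hv, lie_hfld_gen_fld h2 i ho1 ho2.symm h12.symm,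
      hall _ hv _ _ ho1, e2, mul_zero] at e
    exact fld_gen_injective e
  obtain ⟨c, hc⟩ : ∃ c : Fin m → ℕ → F, c = fun i r => co 0 (Φ (mono F (Pi.single i (p ^ r)))) :=
    ⟨_, rfl⟩
  refine ⟨c, fun a ha k l hkl => ?_⟩
  rw [hφ.apply_gen_fld hp hm ht hh hkl ha, lie_powD_fld, powD_tmul, hall a ha k l hkl]
  congr 2
  rw [← sub_eq_zero]
  refine derivation_eq_zero (Φ := Φ - powP p t c) (p := p) (t := t) ?_ ?_ ?_ ha
  · intro a ha b hb
    rw [LinearMap.sub_apply, LinearMap.sub_apply, LinearMap.sub_apply, hmul a ha b hb, powP_mul]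
    ring
  · intro a ha i
    rw [LinearMap.sub_apply, LinearMap.sub_apply, hpar a ha, powP_partial, map_sub]
  · intro i r hr
    rw [LinearMap.sub_apply, map_sub]
    rcases Nat.eq_zero_or_pos r with rfl | hr0
    · rw [pow_zero, hvar, co_zero_powP_var, map_zero, sub_zero]
    · rw [co_zero_powP c i hr0 hr, hc, sub_self]

end IsDer
end SuperAlg

/-! ### Derivations on the fields `x_i D_j` and `x_k x_l D_i` -/

namespace SuperAlg

open DividedPower

variable {F : Type*} [Field F] {m n p : ℕ} {t : Fin m → ℕ}

/-- The fields `x_k x_l D_i`, with `k, l ∈ Y₁` and `i ∈ Y₀`. -/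
def pfld (F : Type*) [Field F] {m n : ℕ} (k l : Fin n) (i : Fin m) :
    Module.End F (SuperAlg F m n) := fld (1 ⊗ₜ (gen F k * gen F l)) (.inl i)

theorem pfld_mem [Fact p.Prime] [CharP F p] (h2 : (2 : F) ≠ 0) (hn : 3 ≤ n) (k l : Fin n)
    (i : Fin m) : pfld F k l i ∈ evenS F n p t := by
  obtain ⟨s, hk, hl⟩ := Fin.exists_ne_and_ne_of_two_lt k l (by omega)
  rw [pfld, ← zfld_one_eq i s]
  exact zfld_mem h2 (one_mem_tr p t) i (inv_gen_mul_gen k l) (dgen_gen_mul_gen_ne hk hl)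

theorem lie_hfld_one_fld (h2 : (2 : F) ≠ 0) (q : Fin m) (r : Fin n) (i : Fin m)
    {u : ExteriorAlgebra F (Fin n → F)} (hu : inv F n u = u) :
    ⁅(hfld F q r : Module.End F (SuperAlg F m n)), fld (1 ⊗ₜ u) (.inl i)⁆
      = fld (1 ⊗ₜ (gen F r * dgen F r u - (if i = q then 1 else 0 : F) • u)) (.inl i) := by
  rw [hfld, x_inl, x_inr, add_lie, lie_inl_inl h2 q i (map_one _) hu, lie_inr_inl h2 r i (inv_gen r) hu,
    partial_one, partial_one, partial_var, mul_zero, mul_zero, mul_one, one_mul,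
    TensorProduct.zero_tmul, TensorProduct.zero_tmul, fld_zero, fld_zero, zero_sub, sub_zero, mul_one]
  by_cases h : i = q
  · subst h
    simp only [if_true, one_smul, mul_one, TensorProduct.tmul_sub, fld_sub]
    abel
  · simp [h]

theorem gen_dgen_gen_mul_gen {k l : Fin n} (hkl : k ≠ l) (r : Fin n) :
    gen F r * dgen F r (gen F k * gen F l)
      = ((if r = k then 1 else 0) + (if r = l then 1 else 0) : F) • (gen F k * gen F l) := by
  by_cases hk : r = k
  · subst hk
    rw [dgen_gen_mul_gen_left hkl]; simp [hkl]
  · by_cases hl : r = l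
    · subst hl
      rw [dgen_gen_mul_gen_right hkl.symm, mul_neg, ← gen_anticomm]; simp [hk]
    · rw [dgen_gen_mul_gen_ne hk hl]; simp [hk, hl]

theorem lie_hfld_pfld (h2 : (2 : F) ≠ 0) (q : Fin m) (r : Fin n) {k l : Fin n} (hkl : k ≠ l)
    (i : Fin m) : ⁅hfld F q r, pfld F k l i⁆
      = ((if r = k then 1 else 0) + (if r = l then 1 else 0) - (if i = q then 1 else 0) : F)
        • pfld F k l i := by
  rw [pfld, lie_hfld_one_fld h2 q r i (inv_gen_mul_gen k l), gen_dgen_gen_mul_gen hkl, ← sub_smul,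
    TensorProduct.tmul_smul, fld_smul]

theorem lie_gfld_pfld (h2 : (2 : F) ≠ 0) (r : Fin n) {k l : Fin n} (hkl : k ≠ l)
    (i : Fin m) : ⁅gfld F m r, pfld F k l i⁆
      = ((if r = k then 1 else 0) + (if r = l then 1 else 0) : F) • pfld F k l i := by
  rw [gfld, pfld, lie_inr_inl h2 r i (inv_gen r) (inv_gen_mul_gen k l), partial_one, mul_zero,
    TensorProduct.zero_tmul, fld_zero, sub_zero, one_mul, gen_dgen_gen_mul_gen hkl,
    TensorProduct.tmul_smul, fld_smul]

theorem eq_smul_gen_mul_gen {k l : Fin n} (hkl : k ≠ l) {u : ExteriorAlgebra F (Fin n → F)}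
    (h : ∀ r, gen F r * dgen F r u
      = ((if r = k then 1 else 0) + (if r = l then 1 else 0) : F) • u) :
    ∃ c : F, u = c • (gen F k * gen F l) := by
  have hk : gen F k * dgen F k u = u := by rw [h]; simp [hkl]
  have hl : gen F l * dgen F l u = u := by rw [h]; simp [hkl.symm]
  obtain ⟨c, hc⟩ := exists_smul_one_of_dgen (u := dgen F l (dgen F k u)) fun r => by
    by_cases hrl : r = l
    · rw [hrl, dgen_dgen]
    rw [dgen_comm]
    by_cases hrk : r = k
    · rw [hrk, dgen_dgen, map_zero, neg_zero]
    · have h0 : dgen F r u = 0 := dgen_eq_zero_of_gen_dgen (by rw [h]; simp [hrk, hrl])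
      rw [dgen_comm r k, h0, map_zero, neg_zero, map_zero, neg_zero]
  refine ⟨c, ?_⟩
  have h' : gen F k * (gen F l * dgen F l (dgen F k u)) = u := by
    have : gen F k * dgen F k (gen F l * dgen F l u) = u := by rw [hl, hk]
    rw [dgen_ne_gen_mul hkl, dgen_comm, mul_neg, mul_neg, mul_neg, neg_neg] at this
    exact this
  rw [hc, mul_smul_comm, mul_smul_comm, mul_one] at h'
  exact h'.symm

variable {φ : Module.End F (Module.End F (SuperAlg F m n))} [Fact p.Prime] [CharP F p]

variable (n p t) in
/-- The derivations of `𝒮` with values in the even part of `W(m, n; t)` that kill all `D_i`,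
`i ∈ Y₀`, the torus of `𝒮`, and `𝔄(m; t) ⊗ sl(n)`. -/
structure KillsSl (φ : Module.End F (Module.End F (SuperAlg F m n))) : Prop
    extends IsDer n p t φ where
  partials : ∀ i : Fin m, φ (D F (.inl i)) = 0
  torus : ∀ (i : Fin m) (k : Fin n), φ (hfld F i k) = 0
  roots : ∀ a ∈ tr p t, ∀ k l : Fin n, k ≠ l → φ (fld (a ⊗ₜ gen F k) (.inr l)) = 0

theorem pfld_ne_zero {k l : Fin n} (hkl : k ≠ l) (i : Fin m) : pfld F k l i ≠ 0 := by
  intro h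
  have e := LinearMap.congr_fun h (x F (.inl i))
  rw [pfld, fld_x, if_pos rfl, LinearMap.zero_apply] at e
  have e := one_tmul_inj (m := m) (e.trans (TensorProduct.tmul_zero _ _).symm)
  have e := congrArg (dgen F k) e
  rw [dgen_gen_mul_gen_left hkl, map_zero] at e
  exact gen_ne_zero l e

namespace KillsSl

/-- The values of such a derivation at the fields `a D_i + (∂_i a) x_s D_s`, which include the `x_i D_j`,
commute with `𝔄(m; t) ⊗ sl(n)`, since these fields normalize the root spaces. -/
theorem lie_zfld (hφ : KillsSl n p t φ) (h2 : (2 : F) ≠ 0) {a b : DividedPower F m}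
    (ha : a ∈ tr p t) (hb : b ∈ tr p t) (i : Fin m) (s : Fin n) {k l : Fin n} (hkl : k ≠ l) :
    ⁅φ (zfld a 1 i s), (fld (b ⊗ₜ gen F k) (.inr l) : Module.End F (SuperAlg F m n))⁆ = 0 := by
  have e := hφ.leib _ (zfld_mem h2 ha i (map_one _) (dgen_one s)) _ (gen_fld_mem h2 i hb hkl)
  have hab : a * partialHom i b ∈ tr p t := mul_mem_tr ha (partial_mem_tr hb i)
  have hba : partialHom i a * b ∈ tr p t := mul_mem_tr (partial_mem_tr ha i) hb
  rw [hφ.roots b hb k l hkl, lie_zero, add_zero, lie_zfld_gen_fld h2 i s hkl,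
    hφ.roots _ ?_ k l hkl] at e
  · exact e.symm
  · refine sub_mem (add_mem hab ?_) ?_ <;> split_ifs <;> first | exact hba | exact zero_mem _

theorem apply_var_fld (hφ : KillsSl n p t φ) (hp : 3 < p) (hn : 3 ≤ n) (ht : ∀ i, 1 ≤ t i)
    {i j : Fin m} (hij : i ≠ j) : φ (fld (mono F (Pi.single i 1) ⊗ₜ 1) (.inl j)) = 0 := by
  have h2 : (2 : F) ≠ 0 := two_ne_zero_of_char p hp
  let k0 : Fin n := ⟨0, by omega⟩
  have hz : (fld (mono F (Pi.single i 1) ⊗ₜ 1) (.inl j) : Module.End F (SuperAlg F m n))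
      = zfld (mono F (Pi.single i 1)) 1 j k0 := by
    rw [zfld, partial_var, if_neg hij.symm, TensorProduct.zero_tmul, fld_zero, add_zero]
  have hv := var_mem_tr (F := F) (p := p) ht i
  have hy := zfld_mem (n := n) h2 hv j (s := k0) (map_one _) (dgen_one k0)
  rw [hz]
  have hE := hφ.mem _ hy
  have hC : ConstCoef (φ (zfld (mono F (Pi.single i 1)) 1 j k0)) := by
    intro q
    rw [← hφ.toIsDer.lie_D h2 hφ.partials k0 q hy, lie_D_zfld, partial_var]
    split_ifs
    · rw [← D_eq_zfld]; exact hφ.partials j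
    · simp [zfld]
  obtain ⟨⟨c, hc⟩, htop⟩ := cc_of_lie_gen_fld ht (by omega) hE hC fun b hb k l hkl =>
    hφ.lie_zfld h2 hv hb j k0 hkl
  have hw : ∀ k : Fin n, ⁅hfld F j k, φ (zfld (mono F (Pi.single i 1)) 1 j k0)⁆
      = (-1 : F) • φ (zfld (mono F (Pi.single i 1)) 1 j k0) := by
    intro k
    rw [← hφ.toIsDer.lie_hfld h2 ht hφ.torus j k hy, ← map_smul]
    congr 1
    rw [← hz, hfld, x_inl, x_inr, add_lie, lie_inl_inl h2 j j (map_one _) (map_one _),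
      lie_inr_inl h2 k j (inv_gen k) (map_one _), partial_var, partial_var, if_neg hij.symm,
      if_pos rfl, dgen_one, mul_zero, mul_zero, mul_one, mul_one]
    simp only [partial_one, mul_zero, TensorProduct.zero_tmul, TensorProduct.tmul_zero, fld_zero,
      zero_sub, sub_zero, add_zero]
    exact (neg_one_smul (R := F) (M := Module.End F (SuperAlg F m n)) _).symm
  refine eq_zero_of_cc hE hC fun r => ?_
  cases r with
  | inr k =>
    have e := gen_dgen_cc hE hC (hw k) (.inr k)
    rw [hc k, map_smul, dgen_gen_self, mul_smul_comm, mul_one] at e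
    rw [hc k, e]
    simp
  | inl q =>
    by_contra hq
    have e := weight_of_cc_inl hE hC (htop q k0) hq (hw k0)
    split_ifs at e
    · exact zero_ne_one (α := F) (by linear_combination e)
    · exact h2 (by linear_combination -e)

theorem exists_apply_pfld (hφ : KillsSl n p t φ) (hp : 3 < p) (hm : 3 ≤ m) (hn : 3 ≤ n)
    (ht : ∀ i, 1 ≤ t i) {k l : Fin n} (hkl : k ≠ l) (i : Fin m) :
    ∃ c : F, φ (pfld F k l i) = c • pfld F k l i := by
  have h2 : (2 : F) ≠ 0 := two_ne_zero_of_char p hp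
  have hy := pfld_mem (p := p) (t := t) h2 hn k l i
  have hE := hφ.mem _ hy
  have hC : ConstCoef (φ (pfld F k l i)) := by
    intro q
    rw [← hφ.toIsDer.lie_D h2 hφ.partials k q hy, pfld, lie_D_fld, D_inl, partial_one,
      TensorProduct.zero_tmul, fld_zero, map_zero]
  have hw := fun (q : Fin m) (r : Fin n) (s : Fin m ⊕ Fin n) => gen_dgen_cc hE hC (q := q) (k := r)
    (by rw [← hφ.toIsDer.lie_hfld h2 ht hφ.torus q r hy, lie_hfld_pfld h2 q r hkl, map_smul]) s
  have hother : ∀ s, s ≠ .inl i → cc (φ (pfld F k l i)) s = 0 := by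
    intro s hs
    obtain ⟨q, q', h⟩ : ∃ q q' : Fin m, (i ≠ q ∧ i = q' ∧ s ≠ .inl q ∧ s ≠ .inl q') ∨
        (i ≠ q ∧ i ≠ q' ∧ s = .inl q ∧ s ≠ .inl q') := by
      cases s with
      | inl j =>
        have hji : j ≠ i := by simpa using hs
        obtain ⟨q', h1, h2⟩ := Fin.exists_ne_and_ne_of_two_lt i j (by omega)
        exact ⟨j, q', .inr ⟨hji.symm, h1.symm, rfl, by simpa using h2.symm⟩⟩
      | inr j =>
        obtain ⟨q, h1, -⟩ := Fin.exists_ne_and_ne_of_two_lt i i (by omega)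
        exact ⟨q, i, .inl ⟨h1.symm, rfl, by simp, by simp⟩⟩
    have e := (hw q k s).symm.trans (hw q' k s)
    by_contra h0
    have e := smul_left_injective F h0 e
    rcases h with ⟨h1, h3, h4, h5⟩ | ⟨h1, h3, h4, h5⟩
    · simp only [if_neg h1, if_pos h3, if_neg h4, if_neg h5] at e
      exact one_ne_zero (α := F) (by linear_combination e)
    · simp only [if_neg h1, if_neg h3, if_pos h4, if_neg h5] at e
      exact one_ne_zero (α := F) (by linear_combination e)
  obtain ⟨c, hc⟩ := eq_smul_gen_mul_gen hkl (u := cc (φ (pfld F k l i)) (.inl i)) fun r => by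
    rw [hw i r]
    congr 1
    simp
  refine ⟨c, evenW_ext hE (Submodule.smul_mem _ _ (evenS_le_evenW hy)) fun s => ?_⟩
  rw [apply_x_eq hE hC, LinearMap.smul_apply, pfld, fld_x]
  by_cases hs : s = .inl i
  · rw [if_pos hs.symm, hs, ← TensorProduct.tmul_smul, ← hc]; rfl
  · rw [if_neg (Ne.symm hs), smul_zero]
    rw [← pfld, hother s hs, TensorProduct.tmul_zero]

/-- The values at the fields `x_k x_l D_i` agree with those of a multiple of `ad ∑ x_k D_k`. -/
theorem exists_ad_pfld (hφ : KillsSl n p t φ) (hp : 3 < p) (hm : 3 ≤ m) (hn : 3 ≤ n)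
    (ht : ∀ i, 1 ≤ t i) :
    ∃ c : F, ∀ (k l : Fin n) (i : Fin m),
      φ (pfld F k l i) = ⁅(c • ∑ r, gfld F m r : Module.End F (SuperAlg F m n)), pfld F k l i⁆ := by
  have h2 : (2 : F) ≠ 0 := two_ne_zero_of_char p hp
  have h1 := one_mem_tr (F := F) p t
  let i0 : Fin m := ⟨0, by omega⟩
  let o : Fin n := ⟨0, by omega⟩
  let k1 : Fin n := ⟨1, by omega⟩
  have ho1 : o ≠ k1 := by simp [o, k1]
  have hc : ∀ (k l : Fin n) (i : Fin m), ∃ c : F, k ≠ l → φ (pfld F k l i) = c • pfld F k l i := by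
    intro k l i
    by_cases hkl : k = l
    · exact ⟨0, fun h => absurd hkl h⟩
    · obtain ⟨c, hc⟩ := hφ.exists_apply_pfld hp hm hn ht hkl i
      exact ⟨c, fun _ => hc⟩
  choose c hc using hc
  have hinj : ∀ {k l : Fin n} {i : Fin m} {a b : F}, k ≠ l →
      a • pfld F k l i = b • pfld F k l i → a = b := by
    intro k l i a b hkl h
    rw [← sub_eq_zero, ← sub_smul_end] at h
    exact sub_eq_zero.1 ((smul_eq_zero.1 h).resolve_right (pfld_ne_zero hkl i))
  have hci : ∀ k l i j, k ≠ l → c k l i = c k l j := by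
    intro k l i j hkl
    by_cases hij : i = j
    · rw [hij]
    have e : ⁅pfld F k l i, (fld (mono F (Pi.single i 1) ⊗ₜ 1) (.inl j) :
        Module.End F (SuperAlg F m n))⁆ = pfld F k l j := by
      rw [pfld, lie_inl_inl h2 i j (inv_gen_mul_gen k l) (map_one _), partial_var, if_pos rfl,
        partial_one, mul_zero, TensorProduct.zero_tmul, fld_zero, sub_zero, mul_one, mul_one, pfld]
    have hm' : (fld (mono F (Pi.single i 1) ⊗ₜ 1) (.inl j) : Module.End F (SuperAlg F m n))
        ∈ evenS F n p t := by
      have := zfld_mem (n := n) h2 (var_mem_tr (F := F) (p := p) ht i) j (s := o) (map_one _)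
        (dgen_one o)
      rwa [zfld, partial_var, if_neg (Ne.symm hij), TensorProduct.zero_tmul, fld_zero,
        add_zero] at this
    have e' := hφ.leib _ (pfld_mem h2 hn k l i) _ hm'
    rw [hφ.apply_var_fld hp hn ht hij, lie_zero, add_zero, hc k l i hkl, smul_lie_end, e,
      hc k l j hkl] at e'
    exact (hinj hkl e').symm
  have hswap : ∀ k l i, k ≠ l → c k l i = c l k i := by
    intro k l i hkl
    have e : pfld F k l i = -pfld F l k i := by
      rw [pfld, gen_anticomm, TensorProduct.tmul_neg, fld_neg, pfld]
    have e' := hc k l i hkl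
    rw [e, map_neg, hc l k i hkl.symm, smul_neg, neg_inj] at e'
    exact (hinj hkl.symm e').symm
  have hrow : ∀ k l r i, k ≠ l → k ≠ r → c k l i = c k r i := by
    intro k l r i hkl hkr
    by_cases hrl : r = l
    · rw [hrl]
    have e' := hφ.leib _ (gen_fld_mem h2 i0 h1 hrl) _ (pfld_mem h2 hn k l i)
    rw [hφ.roots 1 h1 r l hrl, zero_lie, zero_add, hc k l i hkl, lie_smul_end] at e'
    have e : ⁅(fld (1 ⊗ₜ gen F r) (.inr l) : Module.End F (SuperAlg F m n)), pfld F k l i⁆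
        = pfld F k r i := lie_gen_fld_gen_mul_gen h2 i hkl.symm
    rw [e, hc k r i hkr] at e'
    exact (hinj hkr e').symm
  have hall : ∀ k l i, k ≠ l → c k l i = c o k1 i0 := by
    intro k l i hkl
    rw [hci k l i i0 hkl]
    by_cases hk : k = k1
    · subst hk
      rw [hrow k1 l o i0 hkl ho1.symm, hswap _ _ _ ho1.symm]
    · by_cases ho : k = o
      · subst ho; rw [hrow o l k1 i0 hkl ho1]
      · rw [hrow k l o i0 hkl ho, hswap _ _ _ ho, hrow o k k1 i0 (Ne.symm ho) ho1]
  refine ⟨c o k1 i0 / 2, fun k l i => ?_⟩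
  by_cases hkl : k = l
  · subst hkl
    have : pfld F k k i = 0 := by rw [pfld, gen_mul_self, TensorProduct.tmul_zero, fld_zero]
    rw [this, map_zero, lie_zero]
  rw [hc k l i hkl, hall k l i hkl, smul_lie_end, sum_lie]
  simp only [lie_gfld_pfld h2 _ hkl, add_smul_end, Finset.sum_add_distrib, ite_smul, one_smul,
    zero_smul, Finset.sum_ite_eq', Finset.mem_univ, if_true]
  rw [← two_smul F, smul_smul, div_mul_cancel₀ _ h2]

end KillsSl
end SuperAlg

/-! ### A derivation that kills the generators vanishes on divergence-free fields -/

namespace SuperAlg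

open DividedPower

variable {F : Type*} [Field F] {m n p : ℕ} {t : Fin m → ℕ}
  {φ : Module.End F (Module.End F (SuperAlg F m n))}

theorem var_mul_partial_partial (q i : Fin m) (α : Fin m → ℕ) :
    mono F (Pi.single q 1) * partialHom q (partialHom i (mono F α))
      = ((α q : F) - if q = i then 1 else 0) • partialHom i (mono F α) := by
  have h := congrArg (partialHom i) (var_mul_partial (F := F) q α)
  rw [partialHom_mul, partial_var, map_smul, partialHom_comm i q] at h
  rw [sub_smul, ← h]
  by_cases hq : q = i
  · subst hq; simp
  · simp [hq, Ne.symm hq]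

theorem lie_hfld_zfld (h2 : (2 : F) ≠ 0) (q : Fin m) (k : Fin n) (α : Fin m → ℕ) (i : Fin m)
    (s : Fin n) : ⁅(hfld F q k : Module.End F (SuperAlg F m n)), zfld (mono F α) 1 i s⁆
      = ((α q : F) - if q = i then 1 else 0) • zfld (mono F α) 1 i s := by
  have hT4 : fld (((1 : DividedPower F m) * partialHom i (mono F α)) ⊗ₜ (gen F k * dgen F k (gen F s)))
        (.inr s) - fld ((partialHom i (mono F α) * 1) ⊗ₜ (gen F s * dgen F s (gen F k))) (.inr k)
      = (0 : Module.End F (SuperAlg F m n)) := by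
    by_cases h : k = s
    · subst h; rw [one_mul, mul_one, sub_self]
    · rw [dgen_gen_ne h, dgen_gen_ne (Ne.symm h)]; simp
  have hT1 : fld ((mono F (Pi.single q 1) * partialHom q (mono F α)) ⊗ₜ 1) (.inl i)
      - fld ((mono F α * partialHom i (mono F (Pi.single q 1))) ⊗ₜ 1) (.inl q)
      = ((α q : F) - if q = i then 1 else 0) •
        (fld (mono F α ⊗ₜ 1) (.inl i) : Module.End F (SuperAlg F m n)) := by
    rw [var_mul_partial, partial_var, ← TensorProduct.smul_tmul', fld_smul, sub_smul_end]
    by_cases h : q = i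
    · subst h; simp
    · simp [h, Ne.symm h]
  rw [hfld, x_inl, x_inr, zfld, one_mul, add_lie, lie_add, lie_add,
    lie_inl_inl h2 q i (map_one _) (map_one _), lie_inl_inr h2 q s (map_one _) (inv_gen s),
    lie_inr_inl h2 k i (inv_gen k) (map_one _), lie_inr_inr h2 k s (inv_gen k) (inv_gen s),
    hT4, one_mul, hT1, var_mul_partial_partial, one_mul, dgen_one, dgen_one, mul_zero, mul_zero,
    partial_one, mul_zero, smul_add, ← fld_smul _ (partialHom i (mono F α) ⊗ₜ gen F s),
    TensorProduct.smul_tmul']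
  simp

theorem zfld_neg (a : DividedPower F m) (w : ExteriorAlgebra F (Fin n → F)) (i : Fin m) (s : Fin n) :
    zfld a (-w) i s = -zfld a w i s := by
  rw [zfld, zfld, neg_mul, TensorProduct.tmul_neg, TensorProduct.tmul_neg, fld_neg, fld_neg, neg_add]

/-- The map `a ↦ (a w) D_i + (∂_i a) w x_s D_s`. -/
def zfldMap (w : ExteriorAlgebra F (Fin n → F)) (i : Fin m) (s : Fin n) :
    DividedPower F m →ₗ[F] Module.End F (SuperAlg F m n) :=
  fldMap w (.inl i) + fldMap (w * gen F s) (.inr s) ∘ₗ partialHom i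

theorem inv_word_of_odd {l : List (Fin n)} (h : Odd l.length) : inv F n (word F l) = -word F l := by
  rw [inv_word, h.neg_one_pow, neg_one_smul]

theorem inv_word_of_even {l : List (Fin n)} (h : Even l.length) :
    inv F n (word F l) = word F l := by
  rw [inv_word, h.neg_one_pow, one_smul]

variable [Fact p.Prime] [CharP F p]

variable (n p t) in
/-- The derivations of `𝒮` that kill all `D_i`, the torus, `𝔄(m; t) ⊗ sl(n)`, and all `x_k x_l D_i`,
with `k, l ∈ Y₁` and `i ∈ Y₀`. -/
structure KillsGens (φ : Module.End F (Module.End F (SuperAlg F m n))) : Prop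
    extends KillsSl n p t φ where
  pairs : ∀ (k l : Fin n) (i : Fin m), φ (pfld F k l i) = 0

/-- Each derivation of `𝒮` agrees on the generators with a derivation of the form
`ad E + ∑ c_ir (ad D_i)^(p^r)`. -/
theorem IsDer.exists_killsGens (hφ : IsDer n p t φ) (hp : 3 < p) (hm : 3 ≤ m) (hn : 3 ≤ n)
    (ht : ∀ i, 1 ≤ t i) :
    ∃ E ∈ evenW F n p t, ∃ c, KillsGens n p t (φ - adE E - adE (powD n p t c)) := by
  have h2 : (2 : F) ≠ 0 := two_ne_zero_of_char p hp
  have h1 := one_mem_tr (F := F) p t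
  let k0 : Fin n := ⟨0, by omega⟩
  obtain ⟨w₁, hw₁, e₁⟩ := exists_ad_D hp hm hn ht hφ
  have d₁ := hφ.sub (isDer_ad h2 hw₁)
  have hD₁ : ∀ i : Fin m, (φ - adE w₁) (D F (.inl i)) = 0 := by
    intro i
    rw [LinearMap.sub_apply, e₁, LieAlgebra.ad_apply, sub_self]
  obtain ⟨w₂, hw₂, hC₂, e₂⟩ := exists_ad_hfld hp hm hn ht d₁ hD₁
  have d₂ := d₁.sub (isDer_ad h2 hw₂)
  have hD₂ : ∀ i : Fin m, (φ - adE w₁ - adE w₂) (D F (.inl i)) = 0 := by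
    intro i
    rw [LinearMap.sub_apply, hD₁, LieAlgebra.ad_apply, ← lie_skew, hC₂, neg_zero, sub_zero]
  have hh₂ : ∀ (i : Fin m) (k : Fin n), (φ - adE w₁ - adE w₂) (hfld F i k) = 0 := by
    intro i k
    rw [LinearMap.sub_apply, e₂, LieAlgebra.ad_apply, sub_self]
  obtain ⟨w₃, hw₃, hC₃, hh, e₃⟩ := d₂.exists_ad_gfld hp hm hn ht hD₂ hh₂
  have d₃ := d₂.sub (isDer_ad h2 hw₃)
  have hD₃ : ∀ i : Fin m, (φ - adE w₁ - adE w₂ - adE w₃) (D F (.inl i)) = 0 := by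
    intro i
    rw [LinearMap.sub_apply, hD₂, LieAlgebra.ad_apply, ← lie_skew, hC₃, neg_zero, sub_zero]
  have hh₃ : ∀ (i : Fin m) (k : Fin n), (φ - adE w₁ - adE w₂ - adE w₃) (hfld F i k) = 0 := by
    intro i k
    rw [LinearMap.sub_apply, hh₂, LieAlgebra.ad_apply, hh, sub_zero]
  obtain ⟨c, e₄⟩ := d₃.exists_powD hp hm hn ht hD₃ hh₃ fun k l hkl => by
    rw [LinearMap.sub_apply, e₃ k l hkl, LieAlgebra.ad_apply, sub_self]
  have hφ₄ : KillsSl n p t (φ - adE w₁ - adE w₂ - adE w₃ - adE (powD n p t c)) :=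
    { d₃.sub (isDer_powD h2 k0 c) with
      partials := fun i => by
        rw [LinearMap.sub_apply, hD₃, LieAlgebra.ad_apply, lie_powD_of_lie_D, sub_zero]
        intro j
        rw [lie_D_D, lie_zero]
      torus := fun i k => by
        rw [LinearMap.sub_apply, hh₃, LieAlgebra.ad_apply, lie_powD_of_lie_D, sub_zero]
        intro j
        rw [lie_D_hfld]
        split_ifs
        · exact lie_D_D _ _
        · exact lie_zero _
      roots := fun a ha k l hkl => by
        rw [LinearMap.sub_apply, e₄ a ha k l hkl, LieAlgebra.ad_apply, sub_self] }
  obtain ⟨d, e₅⟩ := hφ₄.exists_ad_pfld hp hm hn ht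
  have hw₅ : d • ∑ r, gfld F m r ∈ evenW F n p t :=
    Submodule.smul_mem _ _ (sum_mem fun r _ => gfld_mem_evenW h2 r)
  have hsum : φ - adE (w₁ + w₂ + w₃ + d • ∑ r, gfld F m r) - adE (powD n p t c)
      = φ - adE w₁ - adE w₂ - adE w₃ - adE (powD n p t c) - adE (d • ∑ r, gfld F m r) := by
    rw [adE, map_add, map_add, map_add]
    abel
  refine ⟨w₁ + w₂ + w₃ + d • ∑ r, gfld F m r, add_mem (add_mem (add_mem hw₁ hw₂) hw₃) hw₅, c, ?_⟩
  rw [hsum]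
  exact
    { hφ₄.toIsDer.sub (isDer_ad h2 hw₅) with
      partials := fun i => by
        rw [LinearMap.sub_apply, hφ₄.partials, LieAlgebra.ad_apply, smul_lie_end, sum_lie,
          Finset.sum_eq_zero, smul_zero, sub_zero]
        intro r _
        rw [← lie_skew, lie_gfld_D, neg_zero]
      torus := fun i k => by
        rw [LinearMap.sub_apply, hφ₄.torus, LieAlgebra.ad_apply, smul_lie_end, sum_lie,
          Finset.sum_eq_zero, smul_zero, sub_zero]
        intro r _
        exact lie_gfld_hfld h2 r i k
      roots := fun a ha k l hkl => by
        rw [LinearMap.sub_apply, hφ₄.roots a ha k l hkl, LieAlgebra.ad_apply, smul_lie_end, sum_lie]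
        simp only [lie_gfld_gen_fld h2, sub_smul_end, Finset.sum_sub_distrib, ite_smul, one_smul,
          zero_smul, Finset.sum_ite_eq', Finset.mem_univ, if_true, sub_self, smul_zero]
      pairs := fun k l i => by
        rw [LinearMap.sub_apply, e₅, LieAlgebra.ad_apply, sub_self] }

namespace KillsGens

theorem lie_eq_zero (hφ : KillsGens n p t φ) {y z : Module.End F (SuperAlg F m n)}
    (hy : y ∈ evenS F n p t) (hz : z ∈ evenS F n p t) (hy0 : φ y = 0) (hz0 : φ z = 0) :
    φ ⁅y, z⁆ = 0 := by
  rw [hφ.leib y hy z hz, hy0, hz0, zero_lie, lie_zero, add_zero]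

/-- The derivation vanishes on the fields `(a w) D_s` with odd `w`, and on the fields
`(a w) D_i + (∂_i a) w x_s D_s` with even `w ≠ 1`, where the monomial `w` does not involve `x_s`. -/
theorem apply_word (hφ : KillsGens n p t φ) (hp : 3 < p) (hm : 3 ≤ m) (hn : 3 ≤ n)
    (ht : ∀ i, 1 ≤ t i) (l : List (Fin n)) :
    (Odd l.length → ∀ s, s ∉ l → ∀ a ∈ tr p t, φ (fld (a ⊗ₜ word F l) (.inr s)) = 0) ∧
    (Even l.length → l ≠ [] → ∀ s, s ∉ l → ∀ i : Fin m, ∀ a ∈ tr p t,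
      φ (zfld a (word F l) i s) = 0) := by
  have h2 : (2 : F) ≠ 0 := two_ne_zero_of_char p hp
  have hpp := (Fact.out : p.Prime)
  let i0 : Fin m := ⟨0, by omega⟩
  induction l with
  | nil => exact ⟨fun h => absurd h (by simp), fun _ h => absurd rfl h⟩
  | cons k l ih =>
    constructor
    · intro hodd s hs a ha
      rw [List.length_cons, Nat.odd_add_one, Nat.not_odd_iff_even] at hodd
      obtain ⟨hsk, hsl⟩ := not_or.1 (List.mem_cons.not.1 hs)
      by_cases hl : l = []
      · rw [hl, word_cons, word_nil, mul_one]
        exact hφ.roots a ha k s (Ne.symm hsk)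
      have hw := inv_word_of_even (F := F) hodd
      have hds := dgen_word (F := F) hsl
      have hA := ih.2 hodd hl s hsl i0
      rw [word_cons, gen_mul, hw]
      refine tr_induction (LinearMap.ker (φ ∘ₗ fldMap (word F l * gen F k) (.inr s)))
        (fun α hα => ?_) ha
      change φ (fld (mono F α ⊗ₜ (word F l * gen F k)) (.inr s)) = 0
      by_cases hlt : α i0 + 1 ≤ p ^ t i0 - 1
      · have hb : mono F (α + Pi.single i0 1) ∈ tr p t := mono_mem_tr fun j => by
          by_cases hj : j = i0
          · subst hj; simpa using hlt
          · simpa [hj] using hα j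
        have e := lie_one_fld_gen (b := mono F (α + Pi.single i0 1)) h2 i0 k hw hds
        rw [partialHom_mono, if_neg (by simp), add_single_sub] at e
        rw [← e, ← zfld_one_eq i0 s]
        exact hφ.lie_eq_zero (zfld_mem h2 (one_mem_tr p t) i0 hw hds)
          (gen_fld_mem h2 i0 hb (Ne.symm hsk)) (hA 1 (one_mem_tr p t)) (hφ.roots _ hb k s (Ne.symm hsk))
      · -- Here `α_i = p^(t_i) - 1`, so that `1 - α_i = 2` in `F`.
        have hαi : α i0 + 1 = p ^ t i0 := by
          have := hα i0
          have : 0 < p ^ t i0 := pow_pos hpp.pos _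
          omega
        have hcast : (α i0 : F) = -1 := by
          have : ((α i0 + 1 : ℕ) : F) = 0 := by
            rw [hαi, Nat.cast_pow, CharP.cast_eq_zero, zero_pow (by have := ht i0; omega)]
          rw [Nat.cast_add, Nat.cast_one] at this
          exact eq_neg_of_add_eq_zero_left this
        have e := lie_zfld_var_gen (a := mono F α) h2 i0 hsk hw hds
        rw [var_mul_partial, hcast, neg_one_smul, sub_neg_eq_add, ← two_smul F,
          ← TensorProduct.smul_tmul', fld_smul] at e
        have hv := var_mem_tr (F := F) (p := p) ht i0
        have e' := hφ.lie_eq_zero (zfld_mem h2 (mono_mem_tr hα) i0 hw hds)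
          (gen_fld_mem h2 i0 hv (Ne.symm hsk)) (hA _ (mono_mem_tr hα))
          (hφ.roots _ hv k s (Ne.symm hsk))
        rw [e, map_smul] at e'
        exact (smul_eq_zero.1 e').resolve_left h2
    · intro heven _ s hs i a ha
      rw [List.length_cons, Nat.even_add_one, Nat.not_even_iff_odd] at heven
      obtain ⟨hsk, hsl⟩ := not_or.1 (List.mem_cons.not.1 hs)
      have hw := inv_word_of_odd (F := F) heven
      rw [word_cons, gen_mul, hw, neg_mul, zfld_neg, map_neg, ← lie_fld_gen_mul_gen h2 i hsk hw,
        neg_eq_zero]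
      exact hφ.lie_eq_zero (bfld_mem h2 i ha hw (dgen_word hsl)) (pfld_mem h2 hn s k i)
        (ih.1 heven s hsl a ha) (hφ.pairs s k i)

/-- The only weights for which the value at `x^(α) D_i + x^(α - ε_i) x_s D_s` may be non-zero. -/
theorem zfld_weight (hφ : KillsGens n p t φ) (hp : 3 < p) (hm : 3 ≤ m) (hn : 3 ≤ n)
    (ht : ∀ i, 1 ≤ t i) {α : Fin m → ℕ} (hα : ∀ i, α i ≤ p ^ t i - 1) (i : Fin m) (s : Fin n)
    (h : ∀ j, φ (zfld (partialHom j (mono F α)) 1 i s) = 0) :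
    φ (zfld (mono F α) 1 i s) = 0 ∨ ∃ j : Fin m, ∀ q : Fin m,
      (α q : F) - (if q = i then 1 else 0) + (if j = q then 1 else 0) = 1 := by
  have h2 : (2 : F) ≠ 0 := two_ne_zero_of_char p hp
  obtain ⟨k, hks, -⟩ := Fin.exists_ne_and_ne_of_two_lt s s (by omega)
  obtain ⟨l, hls, hlk⟩ := Fin.exists_ne_and_ne_of_two_lt s k (by omega)
  have ha := mono_mem_tr (F := F) hα
  have hy := zfld_mem (n := n) h2 ha i (s := s) (map_one _) (dgen_one s)
  have hE := hφ.mem _ hy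
  have hC : ConstCoef (φ (zfld (mono F α) 1 i s)) := by
    intro j
    rw [← hφ.toIsDer.lie_D h2 hφ.partials s j hy, lie_D_zfld, h]
  obtain ⟨⟨c, hc⟩, htop⟩ := cc_of_lie_gen_fld ht (by omega) hE hC fun b hb k l hkl =>
    hφ.lie_zfld h2 ha hb i s hkl
  have hpair : ⁅φ (zfld (mono F α) 1 i s), fld (1 ⊗ₜ (gen F k * gen F l)) (.inl i)⁆ = 0 := by
    have e := hφ.leib _ hy _ (pfld_mem h2 hn k l i)
    rw [hφ.pairs, lie_zero, add_zero, pfld, lie_zfld_gen_mul_gen h2 i i hks.symm hls.symm,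
      map_neg] at e
    have e' := (hφ.apply_word hp hm hn ht [k, l]).2 (by simp) (by simp) s
      (by simp [hks.symm, hls.symm]) i _ (partial_mem_tr ha i)
    rw [word_cons, word_cons, word_nil, mul_one] at e'
    rw [← e, e', neg_zero]
  by_cases hz : ∀ j, cc (φ (zfld (mono F α) 1 i s)) (.inl j) = 0
  · left
    refine eq_zero_of_cc hE hC fun r => ?_
    cases r with
    | inl j => exact hz j
    | inr k' => exact cc_inr_eq_zero h2 hE hC hc hlk.symm hpair k'
  · right
    push Not at hz
    obtain ⟨j, hj⟩ := hz
    refine ⟨j, fun q => weight_of_cc_inl (k := s) hE hC (htop j s) hj ?_⟩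
    rw [← hφ.toIsDer.lie_hfld h2 ht hφ.torus q s hy, lie_hfld_zfld h2, map_smul]

theorem apply_zfld_single (hφ : KillsGens n p t φ) (hp : 3 < p) (hm : 3 ≤ m) (hn : 3 ≤ n)
    (ht : ∀ i, 1 ≤ t i) (i : Fin m) (s : Fin n) {N : ℕ} (hN : N ≤ p ^ t i - 1) :
    φ (zfld (mono F (Pi.single i N)) 1 i s) = 0 := by
  induction N with
  | zero => rw [Pi.single_zero, mono_zero, ← D_eq_zfld]; exact hφ.partials i
  | succ N ih =>
    have hle : ∀ j, (Pi.single i (N + 1) : Fin m → ℕ) j ≤ p ^ t j - 1 := by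
      intro j
      by_cases hj : j = i
      · subst hj; simpa using hN
      · simp [hj]
    have hpar : ∀ j, φ (zfld (partialHom j (mono F (Pi.single i (N + 1)))) 1 i s) = 0 := by
      intro j
      by_cases hj : j = i
      · subst hj
        have : (Pi.single j (N + 1) - Pi.single j 1 : Fin m → ℕ) = Pi.single j N := by
          rw [Pi.single_add, add_single_sub]
        rw [partialHom_mono, if_neg (by simp), this]
        exact ih (by omega)
      · have : zfld (0 : DividedPower F m) 1 i s = 0 := by simp [zfld]
        rw [partialHom_mono, if_pos (by simp [hj]), this, map_zero]
    rcases hφ.zfld_weight hp hm hn ht hle i s hpar with h | ⟨j, hj⟩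
    · exact h
    · obtain ⟨q, hqi, hqj⟩ := Fin.exists_ne_and_ne_of_two_lt i j (by omega)
      have := hj q
      simp [hqi, hqj.symm] at this

theorem apply_zfld_one (hφ : KillsGens n p t φ) (hp : 3 < p) (hm : 3 ≤ m) (hn : 3 ≤ n)
    (ht : ∀ i, 1 ≤ t i) (i : Fin m) (s : Fin n) {a : DividedPower F m} (ha : a ∈ tr p t) :
    φ (zfld a 1 i s) = 0 := by
  have h2 : (2 : F) ≠ 0 := two_ne_zero_of_char p hp
  have h3 : (3 : F) ≠ 0 := three_ne_zero_of_char p hp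
  have hpp := (Fact.out : p.Prime)
  refine tr_induction (LinearMap.ker (φ ∘ₗ zfldMap 1 i s)) (fun α hα => ?_) ha
  change φ (zfld (mono F α) 1 i s) = 0
  obtain ⟨N, hN⟩ : ∃ N, ∑ j, α j = N := ⟨_, rfl⟩
  induction N using Nat.strong_induction_on generalizing α with
  | _ N ih =>
    have hsub : ∀ j, α j ≠ 0 → ∑ q, (α - Pi.single j 1 : Fin m → ℕ) q < N := by
      intro j hj
      rw [← hN]
      refine Finset.sum_lt_sum (fun q _ => Nat.sub_le _ _) ⟨j, Finset.mem_univ _, ?_⟩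
      simp; omega
    have hpar : ∀ j, φ (zfld (partialHom j (mono F α)) 1 i s) = 0 := by
      intro j
      rw [partialHom_mono]
      split_ifs with h0
      · have : zfld (0 : DividedPower F m) 1 i s = 0 := by simp [zfld]
        rw [this, map_zero]
      · exact ih _ (hsub j h0) _ (fun q => (Nat.sub_le _ _).trans (hα q)) rfl
    rcases hφ.zfld_weight hp hm hn ht hα i s hpar with h | ⟨j, hj⟩
    · exact h
    · have hαi : (α i : F) = 1 ∨ (α i : F) = 2 := by
        have := hj i
        rw [if_pos rfl] at this
        split_ifs at this
        · left; linear_combination this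
        · right; linear_combination this
      have hi0 : α i ≠ 0 := by
        intro h0
        rw [h0, Nat.cast_zero] at hαi
        rcases hαi with h | h
        · exact zero_ne_one h
        · exact h2 h.symm
      have hlt : α i + 1 ≤ p ^ t i - 1 := by
        by_contra hle
        have h1 := hα i
        have hpos : 0 < p ^ t i := pow_pos hpp.pos _
        have : ((α i + 1 : ℕ) : F) = 0 := by
          have e : α i + 1 = p ^ t i := by omega
          rw [e, Nat.cast_pow, CharP.cast_eq_zero, zero_pow (by have := ht i; omega)]
        rw [Nat.cast_add, Nat.cast_one] at this
        rcases hαi with h | h <;> rw [h] at this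
        · exact h2 (by linear_combination this)
        · exact h3 (by linear_combination this)
      have hb : partialHom i (mono F (Function.update α i 0)) = 0 := by
        rw [partialHom_mono, if_pos (by simp)]
      have hc : mono F (Pi.single i (α i + 1)) ∈ tr p t := mono_mem_tr fun q => by
        by_cases hq : q = i
        · subst hq; simpa using hlt
        · simp [hq]
      have e := lie_zfld_zfld (n := n) (c := mono F (Pi.single i (α i + 1))) h2 i s hb
      have e1 : (Pi.single i (α i + 1) - Pi.single i 1 : Fin m → ℕ) = Pi.single i (α i) := by
        rw [Pi.single_add, add_single_sub]
      rw [partialHom_mono, if_neg (by simp), e1, mul_comm, ← mono_eq_single_mul] at e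
      rw [← e]
      refine hφ.lie_eq_zero (zfld_mem h2 (mono_mem_tr (update_le hα i)) i (map_one _) (dgen_one s))
        (zfld_mem h2 hc i (map_one _) (dgen_one s)) ?_ (hφ.apply_zfld_single hp hm hn ht i s hlt)
      refine ih _ ?_ _ (update_le hα i) rfl
      rw [← hN]
      refine Finset.sum_lt_sum (fun q _ => ?_) ⟨i, Finset.mem_univ _, ?_⟩
      · by_cases hq : q = i
        · subst hq; simp
        · simp [hq]
      · simp; omega

end KillsGens
end SuperAlg

namespace SuperAlg

open DividedPower

variable {F : Type*} [Field F] {m n p : ℕ} {t : Fin m → ℕ}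
  {φ : Module.End F (Module.End F (SuperAlg F m n))}

/-- Conjugation of `D_rs(f)` with the parity automorphism. -/
theorem parity_Drs (r s : Fin m ⊕ Fin n) (f g : SuperAlg F m n) :
    parity F m n (Drs r s f (parity F m n g))
      = (-1 : F) ^ (tau r + tau s) • Drs r s (parity F m n f) g := by
  have hfld : ∀ (f : SuperAlg F m n) (s : Fin m ⊕ Fin n), parity F m n (fld f s (parity F m n g))
      = (-1 : F) ^ tau s • fld (parity F m n f) s g := by
    intro f s
    rw [fld_apply, fld_apply, map_mul, parity_D, parity_parity, mul_smul_comm]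
  have hsgn : ∀ e, parity F m n (sgn e f) = sgn e (parity F m n f) := by
    intro e
    change parity F m n (((parity F m n).toLinearMap ^ e) f) = ((parity F m n).toLinearMap ^ e) _
    exact LinearMap.congr_fun (pow_succ' (parity F m n).toLinearMap e |>.symm.trans
      (pow_succ (parity F m n).toLinearMap e)) f
  rw [Drs_eq, Drs_eq]
  simp only [LinearMap.sub_apply, LinearMap.smul_apply, map_sub, map_smul, hfld, parity_D, hsgn,
    fld_smul, smul_smul, smul_sub]
  congr 2
  · ring
  · ring

variable [Fact p.Prime] [CharP F p]

namespace KillsGens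

theorem apply_fld_inr (hφ : KillsGens n p t φ) (hp : 3 < p) (hm : 3 ≤ m) (hn : 3 ≤ n)
    (ht : ∀ i, 1 ≤ t i) {s : Fin n} {v : ExteriorAlgebra F (Fin n → F)} (hv : inv F n v = -v)
    (hs : dgen F s v = 0) {a : DividedPower F m} (ha : a ∈ tr p t) :
    φ (fld (a ⊗ₜ v) (.inr s)) = 0 := by
  have h2 : (2 : F) ≠ 0 := two_ne_zero_of_char p hp
  have hspan := mem_span_word_of_dgen
    (mem_span_word_of_inv h2 (mem_span_image_univ v) 1 (by simpa using hv)) hs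
  clear hv hs
  induction hspan using Submodule.span_induction with
  | zero => simp
  | add u v _ _ hu hv => rw [TensorProduct.tmul_add, fld_add, map_add, hu, hv, add_zero]
  | smul c u _ hu => rw [TensorProduct.tmul_smul, fld_smul, map_smul, hu, smul_zero]
  | mem u hu =>
    obtain ⟨l, ⟨⟨-, hl⟩, hsl⟩, rfl⟩ := hu
    exact (hφ.apply_word hp hm hn ht l).1 (by simpa [Nat.even_add_one] using hl) s hsl a ha

theorem apply_zfld (hφ : KillsGens n p t φ) (hp : 3 < p) (hm : 3 ≤ m) (hn : 3 ≤ n)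
    (ht : ∀ i, 1 ≤ t i) (i : Fin m) {s : Fin n} {w : ExteriorAlgebra F (Fin n → F)}
    (hw : inv F n w = w) (hs : dgen F s w = 0) {a : DividedPower F m} (ha : a ∈ tr p t) :
    φ (zfld a w i s) = 0 := by
  have h2 : (2 : F) ≠ 0 := two_ne_zero_of_char p hp
  have hspan := mem_span_word_of_dgen
    (mem_span_word_of_inv h2 (mem_span_image_univ w) 0 (by simpa using hw)) hs
  clear hw hs
  have hadd : ∀ u v, zfld a (u + v) i s = zfld a u i s + zfld a v i s := by
    intro u v
    simp only [zfld, add_mul, TensorProduct.tmul_add, fld_add]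
    abel
  have hsmul : ∀ (c : F) u, zfld a (c • u) i s = c • zfld a u i s := by
    intro c u
    simp only [zfld, smul_mul_assoc, TensorProduct.tmul_smul, fld_smul, smul_add]
  induction hspan using Submodule.span_induction with
  | zero => simp [zfld]
  | add u v _ _ hu hv => rw [hadd, map_add, hu, hv, add_zero]
  | smul c u _ hu => rw [hsmul, map_smul, hu, smul_zero]
  | mem u hu =>
    obtain ⟨l, ⟨⟨-, hl⟩, hsl⟩, rfl⟩ := hu
    by_cases h : l = []
    · subst h; exact hφ.apply_zfld_one hp hm hn ht i s ha
    · exact (hφ.apply_word hp hm hn ht l).2 (by simpa using hl) h s hsl i a ha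

theorem apply_inr_inr (hφ : KillsGens n p t φ) (hp : 3 < p) (hm : 3 ≤ m) (hn : 3 ≤ n)
    (ht : ∀ i, 1 ≤ t i) (k l : Fin n) {u : ExteriorAlgebra F (Fin n → F)}
    (hu : inv F n u = u) {a : DividedPower F m} (ha : a ∈ tr p t) :
    φ (fld (a ⊗ₜ dgen F k u) (.inr l) + fld (a ⊗ₜ dgen F l u) (.inr k)) = 0 := by
  have h2 : (2 : F) ≠ 0 := two_ne_zero_of_char p hp
  have hodd : ∀ k, inv F n (dgen F k u) = -dgen F k u := fun k => by rw [inv_dgen, hu]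
  by_cases hkl : k = l
  · subst hkl
    rw [map_add, hφ.apply_fld_inr hp hm hn ht (hodd k) (dgen_dgen k u) ha, add_zero]
  obtain ⟨w, hw⟩ : ∃ w, w = dgen F l (dgen F k u) := ⟨_, rfl⟩
  have hwe : inv F n w = w := by rw [hw, inv_dgen, hodd, map_neg, neg_neg]
  have hlw : dgen F l w = 0 := by rw [hw, dgen_dgen]
  have hkw : dgen F k w = 0 := by rw [hw, dgen_comm l k, map_neg, dgen_dgen, neg_zero]
  have hgw : ∀ k, inv F n (gen F k * w) = -(gen F k * w) := fun k => by
    rw [map_mul, hwe, inv_gen, neg_mul]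
  have e1 := hφ.apply_fld_inr hp hm hn ht (s := l) (v := dgen F k u - gen F l * w)
    (by rw [map_sub, hodd, hgw]; abel)
    (by rw [map_sub, dgen_self_gen_mul, hlw, ← hw, mul_zero, sub_zero, sub_self]) ha
  have e2 := hφ.apply_fld_inr hp hm hn ht (s := k) (v := dgen F l u + gen F k * w)
    (by rw [map_add, hodd, hgw]; abel)
    (by rw [map_add, dgen_self_gen_mul, hkw, mul_zero, sub_zero, dgen_comm, ← hw, neg_add_cancel]) ha
  have hz : dgen F l (gen F k * w) = 0 := by
    rw [dgen_ne_gen_mul (Ne.symm hkl), hlw, mul_zero, neg_zero]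
  have e3 := hφ.lie_eq_zero (bfld_mem h2 ⟨0, by omega⟩ (one_mem_tr p t) (hgw k) hz)
    (gen_fld_mem h2 ⟨0, by omega⟩ ha (Ne.symm hkl))
    (hφ.apply_fld_inr hp hm hn ht (hgw k) hz (one_mem_tr p t)) (hφ.roots a ha l k (Ne.symm hkl))
  rw [lie_gen_mul_fld h2 k l hwe hkw] at e3
  rw [TensorProduct.tmul_sub, fld_sub, map_sub] at e1
  rw [TensorProduct.tmul_add, fld_add, map_add] at e2
  rw [map_sub] at e3
  have key : ∀ A B C D : Module.End F (SuperAlg F m n), A - B = 0 → C + D = 0 → D - B = 0 →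
      A + C = 0 := by
    intro A B C D h1 h2 h3
    rw [sub_eq_zero.1 h1, ← sub_eq_zero.1 h3, add_comm, h2]
  rw [map_add]
  exact key _ _ _ _ e1 e2 e3

theorem apply_inl_inr (hφ : KillsGens n p t φ) (hp : 3 < p) (hm : 3 ≤ m) (hn : 3 ≤ n)
    (ht : ∀ i, 1 ≤ t i) (i : Fin m) (k : Fin n) {u : ExteriorAlgebra F (Fin n → F)}
    (hu : inv F n u = -u) {a : DividedPower F m} (ha : a ∈ tr p t) :
    φ (fld (a ⊗ₜ dgen F k u) (.inl i) + fld (partialHom i a ⊗ₜ u) (.inr k)) = 0 := by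
  have hw : inv F n (dgen F k u) = dgen F k u := by rw [inv_dgen, hu, map_neg, neg_neg]
  have e1 := hφ.apply_zfld hp hm hn ht i hw (dgen_dgen k u) ha
  have e2 := hφ.apply_fld_inr hp hm hn ht (s := k) (v := u - dgen F k u * gen F k)
    (by rw [map_sub, hu, inv_mul_gen hw]; abel)
    (by rw [map_sub, dgen_mul_gen hw (dgen_dgen k u), sub_self]) (partial_mem_tr ha i)
  have : fld (a ⊗ₜ dgen F k u) (.inl i) + fld (partialHom i a ⊗ₜ u) (.inr k)
      = zfld a (dgen F k u) i k
        + fld (partialHom i a ⊗ₜ (u - dgen F k u * gen F k)) (.inr k) := by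
    rw [zfld, TensorProduct.tmul_sub, fld_sub]
    abel
  rw [this, map_add, e1, e2, add_zero]

theorem apply_inl_inl (hφ : KillsGens n p t φ) (hp : 3 < p) (hm : 3 ≤ m) (hn : 3 ≤ n)
    (ht : ∀ i, 1 ≤ t i) (i j : Fin m) {l : List (Fin n)} (hl : Even l.length) {α : Fin m → ℕ}
    (hα : ∀ i, α i ≤ p ^ t i - 1) :
    φ (fld (partialHom i (mono F α) ⊗ₜ word F l) (.inl j)
      - fld (partialHom j (mono F α) ⊗ₜ word F l) (.inl i)) = 0 := by
  have h2 : (2 : F) ≠ 0 := two_ne_zero_of_char p hp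
  by_cases hij : i = j
  · rw [hij, sub_self, map_zero]
  -- The word is a product of two even factors, each of which misses one of the odd variables.
  obtain ⟨w₁, w₂, s₁, s₂, hw₁, hs₁, hw₂, hs₂, hw⟩ : ∃ (w₁ w₂ : ExteriorAlgebra F (Fin n → F))
      (s₁ s₂ : Fin n), inv F n w₁ = w₁ ∧ dgen F s₁ w₁ = 0 ∧ inv F n w₂ = w₂ ∧ dgen F s₂ w₂ = 0 ∧
        word F l = w₁ * w₂ ∧ word F l = w₂ * w₁ := by
    match l, hl with
    | [], _ => exact ⟨1, 1, ⟨0, by omega⟩, ⟨0, by omega⟩, map_one _, dgen_one _, map_one _,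
        dgen_one _, by simp⟩
    | [k], hl => exact absurd hl (by simp)
    | k :: k' :: l, hl =>
      obtain ⟨s, hsk, hsk'⟩ := Fin.exists_ne_and_ne_of_two_lt k k' (by omega)
      by_cases hk : k ∈ l
      · refine ⟨1, 0, s, s, map_one _, dgen_one _, map_zero _, map_zero _, ?_⟩
        rw [word_cons, word_cons, gen_mul_left_anticomm, gen_mul_word hk]
        simp
      · have hl' : Even l.length := by simpa [Nat.even_add_one] using hl
        refine ⟨gen F k * gen F k', word F l, s, k, inv_gen_mul_gen k k',
          dgen_gen_mul_gen_ne hsk hsk', inv_word_of_even hl', dgen_word hk, ?_, ?_⟩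
        · rw [word_cons, word_cons, mul_assoc]
        · rw [word_cons, word_cons, gen_mul k', inv_word_of_even hl', ← mul_assoc, gen_mul k,
            inv_word_of_even hl', mul_assoc]
  obtain ⟨hw, hw'⟩ := hw
  have hb : mono F (Pi.single j (α j)) ∈ tr p t := mono_mem_tr (single_le hα le_rfl)
  have hc : mono F (Function.update α j 0) ∈ tr p t := mono_mem_tr (update_le hα j)
  have hb0 : partialHom i (mono F (Pi.single j (α j))) = 0 := by
    rw [partialHom_mono, if_pos (by simp [hij])]
  have hc0 : partialHom j (mono F (Function.update α j 0)) = 0 := by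
    rw [partialHom_mono, if_pos (by simp)]
  have hz : ∀ {b : DividedPower F m} {i : Fin m}, partialHom i b = 0 →
      ∀ (w : ExteriorAlgebra F (Fin n → F)) (s : Fin n), zfld b w i s = fld (b ⊗ₜ w) (.inl i) := by
    intro b i hb w s
    rw [zfld, hb, TensorProduct.zero_tmul, fld_zero, add_zero]
  have e := hφ.lie_eq_zero (zfld_mem h2 hb i hw₁ hs₁) (zfld_mem h2 hc j hw₂ hs₂)
    (hφ.apply_zfld hp hm hn ht i hw₁ hs₁ hb) (hφ.apply_zfld hp hm hn ht j hw₂ hs₂ hc)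
  rw [hz hb0, hz hc0, lie_inl_inl h2 i j hw₁ hw₂, ← hw, ← hw'] at e
  rw [mono_eq_single_mul α j, partialHom_mul, partialHom_mul, hb0, hc0, zero_mul, zero_add,
    mul_zero, add_zero, mul_comm (partialHom j _)]
  exact e

theorem apply_Drs (hφ : KillsGens n p t φ) (hp : 3 < p) (hm : 3 ≤ m) (hn : 3 ≤ n)
    (ht : ∀ i, 1 ≤ t i) (r s : Fin m ⊕ Fin n) {l : List (Fin n)}
    (hl : Even (l.length + (tau r + tau s))) {α : Fin m → ℕ} (hα : ∀ i, α i ≤ p ^ t i - 1) :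
    φ (Drs r s (mono F α ⊗ₜ word F l)) = 0 := by
  have ha := mono_mem_tr (F := F) hα
  have hpar := parity_tmul (mono F α) (word F l)
  change _ = mono F α ⊗ₜ inv F n (word F l) at hpar
  rw [Drs_eq]
  cases r with
  | inl i =>
    cases s with
    | inl j =>
      simp only [tau, add_zero] at hl
      simp only [tau, mul_zero, pow_zero, one_smul, add_zero, sgn_zero, D_inl]
      exact hφ.apply_inl_inl hp hm hn ht i j hl hα
    | inr k =>
      have hu := inv_word_of_odd (F := F) (l := l) (by simpa [tau, Nat.even_add_one] using hl)
      rw [hu] at hpar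
      simp only [tau, zero_mul, pow_zero, one_smul, zero_add, sgn_one, hpar, D_inl, D_inr_tmul,
        map_neg, TensorProduct.tmul_neg, fld_neg, sub_neg_eq_add]
      rw [add_comm]
      exact hφ.apply_inl_inr hp hm hn ht i k hu ha
  | inr k =>
    cases s with
    | inl i =>
      have hu := inv_word_of_odd (F := F) (l := l) (by simpa [tau, Nat.even_add_one] using hl)
      rw [hu] at hpar
      simp only [tau, mul_zero, pow_zero, one_smul, add_zero, sgn_one, hpar, D_inl, D_inr_tmul,
        map_neg, TensorProduct.tmul_neg, fld_neg, sub_neg_eq_add]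
      exact hφ.apply_inl_inr hp hm hn ht i k hu ha
    | inr k' =>
      have hu := inv_word_of_even (F := F) (l := l) (by simpa [tau, Nat.even_add_one] using hl)
      simp only [tau, mul_one, pow_one, Nat.reduceAdd, sgn_two, D_inr_tmul]
      have e := hφ.apply_inr_inr hp hm hn ht k k' hu ha
      rw [map_add] at e
      rw [map_sub, map_smul]
      exact sub_eq_zero.2 ((neg_one_smul (R := F) (M := Module.End F (SuperAlg F m n)) _).trans
        (neg_eq_of_add_eq_zero_right e))

/-- A derivation that kills the generators is zero. -/
theorem eq_zero (hφ : KillsGens n p t φ) (hp : 3 < p) (hm : 3 ≤ m) (hn : 3 ≤ n)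
    (ht : ∀ i, 1 ≤ t i) {y : Module.End F (SuperAlg F m n)} (hy : y ∈ evenS F n p t) : φ y = 0 := by
  have h2 : (2 : F) ≠ 0 := two_ne_zero_of_char p hp
  -- The projection of `D_rs(f)` to its even part amounts to a projection of `f`.
  let σ : Module.End F (SuperAlg F m n) := (parity F m n).toLinearMap
  let P : Module.End F (Module.End F (SuperAlg F m n)) :=
    LinearMap.id + LinearMap.mulLeft F σ ∘ₗ LinearMap.mulRight F σ
  have hPy : P y = (2 : F) • y := by
    rw [two_smul]
    change y + σ * (y * σ) = y + y
    congr 1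
    refine LinearMap.ext fun f => ?_
    change parity F m n (y (parity F m n f)) = y f
    rw [evenW_parity (evenS_le_evenW hy), parity_parity]
  have hPD : ∀ r s f, P (Drs r s f)
      = Drs r s (f + (-1 : F) ^ (tau r + tau s) • parity F m n f) := by
    intro r s f
    refine LinearMap.ext fun g => ?_
    change Drs r s f g + parity F m n (Drs r s f (parity F m n g)) = _
    rw [parity_Drs, Drs_eq, Drs_eq, Drs_eq]
    simp only [map_add, map_smul, fld_add, fld_smul, LinearMap.sub_apply, LinearMap.add_apply,
      LinearMap.smul_apply, smul_add, smul_sub]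
    rw [smul_comm ((-1 : F) ^ (tau r + tau s))]
    abel
  have key : S F n p t ≤ LinearMap.ker (φ ∘ₗ P) := by
    refine Submodule.span_le.2 ?_
    rintro _ ⟨r, s, f, hf, rfl⟩
    change φ (P (Drs r s f)) = 0
    rw [hPD]
    induction hf using Submodule.span_induction with
    | zero => simp [Drs_eq]
    | add f g _ _ hf hg =>
      rw [← hPD] at hf hg ⊢
      have : Drs r s (f + g) = Drs r s f + Drs r s g := by
        simp only [Drs_eq, map_add, fld_add, smul_add]
        abel
      rw [this, map_add, map_add, hf, hg, add_zero]
    | smul c f _ hf =>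
      rw [← hPD] at hf ⊢
      have : Drs r s (c • f) = c • Drs r s f := by
        simp only [Drs_eq, map_smul, fld_smul, smul_sub]
        rw [smul_comm c]
      rw [this, map_smul, map_smul, hf, smul_zero]
    | mem f hf =>
      obtain ⟨α, hα, u, rfl⟩ := hf
      have hu : u ∈ Submodule.span F (Set.range (word F : List (Fin n) → _)) := by
        rw [span_word]; trivial
      induction hu using Submodule.span_induction with
      | zero => simp [Drs_eq]
      | add u v _ _ hu hv =>
        rw [← hPD] at hu hv ⊢
        have : Drs r s (mono F α ⊗ₜ (u + v)) = Drs r s (mono F α ⊗ₜ u) + Drs r s (mono F α ⊗ₜ v) := by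
          simp only [Drs_eq, TensorProduct.tmul_add, map_add, fld_add, smul_add]
          abel
        rw [this, map_add, map_add, hu, hv, add_zero]
      | smul c u _ hu =>
        rw [← hPD] at hu ⊢
        have : Drs r s (mono F α ⊗ₜ (c • u)) = c • Drs r s (mono F α ⊗ₜ u) := by
          simp only [Drs_eq, TensorProduct.tmul_smul, map_smul, fld_smul, smul_sub]
          rw [smul_comm c]
        rw [this, map_smul, map_smul, hu, smul_zero]
      | mem u hu =>
        obtain ⟨l, rfl⟩ := hu
        have hpar := parity_tmul (mono F α) (word F l)
        change _ = mono F α ⊗ₜ inv F n (word F l) at hpar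
        rw [hpar, inv_word, TensorProduct.tmul_smul, smul_smul, ← pow_add, add_comm (tau r + tau s)]
        rcases Nat.even_or_odd (l.length + (tau r + tau s)) with h | h
        · rw [h.neg_one_pow, one_smul]
          have : Drs r s (mono F α ⊗ₜ word F l + mono F α ⊗ₜ word F l)
              = Drs r s (mono F α ⊗ₜ word F l) + Drs r s (mono F α ⊗ₜ word F l) := by
            simp only [Drs_eq, map_add, fld_add, smul_add]
            abel
          rw [this, map_add, hφ.apply_Drs hp hm hn ht r s h hα, add_zero]
        · rw [h.neg_one_pow, neg_one_smul, add_neg_cancel]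
          simp [Drs_eq]
  have e := key hy.1
  change φ (P y) = 0 at e
  rw [hPy, map_smul] at e
  exact (smul_eq_zero.1 e).resolve_left h2

end KillsGens

/-- Each derivation of `𝒮` is of the form `ad E + ∑ c_ir (ad D_i)^(p^r)`. -/
theorem IsDer.exists_eq (hφ : IsDer n p t φ) (hp : 3 < p) (hm : 3 ≤ m) (hn : 3 ≤ n)
    (ht : ∀ i, 1 ≤ t i) : ∃ E ∈ evenW F n p t, ∃ c : Fin m → ℕ → F, ∀ y ∈ evenS F n p t,
      φ y = ⁅E, y⁆ + ⁅powD n p t c, y⁆ := by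
  obtain ⟨E, hE, c, h⟩ := hφ.exists_killsGens hp hm hn ht
  refine ⟨E, hE, c, fun y hy => ?_⟩
  have e := h.eq_zero hp hm hn ht hy
  rw [LinearMap.sub_apply, LinearMap.sub_apply, sub_sub, sub_eq_zero] at e
  exact e

end SuperAlg

/-! ### The torus and the normalizer of `𝒮` -/

namespace SuperAlg

open DividedPower

variable {F : Type*} [Field F] {m n p : ℕ} {t : Fin m → ℕ} {E : Module.End F (SuperAlg F m n)}

variable (F) in
/-- The element `x_r D_r` of the canonical torus. -/
def toral (r : Fin m ⊕ Fin n) : Module.End F (SuperAlg F m n) := fld (x F r) r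

theorem toral_mem_torus (r : Fin m ⊕ Fin n) : toral F r ∈ torus F m n :=
  Submodule.subset_span ⟨r, rfl⟩

theorem hfld_eq_toral (i : Fin m) (k : Fin n) :
    hfld F i k = toral F (.inl i) + toral F (.inr k) := rfl

theorem x_mem_trunc [Fact p.Prime] (ht : ∀ i, 1 ≤ t i) (r : Fin m ⊕ Fin n) :
    x F r ∈ trunc F n p t := by
  cases r with
  | inl i => exact tmul_mem_trunc (var_mem_tr ht i) _
  | inr k => exact tmul_mem_trunc (one_mem_tr p t) _

theorem toral_mem_evenW [Fact p.Prime] (ht : ∀ i, 1 ≤ t i) (r : Fin m ⊕ Fin n) :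
    toral F r ∈ evenW F n p t := fld_mem_evenW (x_mem_trunc ht r) (x_mem r)

theorem sgn_x (e : ℕ) (r : Fin m ⊕ Fin n) : sgn e (x F r) = (-1 : F) ^ (e * tau r) • x F r :=
  sgn_of_mem e r (x_mem r)

theorem D_toral (s r : Fin m ⊕ Fin n) (f : SuperAlg F m n) :
    D F s (toral F r f) = toral F r (D F s f) + (if s = r then 1 else 0 : F) • D F s f := by
  rw [toral, fld_apply, fld_apply, D_mul, D_x, sgn_x, D_comm s r, smul_mul_smul_comm,
    neg_one_pow_mul_self, one_smul, add_comm]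
  by_cases h : s = r
  · subst h; simp
  · simp [h]

theorem toral_mul (r : Fin m ⊕ Fin n) (f g : SuperAlg F m n) :
    toral F r (f * g) = toral F r f * g + f * toral F r g :=
  evenW_mul (p := 2) (t := fun _ => 1) (toral_mem_evenW (fun _ => le_rfl) r) f g

theorem sgn_evenW (hE : E ∈ evenW F n p t) (e : ℕ) (f : SuperAlg F m n) :
    sgn e (E f) = E (sgn e f) := by
  induction e generalizing f with
  | zero => rw [sgn_zero, sgn_zero]
  | succ e ih =>
    have h : ∀ f : SuperAlg F m n, sgn (e + 1) f = sgn e (parity F m n f) := fun f =>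
      LinearMap.congr_fun (pow_succ (parity F m n).toLinearMap e) f
    rw [h, h, evenW_parity hE, ih]

theorem sgn_toral (e : ℕ) (r : Fin m ⊕ Fin n) (f : SuperAlg F m n) :
    sgn e (toral F r f) = toral F r (sgn e f) :=
  sgn_evenW (p := 2) (t := fun _ => 1) (toral_mem_evenW (fun _ => le_rfl) r) e f

theorem lie_toral_fld (r s : Fin m ⊕ Fin n) (f : SuperAlg F m n) :
    ⁅toral F r, fld f s⁆ = fld (toral F r f - (if s = r then 1 else 0 : F) • f) s := by
  refine LinearMap.ext fun g => ?_
  rw [lie_apply, fld_apply, fld_apply, fld_apply, toral_mul, D_toral, sub_mul, mul_add,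
    smul_mul_assoc, mul_smul_comm]
  abel

theorem lie_toral_Drs (q r s : Fin m ⊕ Fin n) (f : SuperAlg F m n) :
    ⁅toral F q, Drs r s f⁆
      = Drs r s (toral F q f - ((if r = q then 1 else 0) + (if s = q then 1 else 0) : F) • f) := by
  rw [Drs_eq, Drs_eq, lie_sub, lie_smul_end, lie_toral_fld, lie_toral_fld, map_sub, map_sub, map_sub,
    D_toral, sgn_toral, D_toral, map_smul, map_smul, map_smul, add_smul, add_smul]
  congr 1
  · congr 2; abel
  · congr 1; abel

/-- The torus normalizes `𝒮`. -/
theorem lie_toral_mem [Fact p.Prime] [CharP F p] (h2 : (2 : F) ≠ 0) (ht : ∀ i, 1 ≤ t i) (i : Fin m)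
    (k : Fin n) (q : Fin m ⊕ Fin n) {y : Module.End F (SuperAlg F m n)} (hy : y ∈ evenS F n p t) :
    ⁅toral F q, y⁆ ∈ evenS F n p t := by
  refine ⟨?_, evenW_le_evenEnd h2 i k (lie_mem_evenW h2 (toral_mem_evenW ht q) (evenS_le_evenW hy))⟩
  have key : S F n p t ≤ (S F n p t).comap (adE (toral F q)) := by
    refine Submodule.span_le.2 ?_
    rintro _ ⟨r, s, f, hf, rfl⟩
    change ⁅toral F q, Drs r s f⁆ ∈ S F n p t
    rw [lie_toral_Drs]
    exact Submodule.subset_span ⟨r, s, _, sub_mem (evenW_apply_trunc (toral_mem_evenW ht q) hf)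
      (Submodule.smul_mem _ _ hf), rfl⟩
  exact key hy.1

/-- The divergence-free fields normalize `𝒮`. -/
theorem lie_evenSbar_mem [Fact p.Prime] [CharP F p] (h2 : (2 : F) ≠ 0) (i : Fin m) (k : Fin n)
    (hE : E ∈ evenSbar F n p t) {y : Module.End F (SuperAlg F m n)} (hy : y ∈ evenS F n p t) :
    ⁅E, y⁆ ∈ evenS F n p t := by
  have hEW : E ∈ evenW F n p t := Sbar_inf_evenEnd_le hE
  have hyW := evenS_le_evenW hy
  refine ⟨?_, evenW_le_evenEnd h2 i k (lie_mem_evenW h2 hEW hyW)⟩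
  have hdiv : ∀ {G : Module.End F (SuperAlg F m n)}, G ∈ Sbar F n p t →
      div (fun r => G (x F r)) = 0 := by
    rintro _ ⟨f, ⟨-, hf⟩, rfl⟩
    have : (fun r => vf f (x F r)) = f := funext fun r => vf_x f r
    rw [this]
    exact hf
  rw [hEW.1, hyW.1]
  exact bracket_mem_S p t (fun r => (hEW.2 r).2) (fun r => (hyW.2 r).2) (fun r => (hEW.2 r).1)
    (fun r => (hyW.2 r).1) (hdiv hE.1) (hdiv (S_le_Sbar p t hy.1))

/-- The divergence of a field, in terms of the operator. -/
def divE : Module.End F (SuperAlg F m n) →ₗ[F] SuperAlg F m n :=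
  div ∘ₗ LinearMap.pi fun r => LinearMap.applyₗ (x F r)

theorem divE_apply (E : Module.End F (SuperAlg F m n)) :
    divE E = ∑ r, D F r (sgn (tau r) (E (x F r))) := div_apply _

theorem divE_eq_zero [Fact p.Prime] [CharP F p] (hE : E ∈ evenS F n p t) : divE E = 0 := by
  obtain ⟨f, ⟨-, hf⟩, rfl⟩ := S_le_Sbar p t hE.1
  have : (fun r => vf f (x F r)) = f := funext fun r => vf_x f r
  change div (fun r => vf f (x F r)) = 0
  rw [this]
  exact hf

theorem divE_toral (i : Fin m) : divE (toral F (.inl i) : Module.End F (SuperAlg F m n)) = 1 := by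
  rw [divE_apply, Finset.sum_eq_single (.inl i)]
  · rw [toral, fld_x, if_pos rfl, tau, sgn_zero, D_x, if_pos rfl]
  · intro r _ hr
    rw [toral, fld_x, if_neg (Ne.symm hr), map_zero, map_zero]
  · simp

theorem toral_x (q r : Fin m ⊕ Fin n) :
    toral F q (x F r) = (if r = q then 1 else 0 : F) • x F r := by
  rw [toral, fld_x]
  by_cases h : r = q
  · subst h; simp
  · simp [h, Ne.symm h]

theorem divE_lie_toral (q : Fin m ⊕ Fin n) (E : Module.End F (SuperAlg F m n)) :
    divE ⁅toral F q, E⁆ = toral F q (divE E) := by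
  rw [divE_apply, divE_apply, map_sum]
  refine Finset.sum_congr rfl fun r _ => ?_
  rw [lie_apply, toral_x, map_smul, map_sub, map_sub, sgn_toral, D_toral, map_smul, map_smul,
    add_sub_cancel_right]

theorem divE_lie_D (i : Fin m) (hE : E ∈ evenW F n p t) :
    divE ⁅(D F (.inl i) : Module.End F (SuperAlg F m n)), E⁆ = D F (.inl i) (divE E) := by
  rw [divE_apply, divE_apply, map_sum]
  refine Finset.sum_congr rfl fun r _ => ?_
  rw [lie_D_apply i hE, sgn_D, D_comm (.inl i) r]
  simp [tau]

/-- The normalizer of `𝒮` in the even part of `W(m, n; t)`: if `E` normalizes `𝒮` then `div E` is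
annihilated by the `D_i` and the torus of `𝒮`, so it is a scalar. -/
theorem mem_of_lie_mem [Fact p.Prime] [CharP F p] (h2 : (2 : F) ≠ 0) (hm : 0 < m) (hn : 0 < n)
    (ht : ∀ i, 1 ≤ t i) (hE : E ∈ evenW F n p t) (h : ∀ y ∈ evenS F n p t, ⁅E, y⁆ ∈ evenS F n p t) :
    E ∈ evenSbar F n p t ⊔ torus F m n := by
  let i0 : Fin m := ⟨0, hm⟩
  let k0 : Fin n := ⟨0, hn⟩
  have h' : ∀ y ∈ evenS F n p t, divE ⁅y, E⁆ = 0 := by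
    intro y hy
    rw [← lie_skew, map_neg, divE_eq_zero (h y hy), neg_zero]
  have hD : ∀ i : Fin m, D F (.inl i) (divE E) = 0 := by
    intro i
    rw [← divE_lie_D i hE, h' _ (D_mem h2 i k0)]
  have hu := eq_one_tmul_of_D hD
  obtain ⟨c, hc⟩ := exists_smul_one_of_dgen (u := cf 0 (divE E)) fun k => by
    have e := h' _ (hfld_mem h2 ht i0 k)
    rw [hfld_eq_toral, add_lie, map_add, divE_lie_toral, divE_lie_toral, ← LinearMap.add_apply,
      ← hfld_eq_toral, hu, hfld_one_tmul] at e
    exact dgen_eq_zero_of_gen_dgen (one_tmul_inj (m := m) (e.trans (TensorProduct.tmul_zero _ _).symm))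
  have hG : E - c • toral F (.inl i0) ∈ evenW F n p t :=
    sub_mem hE (Submodule.smul_mem _ _ (toral_mem_evenW ht _))
  have hdiv : divE (E - c • toral F (.inl i0)) = 0 := by
    rw [map_sub, map_smul, divE_toral, hu, hc, TensorProduct.tmul_smul,
      ← Algebra.TensorProduct.one_def, sub_self]
  rw [← sub_add_cancel E (c • toral F (.inl i0))]
  refine Submodule.add_mem_sup ⟨⟨_, ⟨fun r _ => (hG.2 r).1, hdiv⟩, hG.1.symm⟩,
    evenW_le_evenEnd h2 i0 k0 hG⟩ (Submodule.smul_mem _ _ (toral_mem_torus _))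

end SuperAlg

/-! ### The derivation algebra -/

section

variable {F : Type*} [Field F] {A : Type*} [LieRing A] [LieAlgebra F A]

theorem adOn_mem_derSpace (L : LieSubalgebra F A) {e : A} (he : ∀ y ∈ L, ⁅e, y⁆ ∈ L) :
    adOn L e ∈ derSpace L := by
  let f : L →ₗ[F] L := (adOn L e).codRestrict L.toSubmodule fun y => he y y.2
  refine ⟨LieDerivation.mk f fun a b => Subtype.ext ?_, rfl⟩
  change ⁅e, ⁅(a : A), (b : A)⁆⁆ = ⁅(a : A), ⁅e, (b : A)⁆⁆ - ⁅(b : A), ⁅e, (a : A)⁆⁆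
  rw [leibniz_lie, ← lie_skew (b : A) ⁅e, (a : A)⁆, sub_neg_eq_add, add_comm]

/-- A derivation of a subalgebra extends to a linear map on the ambient Lie algebra. -/
theorem exists_of_mem_derSpace (L : LieSubalgebra F A) {f : L →ₗ[F] A} (hf : f ∈ derSpace L) :
    ∃ φ : Module.End F A, f = restrictTo L φ ∧ (∀ y ∈ L, φ y ∈ L) ∧
      ∀ y ∈ L, ∀ z ∈ L, φ ⁅y, z⁆ = ⁅φ y, z⁆ + ⁅y, φ z⁆ := by
  obtain ⟨δ, rfl⟩ := hf
  obtain ⟨φ, hφ⟩ := LinearMap.exists_extend (p := L.toSubmodule)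
    (L.toSubmodule.subtype ∘ₗ (δ : L →ₗ[F] L))
  have h : ∀ y : L, φ y = (δ y : A) := fun y => LinearMap.congr_fun hφ y
  refine ⟨φ, LinearMap.ext fun y => (h y).symm, fun y hy => ?_, fun y hy z hz => ?_⟩
  · rw [h ⟨y, hy⟩]; exact (δ _).2
  · have e := congrArg (Subtype.val : L → A) (δ.apply_lie_eq_sub ⟨y, hy⟩ ⟨z, hz⟩)
    rw [← h] at e
    refine e.trans ?_
    rw [h ⟨y, hy⟩, h ⟨z, hz⟩]
    change ⁅y, (δ ⟨z, hz⟩ : A)⁆ - ⁅z, (δ ⟨y, hy⟩ : A)⁆ = _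
    rw [← lie_skew z, sub_neg_eq_add, add_comm]

theorem restrictTo_mem_of_eq (L : LieSubalgebra F A) {φ : Module.End F A} {e e' : A}
    (h : ∀ y ∈ L, φ y = ⁅e, y⁆ + ⁅e', y⁆) {P Q : Submodule F (L →ₗ[F] A)} (hP : adOn L e ∈ P)
    (hQ : adOn L e' ∈ Q) : restrictTo L φ ∈ P ⊔ Q := by
  have : restrictTo L φ = adOn L e + adOn L e' := LinearMap.ext fun y => h y y.2
  rw [this]
  exact Submodule.add_mem_sup hP hQ

end

namespace SuperAlg

open DividedPower

variable {F : Type*} [Field F] {m n p : ℕ} {t : Fin m → ℕ}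

variable (n p t) in
/-- The map `c ↦ ∑ c_ir D_i^(p^r)`. -/
def powMap : (Fin m → ℕ → F) →ₗ[F] Module.End F (SuperAlg F m n) where
  toFun c := powD n p t c
  map_add' c d := by
    simp only [powD, ← Finset.sum_add_distrib]
    exact Finset.sum_congr rfl fun i _ => Finset.sum_congr rfl fun r _ => add_smul_end _ _ _
  map_smul' a c := by
    simp only [powD, Finset.smul_sum]
    exact Finset.sum_congr rfl fun i _ => Finset.sum_congr rfl fun r _ =>
      mul_smul a (c i r) ((D F (.inl i) : Module.End F (SuperAlg F m n)) ^ p ^ r)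

theorem powD_single {i : Fin m} {r : ℕ} (hr : 1 ≤ r) (hrt : r < t i) :
    powD n p t (fun j s => if j = i ∧ s = r then (1 : F) else 0) = D F (.inl i) ^ p ^ r := by
  rw [powD, Finset.sum_eq_single i, Finset.sum_eq_single r]
  · rw [if_pos ⟨rfl, rfl⟩]; exact one_smul F (D F (.inl i) ^ p ^ r : Module.End F (SuperAlg F m n))
  · intro s _ hs
    rw [if_neg fun h => hs h.2]
    exact zero_smul F (D F (.inl i) ^ p ^ s : Module.End F (SuperAlg F m n))
  · intro h; exact absurd (Finset.mem_Ico.2 ⟨hr, hrt⟩) h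
  · intro j _ hj
    refine Finset.sum_eq_zero fun s _ => ?_
    rw [if_neg fun h => hj h.1]
    exact zero_smul F (D F (.inl j) ^ p ^ s : Module.End F (SuperAlg F m n))
  · simp

variable [Fact p.Prime] [CharP F p]

theorem restrictTo_ad_pow (i : Fin m) (r : ℕ) : restrictTo (evenS F n p t)
      (LieAlgebra.ad F (Module.End F (SuperAlg F m n)) (D F (.inl i)) ^ p ^ r)
      = adOn (evenS F n p t) (D F (.inl i) ^ p ^ r) :=
  congrArg (restrictTo (evenS F n p t)) (ad_pow_char _ r)

theorem exists_of_mem_adPowers {f : evenS F n p t →ₗ[F] Module.End F (SuperAlg F m n)}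
    (hf : f ∈ adPowers F n p t) :
    ∃ c : Fin m → ℕ → F, f = adOn (evenS F n p t) (powD n p t c) := by
  have h : adPowers F n p t ≤ LinearMap.range (adOn (evenS F n p t) ∘ₗ powMap n p t) := by
    refine Submodule.span_le.2 ?_
    rintro _ ⟨i, r, hr, hrt, rfl⟩
    exact ⟨_, (congrArg (adOn (evenS F n p t)) (powD_single hr hrt)).trans
      (restrictTo_ad_pow i r).symm⟩
  obtain ⟨c, hc⟩ := h hf
  exact ⟨c, hc.symm⟩

theorem adOn_powD_mem (c : Fin m → ℕ → F) :
    adOn (evenS F n p t) (powD n p t c) ∈ adPowers F n p t := by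
  have h : ∀ (i : Fin m) (r : ℕ), 1 ≤ r → r < t i →
      (D F (.inl i) : Module.End F (SuperAlg F m n)) ^ p ^ r
        ∈ (adPowers F n p t).comap (adOn (evenS F n p t)) := fun i r hr hrt =>
    Submodule.subset_span ⟨i, r, hr, hrt, (restrictTo_ad_pow i r).symm⟩
  refine Submodule.mem_comap.1 (Submodule.sum_mem _ fun i _ => Submodule.sum_mem _ fun r hr => ?_)
  exact Submodule.smul_mem _ _ (h i r (Finset.mem_Ico.1 hr).1 (Finset.mem_Ico.1 hr).2)

theorem derSpace_le (hp : 3 < p) (hm : 3 ≤ m) (hn : 3 ≤ n) (ht : ∀ i, 1 ≤ t i) :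
    derSpace (evenS F n p t) ≤ adPart F n p t ⊔ adPowers F n p t := by
  intro f hf
  have h2 : (2 : F) ≠ 0 := two_ne_zero_of_char p hp
  obtain ⟨φ, rfl, hmem, hleib⟩ := exists_of_mem_derSpace _ hf
  have hφ : IsDer n p t φ := ⟨fun y hy => evenS_le_evenW (hmem y hy), hleib⟩
  obtain ⟨E, hE, c, h⟩ := hφ.exists_eq hp hm hn ht
  have hEn : E ∈ evenSbar F n p t ⊔ torus F m n := by
    refine mem_of_lie_mem h2 (by omega) (by omega) ht hE fun y hy => ?_
    rw [eq_sub_of_add_eq (h y hy).symm]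
    exact sub_mem (hmem y hy) (lie_powD_mem h2 ⟨0, by omega⟩ c hy)
  exact restrictTo_mem_of_eq _ h (Submodule.mem_map_of_mem hEn) (adOn_powD_mem c)

theorem le_derSpace (hp : 3 < p) (hm : 3 ≤ m) (hn : 3 ≤ n) (ht : ∀ i, 1 ≤ t i) :
    adPart F n p t ⊔ adPowers F n p t ≤ derSpace (evenS F n p t) := by
  have h2 : (2 : F) ≠ 0 := two_ne_zero_of_char p hp
  let i0 : Fin m := ⟨0, by omega⟩
  let k0 : Fin n := ⟨0, by omega⟩
  refine sup_le (Submodule.map_le_iff_le_comap.2 (sup_le (fun E hE => ?_)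
    (Submodule.span_le.2 ?_))) fun f hf => ?_
  · exact adOn_mem_derSpace _ fun y hy => lie_evenSbar_mem h2 i0 k0 hE hy
  · rintro _ ⟨q, rfl⟩
    exact adOn_mem_derSpace _ fun y hy => lie_toral_mem h2 ht i0 k0 q hy
  · obtain ⟨c, rfl⟩ := exists_of_mem_adPowers hf
    exact adOn_mem_derSpace _ fun y hy => lie_powD_mem h2 k0 c hy

/-- If `E` agrees with `∑ c_ir D_i^(p^r)` on `𝒮` then it has constant coefficients, so that `E` maps
`x_i^(p^r)` to an element without constant term; on the other hand, the constant term of the value of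
`∑ c_ir D_i^(p^r)` is `c_ir`. -/
theorem powD_coeff_eq_zero (h2 : (2 : F) ≠ 0) (hm : 2 ≤ m) (hn : 0 < n)
    {E : Module.End F (SuperAlg F m n)} (hE : E ∈ evenW F n p t) {c : Fin m → ℕ → F}
    (h : ∀ y ∈ evenS F n p t, ⁅E, y⁆ = ⁅powD n p t c, y⁆) {i : Fin m} {r : ℕ} (hr : 1 ≤ r)
    (hrt : r < t i) : c i r = 0 := by
  have hpp := (Fact.out : p.Prime)
  let k0 : Fin n := ⟨0, hn⟩
  have hpos : 0 < p ^ r := pow_pos hpp.pos r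
  have hC : ConstCoef E := by
    intro j
    rw [← lie_skew, h _ (D_mem h2 j k0), lie_powD_of_lie_D, neg_zero]
    intro q
    rw [lie_D_D, lie_zero]
  obtain ⟨j, hij⟩ : ∃ j, j ≠ i := by
    by_contra! hall
    have h0 := hall ⟨0, by omega⟩
    have h1 := hall ⟨1, by omega⟩
    rw [← h0] at h1
    simp at h1
  have ha : mono F (Pi.single i (p ^ r)) ∈ tr p t := mono_mem_tr fun q => by
    by_cases hq : q = i
    · subst hq
      have := (Nat.pow_lt_pow_iff_right hpp.one_lt).2 hrt
      simp; omega
    · simp [hq]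
  have hz : zfld (mono F (Pi.single i (p ^ r))) 1 j k0
      = (fld (mono F (Pi.single i (p ^ r)) ⊗ₜ 1) (.inl j) : Module.End F (SuperAlg F m n)) := by
    rw [zfld, partialHom_mono, if_pos (by simp [hij]), TensorProduct.zero_tmul, fld_zero, add_zero]
  have e := LinearMap.congr_fun (h _ (zfld_mem (n := n) h2 ha j (s := k0) (map_one _) (dgen_one k0)))
    (x F (.inl j))
  rw [hz, lie_powD_fld, fld_x, if_pos rfl, powD_tmul, lie_apply, fld_x, if_pos rfl, fld_apply,
    apply_x_eq hE hC, D_inl, partial_one, TensorProduct.zero_tmul, mul_zero, sub_zero,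
    evenW_apply hE, Finset.sum_eq_single (.inl i)] at e
  · have e := congrArg (cf 0) e
    have h1 : (Pi.single i (p ^ r) : Fin m → ℕ) - Pi.single i 1 ≠ 0 := by
      intro h0
      have h0 := congrFun h0 i
      have : 2 ≤ p ^ r := hpp.two_le.trans (Nat.le_self_pow (by omega) p)
      simp at h0
      omega
    rw [apply_x_eq hE hC, D_inl, partialHom_mono, if_neg (by simpa using hpos.ne'),
      Algebra.TensorProduct.tmul_mul_tmul, one_mul, mul_one, cf_tmul, co_zero_mono h1, zero_smul,
      cf_tmul, co_zero_powP c i hr hrt] at e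
    exact (smul_eq_zero.1 e.symm).resolve_right one_ne_zero
  · intro q _ hq
    cases q with
    | inl q =>
      have hq : q ≠ i := by simpa using hq
      rw [D_inl, partialHom_mono, if_pos (by simp [hq]), TensorProduct.zero_tmul, mul_zero]
    | inr k => rw [D_inr_tmul, dgen_one, TensorProduct.tmul_zero, mul_zero]
  · simp

theorem disjoint_adPart_adPowers (hp : 3 < p) (hm : 3 ≤ m) (hn : 3 ≤ n) (ht : ∀ i, 1 ≤ t i) :
    Disjoint (adPart F n p t) (adPowers F n p t) := by
  have h2 : (2 : F) ≠ 0 := two_ne_zero_of_char p hp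
  rw [Submodule.disjoint_def]
  intro f hf hf'
  obtain ⟨E, hE, rfl⟩ := hf
  obtain ⟨c, hc⟩ := exists_of_mem_adPowers hf'
  have hEW : E ∈ evenW F n p t := by
    refine (sup_le Sbar_inf_evenEnd_le (Submodule.span_le.2 ?_) :
      evenSbar F n p t ⊔ torus F m n ≤ evenW F n p t) hE
    rintro _ ⟨q, rfl⟩
    exact toral_mem_evenW ht q
  have h : ∀ y ∈ evenS F n p t, ⁅E, y⁆ = ⁅powD n p t c, y⁆ := fun y hy =>
    LinearMap.congr_fun hc ⟨y, hy⟩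
  have h0 : powD n p t c = 0 := by
    rw [powD]
    refine Finset.sum_eq_zero fun i _ => Finset.sum_eq_zero fun r hr => ?_
    rw [powD_coeff_eq_zero h2 (by omega) (by omega) hEW h (Finset.mem_Ico.1 hr).1
      (Finset.mem_Ico.1 hr).2]
    exact zero_smul F (D F (.inl i) ^ p ^ r : Module.End F (SuperAlg F m n))
  rw [hc, h0, map_zero]

end SuperAlg

end

theorem theorem4p3p7 {F : Type*} [Field F] (p : ℕ) [Fact p.Prime] [CharP F p] (hp : 3 < p)
    {m n : ℕ} (hm : 3 ≤ m) (hn : 3 ≤ n) (t : Fin m → ℕ) (ht : ∀ i, 1 ≤ t i) :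
    derSpace (SuperAlg.evenS F n p t) = SuperAlg.adPart F n p t ⊔ SuperAlg.adPowers F n p t ∧
      Disjoint (SuperAlg.adPart F n p t) (SuperAlg.adPowers F n p t) :=
  ⟨le_antisymm (SuperAlg.derSpace_le hp hm hn ht) (SuperAlg.le_derSpace hp hm hn ht),
    SuperAlg.disjoint_adPart_adPowers hp hm hn ht⟩
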